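/- **Setting.** Let $p$ be a prime, $\mathbf F_q$ a finite field of characteristic $p$ with $q$ elements, $\mathbf C_p$ the completion of an algebraic closure of $\mathbf Q_p$, and $\zeta_p\in\mathbf C_p$ a primitive $p$-th root of unity. For a Laurent polynomial $f\in\mathbf F_q[x_1^{\pm1},\dots,x_n^{\pm1}]$ put $$S_k^*(f)=\sum_{x\in(\mathbf F_{q^k}^*)^n}\zeta_p^{\mathrm{Tr}_{\mathbf F_{q^k}/\mathbf F_p}f(x)},\qquad L^*(f,t)=\exp\Big(\sum_{k\ge1}S_k^*(f)\frac{t^k}{k}\Big).$$ Let $\Delta=\Delta(f)\subset\mathbf R^n$ be the convex hull of the origin and the exponents of $f$. For $u\in\mathbf R^n$ let $w(u)$ be the smallest real $c\ge0$ with $u\in c\Delta$ ($w(u)=\infty$ if there is none). Let $D=D(\Delta)$ be the least common denominator of the coefficients $e_i$ of the equations $\sum_i e_iX_i=1$ of all codimension $1$ faces of $\Delta$ not containing the origin. Let $W(k)=\#\{u\in\mathbf Z^n: w(u)=k/D\}$ and $H(k)=\sum_{i=0}^n(-1)^i\binom ni W(k-iD)$. The Hodge polygon of $\Delta$ is the convex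 polygon with vertices $(0,0)$ and $\big(\sum_{k=0}^mH(k),\frac1D\sum_{k=0}^mkH(k)\big)$, $m=0,1,\dots,nD$. The Newton polygon, computed with respect to $q$, of a power series $\sum_k c_kt^k$ over $\mathbf C_p$ with $c_0=1$ is the lower convex closure of the points $(k,\mathrm{ord}_q c_k)$, where $\mathrm{ord}_q$ is the $p$-adic valuation with $\mathrm{ord}_q q=1$. One says that $f$ is *ordinary over $\mathbf F_q$* if the Newton polygon of $L^*(f,t)^{(-1)^{n-1}}$, computed with respect to $q$, coincides with the Hodge polygon of $\Delta(f)$. **Theorem 3.4.** Let $M=(V_1,\dots,V_n)$ be a nonsingular $n\times n$ integer matrix with columns $V_1,\dots,V_n$ and suppose that $p$ is relatively prime to $\det M$. Let $f=\sum_{j=1}^na_jx^{V_j}$ with $a_j\in\mathbf F_q^*$, so that $\Delta=\Delta(f)$ is the simplex with vertices $0,V_1,\dots,V_n$. Let $S(\Delta)$ be the finite group (under addition modulo $1$) of all $r\in\mathbf Q^n$ with $0\le r_i<1$ and $Mr\in\mathbf Z^n$, let $|r|=r_1+\dots+r_n$, and let $\{pr\}=(\{pr_1\},\dots,\{pr_n\})$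 be the vector of fractional parts. Then $f$ is ordinary over $\mathbf F_q$ if and only if $$|r|=|\{pr\}|\qquad\text{for every } r\in S(\Delta).$$ Equivalently, $f$ is ordinary over $\mathbf F_q$ if and only if $w(u)=w(\{pu\})$ for every lattice point $u\in\mathbf Z^n$ of the fundamental domain $\{\sum_j r_jV_j: 0\le r_j<1\}$ of $\mathbf R^n$ modulo $\mathbf ZV_1+\dots+\mathbf ZV_n$, where $\{pu\}$ is the representative of $pu$ in this fundamental domain. -/

import Mathlib

open scoped Pointwise

noncomputable section

namespace DiagonalLaurent

/-! ### Laurent polynomials, exponential sums and L-functions -/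

/-- Laurent polynomials in `n` variables over `F`: finitely supported functions on the
exponent lattice `ℤⁿ`. -/
abbrev LaurentPoly (F : Type*) [Field F] (n : ℕ) : Type _ := AddMonoidAlgebra F (Fin n → ℤ)

/-- Evaluation of a Laurent polynomial at a point of the torus over an extension `K` of `F`. -/
def evalTorus {F : Type*} [Field F] {n : ℕ} {K : Type*} [Field K] [Algebra F K]
    (f : LaurentPoly F n) (x : Fin n → Kˣ) : K :=
  ∑ v ∈ f.coeff.support, algebraMap F K (f.coeff v) * ((∏ i, x i ^ v i : Kˣ) : K)

section LFunction

variable (p : ℕ) [Fact p.Prime] {F : Type*} [Field F] [Finite F] [CharP F p] {n : ℕ}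

/-- The exponential sum `S_k^*(f) = ∑ ζ ^ Tr_k (f x)`, over all `x` in the `n`-torus over the
extension of `F` of degree `k ≥ 1`, where `Tr_k` is the trace down to `𝔽_p`. -/
def expSum (ζ : ℂ_[p]) (f : LaurentPoly F n) (k : ℕ) [NeZero k] : ℂ_[p] :=
  ∑ᶠ x : Fin n → (FiniteField.Extension F p k)ˣ,
    ζ ^ (Algebra.trace (ZMod p) (FiniteField.Extension F p k) (evalTorus f x)).val

/-- The power series `∑_{k ≥ 1} S_k^*(f) t^k / k`. -/
def logLSeries (ζ : ℂ_[p]) (f : LaurentPoly F n) : PowerSeries ℂ_[p] :=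
  PowerSeries.mk fun
    | 0 => 0
    | k + 1 => expSum p ζ f (k + 1) / ((k + 1 : ℕ) : ℂ_[p])

/-- `logLSeries` has constant term `0`, so it may be substituted into any power series. -/
theorem hasSubst_logLSeries (ζ : ℂ_[p]) (f : LaurentPoly F n) :
    PowerSeries.HasSubst (logLSeries p ζ f) :=
  PowerSeries.HasSubst.of_constantCoeff_zero' (by
    rw [← PowerSeries.coeff_zero_eq_constantCoeff_apply, logLSeries, PowerSeries.coeff_mk])

/-- The L-function `L^*(f, t) = exp (∑_{k ≥ 1} S_k^*(f) t^k / k)`. -/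
def LSeries (ζ : ℂ_[p]) (f : LaurentPoly F n) : PowerSeries ℂ_[p] :=
  (PowerSeries.exp ℂ_[p]).subst (logLSeries p ζ f)

/-- The power `L^*(f, t) ^ ((-1) ^ (n - 1))`. -/
def signedLSeries (ζ : ℂ_[p]) (f : LaurentPoly F n) : PowerSeries ℂ_[p] :=
  if Odd n then LSeries p ζ f else (LSeries p ζ f)⁻¹

end LFunction

/-! ### Newton polygons -/

/-- The convex closure from below of a set of points in the plane, given as the region of all
points on or above it: the convex hull of the vertical rays going up from the points of `S`.
The polygon is the lower boundary of this region. -/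
def lowerConvexClosure (S : Set (ℝ × ℝ)) : Set (ℝ × ℝ) :=
  convexHull ℝ {P | ∃ Q ∈ S, P.1 = Q.1 ∧ Q.2 ≤ P.2}

/-- The `p`-adic valuation of a nonzero `x`, normalized by `ord_q q = 1` for `q` a power of `p`
(the norm of `ℂ_[p]` satisfies `‖p‖ = 1 / p`). -/
def ordQ {p : ℕ} [Fact p.Prime] (q : ℕ) (x : ℂ_[p]) : ℝ := -Real.logb q ‖x‖

/-- The Newton polygon, computed with respect to `q`, of a power series `E`: the convex closure
from below of the points `(k, ord_q a_k)`; coefficients `a_k = 0` have valuation `∞` and do not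
contribute. -/
def newtonPolygon {p : ℕ} [Fact p.Prime] (q : ℕ) (E : PowerSeries ℂ_[p]) : Set (ℝ × ℝ) :=
  lowerConvexClosure
    {P | ∃ k : ℕ, PowerSeries.coeff k E ≠ 0 ∧ P = ((k : ℝ), ordQ q (PowerSeries.coeff k E))}

/-! ### The Newton polyhedron, its weight function and its Hodge polygon -/

/-- The Newton polyhedron `Δ(f)`: the convex hull of the origin and the exponents of `f`. -/
def newtonPolyhedron {F : Type*} [Field F] {n : ℕ} (f : LaurentPoly F n) : Set (Fin n → ℝ) :=
  convexHull ℝ (insert 0 ((fun (v : Fin n → ℤ) (i : Fin n) => (v i : ℝ)) '' (f.coeff.support : Set _)))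

section Polyhedron

variable {n : ℕ} (Δ : Set (Fin n → ℝ))

/-- The weight `w(u)`: the smallest real `c ≥ 0` such that `u ∈ cΔ`, and `∞` if there is none. -/
def weight (u : Fin n → ℝ) : EReal :=
  sInf {c : EReal | ∃ r : ℝ, 0 ≤ r ∧ u ∈ r • Δ ∧ c = (r : EReal)}

/-- `IsFacetEquation Δ e` says that `∑ eᵢ Xᵢ = 1` is the equation of (the hyperplane spanned by)
a face of `Δ` of codimension `1` not containing the origin. As the origin lies in `Δ`, the
polyhedron is then contained in the half-space `∑ eᵢ Xᵢ ≤ 1`. -/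
def IsFacetEquation (e : Fin n → ℚ) : Prop :=
  (∀ x ∈ Δ, ∑ i, (e i : ℝ) * x i ≤ 1) ∧
  {x ∈ Δ | ∑ i, (e i : ℝ) * x i = 1}.Nonempty ∧
  Module.finrank ℝ (vectorSpan ℝ {x ∈ Δ | ∑ i, (e i : ℝ) * x i = 1}) + 1 = n

/-- The denominator `D(Δ)`: the least common denominator of the coefficients of the equations
`∑ eᵢ Xᵢ = 1` of all faces of codimension `1` not containing the origin. -/
def denominator : ℕ :=
  sInf {D : ℕ | 0 < D ∧ ∀ e : Fin n → ℚ, IsFacetEquation Δ e → ∀ i, ∃ z : ℤ, (D : ℚ) * e i = z}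

/-- `W(k)`: the number of lattice points of weight `k / D(Δ)` (it is `0` for `k < 0`). -/
def latticeCount (k : ℤ) : ℕ :=
  Set.ncard {u : Fin n → ℤ |
    weight Δ (fun i => (u i : ℝ)) = (((k : ℝ) / (denominator Δ : ℝ) : ℝ) : EReal)}

/-- `H(k) = ∑_{i=0}^n (-1)^i (n choose i) W(k - i D(Δ))`. -/
def hodgeNumber (k : ℕ) : ℤ :=
  ∑ i ∈ Finset.range (n + 1),
    (-1) ^ i * (n.choose i : ℤ) * (latticeCount Δ ((k : ℤ) - i * denominator Δ) : ℤ)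

/-- The Hodge polygon `HP(Δ)`: the convex polygon with vertices `(0, 0)` and
`(∑_{k=0}^m H(k), (1 / D(Δ)) ∑_{k=0}^m k H(k))` for `m = 0, 1, …, n D(Δ)`. -/
def hodgePolygon : Set (ℝ × ℝ) :=
  lowerConvexClosure (insert (0, 0) {P | ∃ m : ℕ, m ≤ n * denominator Δ ∧
    P = (∑ k ∈ Finset.range (m + 1), (hodgeNumber Δ k : ℝ),
      1 / (denominator Δ : ℝ) * ∑ k ∈ Finset.range (m + 1), (k : ℝ) * (hodgeNumber Δ k : ℝ))})

end Polyhedron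

/-- `f` is ordinary over `F = 𝔽_q`: the Newton polygon of `L^*(f, t) ^ ((-1) ^ (n - 1))`, computed
with respect to `q`, coincides with the Hodge polygon of `Δ(f)`. -/
def IsOrdinary (p : ℕ) [Fact p.Prime] {F : Type*} [Field F] [Finite F] [CharP F p] {n : ℕ}
    (ζ : ℂ_[p]) (f : LaurentPoly F n) : Prop :=
  newtonPolygon (Nat.card F) (signedLSeries p ζ f) = hodgePolygon (newtonPolyhedron f)

/-! ### Diagonal Laurent polynomials and the `p`-action -/

/-- The Laurent polynomial `∑ⱼ aⱼ x^{Vⱼ}`, where `Vⱼ` is the `j`-th column of `M`. -/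
def diagonal {F : Type*} [Field F] {n : ℕ} (M : Matrix (Fin n) (Fin n) ℤ) (a : Fin n → Fˣ) :
    LaurentPoly F n :=
  ∑ j, AddMonoidAlgebra.single (fun i => M i j) (a j : F)

section Action

variable {n : ℕ} (M : Matrix (Fin n) (Fin n) ℤ)

/-- The set `S(Δ)` of rational solutions `r` of `M r ≡ 0 (mod 1)` with `0 ≤ rᵢ < 1`. -/
def solutionSet : Set (Fin n → ℚ) :=
  {r | (∀ i, 0 ≤ r i ∧ r i < 1) ∧
    ∃ u : Fin n → ℤ, (M.map (Int.cast : ℤ → ℚ)).mulVec r = fun i => (u i : ℚ)}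

/-- The `m`-action `r ↦ {m r}`, taking fractional parts coordinatewise. -/
def fracMul (m : ℕ) (r : Fin n → ℚ) : Fin n → ℚ := fun i => Int.fract ((m : ℚ) * r i)

/-- The `m`-action maps `S(Δ)` to itself. -/
theorem fracMul_mem (m : ℕ) {r : Fin n → ℚ} (hr : r ∈ solutionSet M) :
    fracMul m r ∈ solutionSet M := by
  obtain ⟨-, u, hu⟩ := hr
  refine ⟨fun i => ⟨Int.fract_nonneg _, Int.fract_lt_one _⟩,
    fun i => m * u i - ∑ j, M i j * ⌊(m : ℚ) * r j⌋, ?_⟩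
  funext i
  have h := congrFun hu i
  simp only [Matrix.mulVec, dotProduct, Matrix.map_apply] at h ⊢
  push_cast
  rw [← h, Finset.mul_sum, ← Finset.sum_sub_distrib]
  refine Finset.sum_congr rfl fun j _ => ?_
  simp only [fracMul, Int.fract]
  ring

/-- The norm `|r| = r₁ + ⋯ + rₙ`. -/
def rnorm (r : Fin n → ℚ) : ℚ := ∑ i, r i

/-- The coordinates of `x ∈ ℝⁿ` with respect to the columns of the (nonsingular) matrix `M`. -/
def coords (x : Fin n → ℝ) : Fin n → ℝ := (M.map (Int.cast : ℤ → ℝ))⁻¹.mulVec x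

/-- The fundamental domain `{∑ rⱼ Vⱼ | 0 ≤ rⱼ < 1}` of `ℝⁿ` modulo the lattice spanned by the
columns `Vⱼ` of `M`. -/
def fundamentalDomain : Set (Fin n → ℝ) := {x | ∀ j, 0 ≤ coords M x j ∧ coords M x j < 1}

/-- The representative `{x}` in the fundamental domain of `x ∈ ℝⁿ` modulo the lattice spanned by
the columns of `M`. -/
def latticeFract (x : Fin n → ℝ) : Fin n → ℝ :=
  (M.map (Int.cast : ℤ → ℝ)).mulVec fun j => Int.fract (coords M x j)

end Action

end DiagonalLaurent

end

/-! Write q = p^e. Expand the additive character over the field with q^k elements in powers of the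
Teichmüller character and sum over the torus. Orthogonality keeps exactly the exponent vectors a
with M a ≡ 0 mod q^k - 1, i.e. the points r = a/(q^k - 1) of S(Δ) with {q^k r} = r. Up to the common
sign (-1)^n, such an r contributes a product of negated Gauss sums times roots of unity coming from
the coefficients (`sum_traceChar_eq_sum_eigenvalue`). By the Hasse–Davenport relation the
contribution over the extension of degree dm is the m-th power of the one over degree d, and it is
constant on the cycles of r ↦ {qr}. Comparing logarithmic derivatives, L^*(f,t)^((-1)^(n-1)) is the
polynomial ∏ (1 - b t^d) over these cycles, d being the length (`derivative_cycleProd`).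
Stickelberger's theorem gives |b|: every r accounts for one unit of length of the Newton polygon, of
slope s(r), the average of |{p^i r}| over the p-orbit of r.

On the Hodge side, a lattice point of the cone over Δ is uniquely a lattice point of the fundamental
domain plus a combination of the V_j with coefficients in ℕ. Hence ∑ W(k) T^k = (1 - T^D)^(-n) ∑_r
T^(D|r|), and H(k) is the number of r with D|r| = k (`hodgeNumber_diagonal`): the slopes are the
numbers |r|.

Both polygons are determined by their support functions l ↦ min (y - l x), which are -∑ max(0, l -
s(r)) and -∑ max(0, l - |r|). For the Newton polygon this is read off from Gauss norms, which are
multiplicative. Since s is an orbit average of |r| and x ↦ max(0, l - x) is convex, equality for all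
l is the equality case of Jensen's inequality, which forces |r| to be constant on p-orbits
(`sum_max_average_eq_iff`). The second form of the criterion is the first in the coordinates u = M
r, where w(u) = |r|. -/

noncomputable section

/-! ### The Hasse–Davenport relation, from an Euler product over monic polynomials -/

namespace HasseDavenport

open Polynomial UniqueFactorizationMonoid

section Weight

variable {F : Type*} [Field F] {R : Type*} [CommRing R]

/-- The multiplicative weight `χ((-1)^d c_0) ψ(-c_{d-1})` of a monic polynomial of degree `d`. -/
def polyWeight (χ : MulChar F R) (ψ : AddChar F R) (f : F[X]) : R :=
  χ ((-1) ^ f.natDegree * f.coeff 0) * ψ (-f.nextCoeff)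

theorem polyWeight_one (χ : MulChar F R) (ψ : AddChar F R) : polyWeight χ ψ 1 = 1 := by
  have h : (1 : F[X]).nextCoeff = 0 := nextCoeff_C_eq_zero 1
  simp [polyWeight, h]

/-- The arguments of χ and ψ are the product and the sum of the roots, hence multiplicative and
additive in the polynomial. This gives the generating series of `monicSum` an Euler product. -/
theorem polyWeight_mul (χ : MulChar F R) (ψ : AddChar F R) {f g : F[X]} (hf : f.Monic)
    (hg : g.Monic) : polyWeight χ ψ (f * g) = polyWeight χ ψ f * polyWeight χ ψ g := by
  have h : (-1 : F) ^ (f * g).natDegree * (f * g).coeff 0 =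
      ((-1) ^ f.natDegree * f.coeff 0) * ((-1) ^ g.natDegree * g.coeff 0) := by
    rw [hf.natDegree_mul hg, mul_coeff_zero, pow_add]; ring
  rw [polyWeight, h, hf.nextCoeff_mul hg, neg_add, map_mul, AddChar.map_add_eq_mul]
  simp only [polyWeight]; ring

theorem polyWeight_pow (χ : MulChar F R) (ψ : AddChar F R) {f : F[X]} (hf : f.Monic) (i : ℕ) :
    polyWeight χ ψ (f ^ i) = polyWeight χ ψ f ^ i := by
  induction i with
  | zero => simp [polyWeight_one]
  | succ i ih => rw [pow_succ, polyWeight_mul χ ψ (hf.pow i) hf, ih, pow_succ]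

end Weight

section Finite

variable {F : Type*} [Field F] [Finite F]

theorem finite_monic (k : ℕ) : {f : F[X] | f.Monic ∧ f.natDegree = k}.Finite := by
  refine Set.Finite.of_finite_image (f := fun f : F[X] => fun i : Fin (k + 1) => f.coeff i)
    (Set.toFinite _) ?_
  rintro f ⟨-, hf⟩ g ⟨-, hg⟩ h
  ext i
  by_cases hi : i < k + 1
  · exact congrFun h ⟨i, hi⟩
  · rw [coeff_eq_zero_of_natDegree_lt (by omega), coeff_eq_zero_of_natDegree_lt (by omega)]

variable (F) in
/-- The monic polynomials of degree `k`. -/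
def monics (k : ℕ) : Finset F[X] := (finite_monic k).toFinset

@[simp] theorem mem_monics {k : ℕ} {f : F[X]} : f ∈ monics F k ↔ f.Monic ∧ f.natDegree = k := by
  simp [monics]

open Classical in
variable (F) in
/-- The monic irreducible polynomials of degree at most `k`. -/
def primesUpTo (k : ℕ) : Finset F[X] :=
  ((Finset.Icc 1 k).biUnion (monics F)).filter Irreducible

theorem mem_primesUpTo {k : ℕ} {P : F[X]} :
    P ∈ primesUpTo F k ↔ P.Monic ∧ Irreducible P ∧ P.natDegree ≤ k := by
  simp only [primesUpTo, Finset.mem_filter, Finset.mem_biUnion, Finset.mem_Icc, mem_monics]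
  constructor
  · rintro ⟨⟨e, he, hP, rfl⟩, hi⟩
    exact ⟨hP, hi, he.2⟩
  · rintro ⟨hP, hi, hk⟩
    exact ⟨⟨_, ⟨hi.natDegree_pos, hk⟩, hP, rfl⟩, hi⟩

open Classical in
-- The degree of f is the sum of v_P(f) deg P, and v_P(f) is the number of i ≥ 1 with P^i dividing
-- f. This is the polynomial analogue of log n = ∑ Λ(d) over the divisors d of n.
theorem sum_prime_powers_dvd {k : ℕ} {f : F[X]} (hf : f.Monic) (hk : f.natDegree = k) :
    ∑ P ∈ primesUpTo F k, ∑ i ∈ Finset.Icc 1 k, (if P ^ i ∣ f then P.natDegree else 0) = k := by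
  have hmonic : ∀ P ∈ normalizedFactors f, P.Monic := fun P hP => by
    have h := normalize_normalized_factor P hP
    rw [← h]
    exact monic_normalize (irreducible_of_normalized_factor P hP).ne_zero
  have hprod : (normalizedFactors f).prod = f :=
    eq_of_monic_of_associated
      (by simpa using monic_multiset_prod_of_monic (normalizedFactors f) id hmonic) hf
      (prod_normalizedFactors hf.ne_zero)
  have hdeg : ((normalizedFactors f).map natDegree).sum = k := by
    rw [← natDegree_multiset_prod_of_monic _ hmonic, hprod, hk]
  have hcount : ∀ P ∈ primesUpTo F k,
      ∑ i ∈ Finset.Icc 1 k, (if P ^ i ∣ f then P.natDegree else 0) =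
        (normalizedFactors f).count P * P.natDegree := by
    intro P hP
    obtain ⟨hPm, hPi, -⟩ := mem_primesUpTo.1 hP
    have hmul := emultiplicity_eq_count_normalizedFactors hPi hf.ne_zero
    rw [hPm.normalize_eq_self] at hmul
    have hdvd : ∀ i, P ^ i ∣ f ↔ i ≤ (normalizedFactors f).count P := fun i => by
      rw [pow_dvd_iff_le_emultiplicity, hmul, Nat.cast_le]
    have hle : (normalizedFactors f).count P ≤ k := by
      have h1 := natDegree_le_of_dvd ((hdvd _).2 le_rfl) hf.ne_zero
      rw [natDegree_pow, hk] at h1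
      exact le_trans (Nat.le_mul_of_pos_right _ hPi.natDegree_pos) h1
    simp_rw [hdvd]
    rw [← Finset.sum_filter, Finset.sum_const, smul_eq_mul]
    congr 1
    have : Finset.filter (fun i => i ≤ (normalizedFactors f).count P) (Finset.Icc 1 k) =
        Finset.Icc 1 ((normalizedFactors f).count P) := by
      ext i; simp only [Finset.mem_filter, Finset.mem_Icc]; omega
    rw [this]; simp
  rw [Finset.sum_congr rfl hcount]
  rw [Finset.sum_multiset_map_count] at hdeg
  simp only [smul_eq_mul] at hdeg
  refine Eq.trans (Finset.sum_subset ?_ ?_).symm hdeg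
  · intro P hP
    rw [Multiset.mem_toFinset] at hP
    refine mem_primesUpTo.2 ⟨hmonic P hP, irreducible_of_normalized_factor P hP, ?_⟩
    rw [← hk]
    exact natDegree_le_of_dvd (dvd_of_mem_normalizedFactors hP) hf.ne_zero
  · intro P _ hP
    rw [Multiset.mem_toFinset] at hP
    rw [Multiset.count_eq_zero_of_notMem hP, zero_mul]

end Finite

section Sums

variable {F : Type*} [Field F] [Finite F] {R : Type*} [CommRing R]

/-- The sum of the weights of all monic polynomials of degree `k`. -/
def monicSum (χ : MulChar F R) (ψ : AddChar F R) (k : ℕ) : R :=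
  ∑ f ∈ monics F k, polyWeight χ ψ f

open Classical in
/-- The sum of `deg P * λ(P) ^ (k / deg P)` over the primes `P` of degree dividing `k`. -/
def primeSum (χ : MulChar F R) (ψ : AddChar F R) (k : ℕ) : R :=
  ∑ P ∈ (primesUpTo F k).filter (fun P => P.natDegree ∣ k),
    (P.natDegree : R) * polyWeight χ ψ P ^ (k / P.natDegree)

theorem monicSum_zero (χ : MulChar F R) (ψ : AddChar F R) : monicSum χ ψ 0 = 1 := by
  have : monics F 0 = {1} := by
    ext f
    simp only [mem_monics, Finset.mem_singleton]
    exact ⟨fun h => h.1.natDegree_eq_zero.1 h.2, by rintro rfl; simp⟩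
  rw [monicSum, this, Finset.sum_singleton, polyWeight_one]

theorem monicSum_one [Fintype F] (χ : MulChar F R) (ψ : AddChar F R) :
    monicSum χ ψ 1 = gaussSum χ ψ := by
  rw [monicSum, gaussSum]
  symm
  refine Finset.sum_bij (fun c _ => X - C c) ?_ ?_ ?_ ?_
  · intro c _
    simp [monic_X_sub_C]
  · intro c _ d _ h
    simpa using h
  · intro f hf
    obtain ⟨hm, hd⟩ := mem_monics.1 hf
    refine ⟨-f.coeff 0, Finset.mem_univ _, ?_⟩
    have := hm.eq_X_add_C hd
    rw [C_neg, sub_neg_eq_add]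
    exact this.symm
  · intro c _
    simp [polyWeight]

/-- Shifting the coefficient of X^(k-1) by -c permutes the monic polynomials and multiplies each
weight by ψ(c) ≠ 1. As k ≥ 2, the constant coefficient, and so the χ factor, is untouched. -/
theorem monicSum_eq_zero [IsDomain R] (χ : MulChar F R) {ψ : AddChar F R} (hψ : ψ ≠ 1) {k : ℕ}
    (hk : 2 ≤ k) : monicSum χ ψ k = 0 := by
  obtain ⟨c, hc⟩ := AddChar.ne_one_iff.1 hψ
  have hdeg : ∀ {f : F[X]} (a : F), f.Monic → f.natDegree = k →
      ((f + C a * X ^ (k - 1)).Monic ∧ (f + C a * X ^ (k - 1)).natDegree = k) := by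
    intro f a hf hfk
    have hlt : (C a * X ^ (k - 1)).degree < f.degree := by
      rw [degree_eq_natDegree hf.ne_zero, hfk]
      refine lt_of_le_of_lt (degree_C_mul_X_pow_le _ _) ?_
      exact_mod_cast (by omega : k - 1 < k)
    exact ⟨hf.add_of_left hlt, by rw [natDegree_add_eq_left_of_degree_lt hlt, hfk]⟩
  have key : monicSum χ ψ k = ψ c * monicSum χ ψ k := by
    rw [monicSum, Finset.mul_sum]
    symm
    refine Finset.sum_bij (fun f _ => f + C (-c) * X ^ (k - 1)) ?_ ?_ ?_ ?_
    · intro f hf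
      rw [mem_monics] at hf ⊢
      exact hdeg _ hf.1 hf.2
    · intro f _ g _ h
      exact add_right_cancel h
    · intro f hf
      rw [mem_monics] at hf
      exact ⟨f + C c * X ^ (k - 1), mem_monics.2 (hdeg _ hf.1 hf.2), by simp⟩
    · intro f hf
      rw [mem_monics] at hf
      have h2 := hdeg (-c) hf.1 hf.2
      have hk0 : k ≠ 0 := by omega
      rw [polyWeight, polyWeight, h2.2, hf.2,
        nextCoeff_of_natDegree_pos (by omega), nextCoeff_of_natDegree_pos (by omega), h2.2, hf.2]
      have h0 : ¬ (0 = k - 1) := by omega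
      simp only [coeff_add, coeff_C_mul, coeff_X_pow, h0, if_true, if_false, mul_zero, add_zero,
        mul_one, neg_add, neg_neg, AddChar.map_add_eq_mul]
      ring
  have : (ψ c - 1) * monicSum χ ψ k = 0 := by rw [sub_mul, one_mul, ← key, sub_self]
  exact (mul_eq_zero.1 this).resolve_left (sub_ne_zero.2 hc)

open Classical in
theorem sum_filter_pow_dvd (χ : MulChar F R) (ψ : AddChar F R) {P : F[X]} (hP : P.Monic)
    {i k : ℕ} (hi : i * P.natDegree ≤ k) :
    ∑ f ∈ (monics F k).filter (fun f => P ^ i ∣ f), polyWeight χ ψ f =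
      polyWeight χ ψ P ^ i * monicSum χ ψ (k - i * P.natDegree) := by
  rw [monicSum, Finset.mul_sum]
  symm
  refine Finset.sum_bij (fun g _ => P ^ i * g) ?_ ?_ ?_ ?_
  · intro g hg
    rw [mem_monics] at hg
    rw [Finset.mem_filter, mem_monics]
    refine ⟨⟨(hP.pow i).mul hg.1, ?_⟩, dvd_mul_right _ _⟩
    rw [(hP.pow i).natDegree_mul hg.1, hP.natDegree_pow, hg.2]
    omega
  · intro g _ h _ e
    exact mul_left_cancel₀ (hP.pow i).ne_zero e
  · intro f hf
    rw [Finset.mem_filter, mem_monics] at hf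
    obtain ⟨⟨hf, hk⟩, g, rfl⟩ := hf
    have hg := (hP.pow i).of_mul_monic_left hf
    refine ⟨g, mem_monics.2 ⟨hg, ?_⟩, rfl⟩
    rw [(hP.pow i).natDegree_mul hg, hP.natDegree_pow] at hk
    omega
  · intro g hg
    rw [mem_monics] at hg
    rw [polyWeight_mul χ ψ (hP.pow i) hg.1, polyWeight_pow χ ψ hP]

theorem sum_multiples (e k : ℕ) (he : 0 < e) (h : ℕ → ℕ → R) :
    ∑ i ∈ (Finset.Icc 1 k).filter (fun i => i * e ≤ k), h i (i * e) =
      ∑ j ∈ (Finset.Icc 1 k).filter (fun j => e ∣ j), h (j / e) j := by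
  refine Finset.sum_bij (fun i _ => i * e) ?_ ?_ ?_ ?_
  · intro i hi
    simp only [Finset.mem_filter, Finset.mem_Icc] at hi ⊢
    exact ⟨⟨Nat.mul_pos hi.1.1 he, hi.2⟩, dvd_mul_left _ _⟩
  · intro i _ j _ hij
    exact Nat.eq_of_mul_eq_mul_right he hij
  · intro j hj
    simp only [Finset.mem_filter, Finset.mem_Icc] at hj
    obtain ⟨hj, i, rfl⟩ := hj
    refine ⟨i, ?_, mul_comm _ _⟩
    simp only [Finset.mem_filter, Finset.mem_Icc]
    rw [mul_comm i e]
    exact ⟨⟨Nat.pos_of_ne_zero (by rintro rfl; simp at hj),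
      le_trans (Nat.le_mul_of_pos_left _ he) hj.2⟩, hj.2⟩
  · intro i _
    rw [Nat.mul_div_cancel _ he]

/-- Coefficientwise form of T Λ'(T) = Λ(T) ∑ `primeSum` T^j for Λ(T) = ∏ (1 - λ(P) T^(deg P))⁻¹,
where λ is the weight. Each f is weighted by its degree, the degree is distributed over the prime
powers dividing f, and the order of summation is exchanged. -/
theorem mul_monicSum (χ : MulChar F R) (ψ : AddChar F R) (k : ℕ) :
    (k : R) * monicSum χ ψ k =
      ∑ j ∈ Finset.Icc 1 k, primeSum χ ψ j * monicSum χ ψ (k - j) := by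
  classical
  have h1 : (k : R) * monicSum χ ψ k = ∑ P ∈ primesUpTo F k, ∑ i ∈ Finset.Icc 1 k,
      (P.natDegree : R) * ∑ f ∈ (monics F k).filter (fun f => P ^ i ∣ f), polyWeight χ ψ f := by
    rw [monicSum, Finset.mul_sum]
    have : ∀ f ∈ monics F k, (k : R) * polyWeight χ ψ f = ∑ P ∈ primesUpTo F k,
        ∑ i ∈ Finset.Icc 1 k, (if P ^ i ∣ f then (P.natDegree : R) * polyWeight χ ψ f else 0) := by
      intro f hf
      rw [mem_monics] at hf
      nth_rw 1 [← sum_prime_powers_dvd hf.1 hf.2]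
      push_cast
      simp_rw [Finset.sum_mul, ite_mul, zero_mul]
    rw [Finset.sum_congr rfl this, Finset.sum_comm]
    refine Finset.sum_congr rfl fun P _ => ?_
    rw [Finset.sum_comm]
    refine Finset.sum_congr rfl fun i _ => ?_
    rw [Finset.mul_sum, Finset.sum_filter]
  have h2 : ∀ P ∈ primesUpTo F k, ∑ i ∈ Finset.Icc 1 k,
      (P.natDegree : R) * ∑ f ∈ (monics F k).filter (fun f => P ^ i ∣ f), polyWeight χ ψ f =
      ∑ j ∈ (Finset.Icc 1 k).filter (fun j => P.natDegree ∣ j),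
        (P.natDegree : R) * (polyWeight χ ψ P ^ (j / P.natDegree) * monicSum χ ψ (k - j)) := by
    intro P hP
    obtain ⟨hPm, hPi, -⟩ := mem_primesUpTo.1 hP
    rw [← sum_multiples P.natDegree k hPi.natDegree_pos
      (fun i j => (P.natDegree : R) * (polyWeight χ ψ P ^ i * monicSum χ ψ (k - j))),
      Finset.sum_filter]
    refine Finset.sum_congr rfl fun i _ => ?_
    split_ifs with hi
    · rw [sum_filter_pow_dvd χ ψ hPm hi]
    · rw [Finset.filter_false_of_mem, Finset.sum_empty, mul_zero]
      intro f hf hd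
      rw [mem_monics] at hf
      have := natDegree_le_of_dvd hd hf.1.ne_zero
      rw [natDegree_pow, hf.2] at this
      exact hi this
  rw [h1, Finset.sum_congr rfl h2]
  simp_rw [Finset.sum_filter]
  rw [Finset.sum_comm]
  refine Finset.sum_congr rfl fun j hj => ?_
  rw [Finset.mem_Icc] at hj
  rw [← Finset.sum_filter, primeSum, Finset.sum_mul]
  have : (primesUpTo F k).filter (fun P => P.natDegree ∣ j) =
      (primesUpTo F j).filter (fun P => P.natDegree ∣ j) := by
    ext P
    simp only [Finset.mem_filter, mem_primesUpTo]
    constructor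
    · rintro ⟨⟨h1, h2, -⟩, h4⟩
      exact ⟨⟨h1, h2, Nat.le_of_dvd hj.1 h4⟩, h4⟩
    · rintro ⟨⟨h1, h2, h3⟩, h4⟩
      exact ⟨⟨h1, h2, h3.trans hj.2⟩, h4⟩
  rw [this]
  exact Finset.sum_congr rfl fun P _ => by ring

/-- The series Λ reduces to 1 + gT with g the Gauss sum, so its logarithmic derivative is geometric;
in the recursion only j = k + 1 and j = k + 2 survive. -/
theorem primeSum_succ [IsDomain R] [Fintype F] (χ : MulChar F R) {ψ : AddChar F R} (hψ : ψ ≠ 1)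
    (k : ℕ) : primeSum χ ψ (k + 1) = (-1) ^ k * gaussSum χ ψ ^ (k + 1) := by
  induction k with
  | zero =>
    have := mul_monicSum χ ψ 1
    simpa [monicSum_zero, monicSum_one] using this.symm
  | succ k ih =>
    have h := mul_monicSum χ ψ (k + 2)
    rw [monicSum_eq_zero χ hψ (by omega), mul_zero] at h
    rw [← Finset.sum_subset (s₁ := {k + 1, k + 2})] at h
    · rw [Finset.sum_pair (by omega)] at h
      have e1 : k + 2 - (k + 1) = 1 := by omega
      rw [e1, Nat.sub_self, monicSum_zero, monicSum_one, ih] at h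
      linear_combination -h
    · intro j hj
      simp only [Finset.mem_insert, Finset.mem_singleton] at hj
      rw [Finset.mem_Icc]; omega
    · intro j hj hj'
      simp only [Finset.mem_insert, Finset.mem_singleton] at hj'
      rw [Finset.mem_Icc] at hj
      rw [monicSum_eq_zero χ hψ (by omega), mul_zero]

end Sums

section Extension

variable {F E : Type*} [Field F] [Field E] [Fintype E] [Algebra F E]
  {R : Type*} [CommRing R]

open IntermediateField in
-- Norm and trace of α from F(α) are the signed constant and next-to-leading coefficients of the
-- minimal polynomial; going up to E raises the norm to the power [E : F(α)] and multiplies the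
-- trace by it.
theorem char_norm_mul_char_trace (χ : MulChar F R) (ψ : AddChar F R) (α : E) :
    χ (Algebra.norm F α) * ψ (Algebra.trace F E α) =
      polyWeight χ ψ (minpoly F α) ^ (Module.finrank F E / (minpoly F α).natDegree) := by
  have hint : IsIntegral F α := Algebra.IsIntegral.isIntegral α
  have hdim : Module.finrank F E / (minpoly F α).natDegree = Module.finrank F⟮α⟯ E := by
    rw [← adjoin.finrank hint, ← Module.finrank_mul_finrank F F⟮α⟯ E,
      Nat.mul_div_cancel_left _ Module.finrank_pos]
  have hn := Algebra.PowerBasis.norm_gen_eq_coeff_zero_minpoly (adjoin.powerBasis hint)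
  have ht := PowerBasis.trace_gen_eq_nextCoeff_minpoly (adjoin.powerBasis hint)
  rw [adjoin.powerBasis_gen, minpoly_gen] at hn ht
  rw [adjoin.powerBasis_dim] at hn
  rw [Algebra.norm_eq_norm_adjoin F α, trace_eq_trace_adjoin F α, hn, ht, hdim, polyWeight,
    map_pow, AddChar.map_nsmul_eq_pow, ← mul_pow]

/-- Elements of E are grouped by minimal polynomial: an irreducible P whose degree divides [E : F]
has exactly deg P roots in E. -/
theorem primeSum_finrank [Finite F] (χ : MulChar F R) (ψ : AddChar F R) :
    primeSum χ ψ (Module.finrank F E) =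
      ∑ α : E, χ (Algebra.norm F α) * ψ (Algebra.trace F E α) := by
  classical
  set m := Module.finrank F E with hm
  have hmaps : ∀ α ∈ (Finset.univ : Finset E), minpoly F α ∈
      (primesUpTo F m).filter (fun P => P.natDegree ∣ m) := by
    intro α _
    have hint : IsIntegral F α := Algebra.IsIntegral.isIntegral α
    have hd : (minpoly F α).natDegree ∣ m := by
      rw [← IntermediateField.adjoin.finrank hint, hm]
      exact ⟨_, (Module.finrank_mul_finrank F (IntermediateField.adjoin F {α}) E).symm⟩
    rw [Finset.mem_filter, mem_primesUpTo]
    exact ⟨⟨minpoly.monic hint, minpoly.irreducible hint,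
      Nat.le_of_dvd Module.finrank_pos hd⟩, hd⟩
  rw [← Finset.sum_fiberwise_of_maps_to hmaps, primeSum]
  refine Finset.sum_congr rfl fun P hP => ?_
  rw [Finset.mem_filter, mem_primesUpTo] at hP
  obtain ⟨⟨hPm, hPi, -⟩, hd⟩ := hP
  have hval : ∀ α ∈ Finset.univ.filter (fun α : E => minpoly F α = P),
      χ (Algebra.norm F α) * ψ (Algebra.trace F E α) = polyWeight χ ψ P ^ (m / P.natDegree) := by
    intro α hα
    rw [Finset.mem_filter] at hα
    rw [char_norm_mul_char_trace, hα.2]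
  rw [Finset.sum_congr rfl hval, Finset.sum_const, nsmul_eq_mul]
  congr 2
  -- P divides X^|E| - X, which splits over E.
  have hsplit : (P.map (algebraMap F E)).Splits := by
    have h := (hPi.natDegree_dvd_iff_dvd_X_pow_card_pow_sub_X).1 hd
    rw [hm, ← Module.natCard_eq_pow_finrank, Nat.card_eq_fintype_card] at h
    have hs := (FiniteField.isSplittingField_sub E F).splits
    refine hs.of_dvd ?_ (Polynomial.map_dvd _ h)
    simpa using FiniteField.X_pow_card_sub_X_ne_zero E Fintype.one_lt_card
  have hcard := card_rootSet_eq_natDegree (PerfectField.separable_of_irreducible hPi) hsplit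
  rw [← hcard, ← Set.toFinset_card]
  congr 1
  ext α
  simp only [Set.mem_toFinset, mem_rootSet, Finset.mem_filter, Finset.mem_univ, true_and]
  constructor
  · rintro ⟨-, h⟩
    exact (minpoly.eq_of_irreducible_of_monic hPi h hPm).symm
  · rintro rfl
    exact ⟨hPm.ne_zero, minpoly.aeval F α⟩

/-- The **Hasse–Davenport relation**. -/
theorem neg_sum_lift_eq [IsDomain R] [Fintype F] (χ : MulChar F R) {ψ : AddChar F R}
    (hψ : ψ ≠ 1) :
    -∑ α : E, χ (Algebra.norm F α) * ψ (Algebra.trace F E α) =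
      (-gaussSum χ ψ) ^ Module.finrank F E := by
  obtain ⟨k, hk⟩ : ∃ k, Module.finrank F E = k + 1 :=
    ⟨_, (Nat.succ_pred_eq_of_pos Module.finrank_pos).symm⟩
  rw [← primeSum_finrank χ ψ, hk, primeSum_succ χ hψ k, neg_pow (gaussSum χ ψ)]
  ring

end Extension

end HasseDavenport

end

noncomputable section

/-! ### Residue field and Teichmüller lifts in an algebraically closed ultrametric field -/

namespace Teichmuller

open Polynomial IsLocalRing

variable (C : Type*) [NormedField C] [IsUltrametricDist C]

/-- The closed unit ball of an ultrametric field. -/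
def unitBall : ValuationSubring C := (NormedField.valuation (K := C)).valuationSubring

/-- The residue field of an ultrametric field. -/
abbrev Residue : Type _ := ResidueField (unitBall C)

variable {C}

theorem mem_unitBall {x : C} : x ∈ unitBall C ↔ ‖x‖ ≤ 1 := Iff.rfl

theorem residue_eq_zero_iff_norm {x : unitBall C} : residue (unitBall C) x = 0 ↔ ‖(x : C)‖ < 1 := by
  rw [residue_eq_zero_iff, mem_maximalIdeal, mem_nonunits_iff]
  have h : Valuation.Integers (NormedField.valuation (K := C)) (unitBall C) :=
    Valuation.integer.integers _
  rw [h.isUnit_iff_valuation_eq_one, ← ne_eq]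
  have hx : ‖(x : C)‖ ≤ 1 := x.2
  have e : NormedField.valuation (algebraMap (unitBall C) C x) = 1 ↔ ‖(x : C)‖ = 1 := by
    rw [← NNReal.coe_inj]; rfl
  rw [ne_eq, e]
  exact ⟨fun h => lt_of_le_of_ne hx h, fun h => h.ne⟩

theorem norm_eq_one_of_residue_ne_zero {x : unitBall C} (hx : residue (unitBall C) x ≠ 0) :
    ‖(x : C)‖ = 1 :=
  le_antisymm x.2 (not_lt.1 fun h => hx (residue_eq_zero_iff_norm.2 h))

theorem charP_residue {p : ℕ} (hp : p.Prime) (h : ‖(p : C)‖ < 1) : CharP (Residue C) p := by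
  have h0 : ((p : ℕ) : Residue C) = 0 := by
    rw [← map_natCast (residue (unitBall C))]
    exact residue_eq_zero_iff_norm.2 (by simpa using h)
  exact (CharP.charP_iff_prime_eq_zero hp).2 h0

/-- A monic lift of the polynomial has a root in C, and this root lies in the unit ball because
valuation rings are integrally closed. -/
instance isAlgClosed_residue [IsAlgClosed C] : IsAlgClosed (Residue C) := by
  refine IsAlgClosed.of_exists_root _ fun P hP hPi => ?_
  obtain ⟨Q, hQ, hdeg, hQm⟩ := lifts_and_natDegree_eq_and_monic
    (map_surjective (residue (unitBall C)) residue_surjective P) hP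
  obtain ⟨y, hy⟩ := IsAlgClosed.exists_aeval_eq_zero C Q (by
    rw [degree_eq_natDegree hQm.ne_zero, hdeg]
    exact_mod_cast hPi.natDegree_pos.ne')
  obtain ⟨z, rfl⟩ := IsIntegrallyClosed.isIntegral_iff.1 (⟨Q, hQm, hy⟩ : IsIntegral (unitBall C) y)
  refine ⟨residue _ z, ?_⟩
  rw [← hQ, eval_map_apply]
  rw [aeval_algebraMap_apply, ← map_zero (algebraMap (unitBall C) C)] at hy
  rw [show Q.eval z = 0 from FaithfulSMul.algebraMap_injective _ _ hy, map_zero]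

variable (p : ℕ)

/-- `IsTeich p y` says that `y` is fixed by some power of the `p`-th power map. -/
def IsTeich {R : Type*} [Monoid R] (y : R) : Prop := ∃ N : ℕ, N ≠ 0 ∧ y ^ p ^ N = y

section IsTeich
variable {p}

theorem pow_pow_mul_eq {R : Type*} [Monoid R] {y : R} {N : ℕ} (h : y ^ p ^ N = y) (m : ℕ) :
    y ^ p ^ (N * m) = y := by
  induction m with
  | zero => simp
  | succ m ih => rw [Nat.mul_succ, pow_add, pow_mul, ih, h]

theorem IsTeich.mul {R : Type*} [CommMonoid R] {x y : R} (hx : IsTeich p x) (hy : IsTeich p y) :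
    IsTeich p (x * y) := by
  obtain ⟨N, hN, hx⟩ := hx
  obtain ⟨N', hN', hy⟩ := hy
  refine ⟨N * N', Nat.mul_ne_zero hN hN', ?_⟩
  rw [mul_pow, pow_pow_mul_eq hx, mul_comm N N', pow_pow_mul_eq hy]

end IsTeich

variable [hp : Fact p.Prime]

variable {p} in
-- For a common Q = p^m fixing both, y - z = y^Q - z^Q = (y - z) s, where s reduces to Q z^(Q-1) =
-- 0. Thus 1 - s is nonzero and y = z.
theorem IsTeich.eq_of_residue_eq (h : ‖(p : C)‖ < 1) {y z : unitBall C} (hy : IsTeich p y)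
    (hz : IsTeich p z) (hyz : residue (unitBall C) y = residue (unitBall C) z) : y = z := by
  obtain ⟨N, hN, hy⟩ := hy
  obtain ⟨N', hN', hz⟩ := hz
  have hy' := pow_pow_mul_eq hy N'
  have hz' := pow_pow_mul_eq hz N
  rw [mul_comm] at hz'
  have hQ : N * N' ≠ 0 := Nat.mul_ne_zero hN hN'
  generalize N * N' = m at *
  have hg := Commute.mul_geom_sum₂ (Commute.all y z) (p ^ m)
  rw [hy', hz'] at hg
  set s := ∑ i ∈ Finset.range (p ^ m), y ^ i * z ^ (p ^ m - 1 - i) with hs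
  have hres : residue (unitBall C) s = 0 := by
    have := charP_residue hp.out h
    rw [hs, map_sum]
    have : ∀ i ∈ Finset.range (p ^ m), residue (unitBall C) (y ^ i * z ^ (p ^ m - 1 - i)) =
        residue (unitBall C) z ^ (p ^ m - 1) := by
      intro i hi
      rw [Finset.mem_range] at hi
      rw [map_mul, map_pow, map_pow, hyz, ← pow_add]
      congr 1; omega
    rw [Finset.sum_congr rfl this, Finset.sum_const, Finset.card_range, nsmul_eq_mul,
      Nat.cast_pow, CharP.cast_eq_zero, zero_pow hQ, zero_mul]
  have hne : (1 - s) ≠ 0 := by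
    intro h0
    have : residue (unitBall C) (1 - s) = 0 := by rw [h0, map_zero]
    rw [map_sub, hres, map_one, sub_zero] at this
    exact one_ne_zero this
  have : (y - z) * (1 - s) = 0 := by rw [mul_sub, hg]; ring
  exact sub_eq_zero.1 ((mul_eq_zero.1 this).resolve_right hne)

open Classical in
/-- The Teichmüller lift, with value `0` at the elements which are not fixed by any power of
Frobenius. -/
def teich (x : Residue C) : C :=
  if h : ∃ y : unitBall C, IsTeich p y ∧ residue (unitBall C) y = x then (h.choose : C) else 0

variable {p}

theorem teich_residue (h : ‖(p : C)‖ < 1) {y : unitBall C} (hy : IsTeich p y) :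
    teich p (residue (unitBall C) y) = (y : C) := by
  have hex : ∃ z : unitBall C, IsTeich p z ∧ residue (unitBall C) z = residue (unitBall C) y :=
    ⟨y, hy, rfl⟩
  rw [teich, dif_pos hex]
  exact congrArg _ (IsTeich.eq_of_residue_eq h hex.choose_spec.1 hy hex.choose_spec.2)

/-- No completeness or Hensel lifting is used: for any lift t of x, the product of |t - y| over the
roots y of X^Q - X is |t^Q - t| < 1, so some root is congruent to t. -/
theorem exists_isTeich [IsAlgClosed C] [CharZero C] {x : Residue C} {N : ℕ}
    (hN : N ≠ 0) (hx : x ^ p ^ N = x) :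
    ∃ y : unitBall C, y ^ p ^ N = y ∧ residue (unitBall C) y = x := by
  have hQ : 1 < p ^ N := Nat.one_lt_pow hN hp.out.one_lt
  have hmem : ∀ y : C, y ^ p ^ N = y → y ∈ unitBall C := by
    intro y hy
    rw [mem_unitBall]
    by_contra hlt
    rw [not_le] at hlt
    have := lt_self_pow₀ hlt hQ
    rw [← norm_pow, hy] at this
    exact lt_irrefl _ this
  set P : C[X] := X ^ p ^ N - X with hP
  have hmon : P.Monic := by
    rw [hP]
    exact (monic_X_pow (p ^ N)).sub_of_left (by rw [degree_X, degree_X_pow]; exact_mod_cast hQ)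
  have hroot : ∀ y ∈ P.roots, y ^ p ^ N = y := by
    intro y hy
    have := (mem_roots'.1 hy).2
    simpa [hP, sub_eq_zero] using this
  have hprod : ∀ t : C, t ^ p ^ N - t = (P.roots.map (fun a => t - a)).prod := by
    intro t
    have h1 := prod_multiset_X_sub_C_of_monic_of_roots_card_eq hmon
      (splits_iff_card_roots.1 (IsAlgClosed.splits P))
    have h2 := congrArg (eval t) h1
    rw [eval_multiset_prod, Multiset.map_map] at h2
    simpa [hP] using h2.symm
  obtain ⟨t, rfl⟩ := residue_surjective x
  have hlt : ‖((t : C) ^ p ^ N - t)‖ < 1 := by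
    have : residue (unitBall C) (t ^ p ^ N - t) = 0 := by rw [map_sub, map_pow, hx, sub_self]
    simpa using residue_eq_zero_iff_norm.1 this
  have hex : ∃ y ∈ P.roots, ‖(t : C) - y‖ < 1 := by
    by_contra! hno
    rw [hprod, ← coe_nnnorm, ← NNReal.coe_one, NNReal.coe_lt_coe, ← nnnormHom_apply, map_multiset_prod,
      Multiset.map_map] at hlt
    refine absurd hlt (not_lt.2 ?_)
    refine Multiset.one_le_prod_of_one_le ?_
    intro c hc
    obtain ⟨y, hy, rfl⟩ := Multiset.mem_map.1 hc
    exact hno y hy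
  obtain ⟨y, hy, hyt⟩ := hex
  have hy' := hroot y hy
  refine ⟨⟨y, hmem y hy'⟩, Subtype.ext (by simpa using hy'), ?_⟩
  rw [← sub_eq_zero, ← map_sub, residue_eq_zero_iff_norm]
  rw [norm_sub_rev] at hyt
  exact hyt

theorem exists_teich_eq [IsAlgClosed C] [CharZero C] (h : ‖(p : C)‖ < 1) {x : Residue C} {N : ℕ}
    (hN : N ≠ 0) (hx : x ^ p ^ N = x) :
    ∃ y : unitBall C, y ^ p ^ N = y ∧ residue (unitBall C) y = x ∧ teich p x = y := by
  obtain ⟨y, hy, rfl⟩ := exists_isTeich hN hx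
  exact ⟨y, hy, rfl, teich_residue h ⟨N, hN, hy⟩⟩

theorem teich_mul [IsAlgClosed C] [CharZero C] (h : ‖(p : C)‖ < 1) {x y : Residue C}
    (hx : IsTeich p x) (hy : IsTeich p y) : teich p (x * y) = teich p x * teich p y := by
  obtain ⟨N, hN, hx⟩ := hx
  obtain ⟨N', hN', hy⟩ := hy
  obtain ⟨a, ha, rfl, ha'⟩ := exists_teich_eq h hN hx
  obtain ⟨b, hb, rfl, hb'⟩ := exists_teich_eq h hN' hy
  rw [← map_mul, teich_residue h (IsTeich.mul ⟨N, hN, ha⟩ ⟨N', hN', hb⟩), ha', hb']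
  rfl

theorem teich_one (h : ‖(p : C)‖ < 1) : teich p (1 : Residue C) = 1 := by
  have := teich_residue (y := (1 : unitBall C)) h ⟨1, one_ne_zero, one_pow _⟩
  simpa using this

theorem teich_zero (h : ‖(p : C)‖ < 1) : teich p (0 : Residue C) = 0 := by
  have := teich_residue (y := (0 : unitBall C)) h
    ⟨1, one_ne_zero, zero_pow (pow_ne_zero _ hp.out.ne_zero)⟩
  simpa using this

end Teichmuller

end

noncomputable section

/-! ### Stickelberger's theorem on absolute values of Gauss sums -/

namespace Stickelberger

section Digits

/-- The sum of the residues of `p ^ i * a` modulo `p ^ N - 1` over a full period of exponents. -/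
def residueSum (p N a : ℕ) : ℕ := ∑ i ∈ Finset.range N, (p ^ i * a) % (p ^ N - 1)

variable {p N : ℕ}

theorem pow_mul_mod (hp : 1 < p) (a : ℕ) : (p ^ N * a) % (p ^ N - 1) = a % (p ^ N - 1) := by
  have h : p ^ N = (p ^ N - 1) + 1 := (Nat.sub_add_cancel (Nat.one_le_pow _ _ (by omega))).symm
  conv_lhs => rw [h, add_mul, one_mul, Nat.add_sub_cancel, Nat.mul_add_mod]

theorem residueSum_zero : residueSum p N 0 = 0 := by simp [residueSum]

/-- As p^N ≡ 1, multiplying by p only shifts the summands cyclically. -/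
theorem residueSum_mul (hp : 1 < p) (b : ℕ) : residueSum p N (p * b) = residueSum p N b := by
  have h1 := Finset.sum_range_succ (fun i => (p ^ i * b) % (p ^ N - 1)) N
  have h2 := Finset.sum_range_succ' (fun i => (p ^ i * b) % (p ^ N - 1)) N
  simp only [pow_zero, one_mul] at h2
  rw [pow_mul_mod hp] at h1
  rw [h1] at h2
  have h3 := Nat.add_right_cancel h2
  rw [residueSum, residueSum, h3]
  exact Finset.sum_congr rfl fun i _ => by rw [pow_succ, mul_assoc]

/-- For a < p^N - 1, `residueSum` is (p^N - 1)/(p - 1) times the base p digit sum. Passing to a + 1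
without a carry raises the digit sum by one; here the i-th residue rises by exactly p^i. -/
theorem residueSum_succ (hp : 1 < p) {a : ℕ} (ha : a + 1 < p ^ N - 1) (hpa : ¬ p ∣ a + 1) :
    (p - 1) * residueSum p N (a + 1) = (p - 1) * residueSum p N a + (p ^ N - 1) := by
  have key : ∀ i ∈ Finset.range N, (p ^ i * (a + 1)) % (p ^ N - 1) =
      (p ^ i * a) % (p ^ N - 1) + p ^ i := by
    intro i hi
    rw [Finset.mem_range] at hi
    have hm : 0 < p ^ N - 1 := by omega
    -- If the residue t were below p^i, then p^(N-i) t would be below p^N - 1, hence equal to a + 1,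
    -- which p does not divide.
    have hle : p ^ i ≤ (p ^ i * (a + 1)) % (p ^ N - 1) := by
      by_contra! hlt
      set t := (p ^ i * (a + 1)) % (p ^ N - 1) with ht
      have hN : p ^ (N - i) * p ^ i = p ^ N := by rw [← pow_add]; congr 1; omega
      have h1 : (p ^ (N - i) * t) % (p ^ N - 1) = a + 1 := by
        rw [ht, Nat.mul_mod, Nat.mod_mod, ← Nat.mul_mod, ← mul_assoc, hN, pow_mul_mod hp,
          Nat.mod_eq_of_lt ha]
      have hpN : p ∣ p ^ (N - i) := dvd_pow_self _ (by omega)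
      have h2 : p ^ (N - i) * t < p ^ N - 1 := by
        have h3 : p ^ (N - i) * (t + 1) ≤ p ^ N := by
          rw [← hN]; exact Nat.mul_le_mul_left _ hlt
        have h4 : p ≤ p ^ (N - i) := Nat.le_of_dvd (by positivity) hpN
        rw [mul_add, mul_one] at h3
        omega
      rw [Nat.mod_eq_of_lt h2] at h1
      exact hpa (h1 ▸ hpN.mul_right t)
    have h5 : (p ^ i * a + p ^ i) % (p ^ N - 1) = (p ^ i * (a + 1)) % (p ^ N - 1) := by
      rw [mul_add, mul_one]
    have h6 : p ^ i * a ≡ (p ^ i * (a + 1)) % (p ^ N - 1) - p ^ i [MOD p ^ N - 1] := by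
      refine Nat.ModEq.add_right_cancel' (p ^ i) ?_
      rw [Nat.sub_add_cancel hle]
      exact h5.trans (Nat.mod_mod _ _).symm
    have h7 := Nat.mod_lt (p ^ i * (a + 1)) hm
    have h8 : (p ^ i * a) % (p ^ N - 1) = (p ^ i * (a + 1)) % (p ^ N - 1) - p ^ i :=
      Eq.trans h6 (Nat.mod_eq_of_lt (lt_of_le_of_lt (Nat.sub_le _ _) h7))
    rw [h8, Nat.sub_add_cancel hle]
  have hgeom : (p - 1) * ∑ i ∈ Finset.range N, p ^ i = p ^ N - 1 := by
    have := Nat.geomSum_eq hp N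
    rw [this, Nat.mul_div_cancel' (by simpa using Nat.sub_dvd_pow_sub_pow p 1 N)]
  rw [residueSum, Finset.sum_congr rfl key, Finset.sum_add_distrib, mul_add, hgeom, residueSum]

/-- The residues of p^i a and of its negative are nonzero and add up to p^N - 1, for each of the N
exponents. -/
theorem residueSum_add_sub {a : ℕ} (ha : 0 < a) (ham : a < p ^ N - 1) :
    residueSum p N a + residueSum p N (p ^ N - 1 - a) = N * (p ^ N - 1) := by
  rw [residueSum, residueSum, ← Finset.sum_add_distrib]
  rw [Finset.sum_congr rfl (g := fun _ => p ^ N - 1), Finset.sum_const, Finset.card_range,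
    smul_eq_mul]
  intro i _
  set m := p ^ N - 1 with hm
  have hN : p ^ N = m + 1 := by omega
  have hcop : Nat.Coprime m (p ^ i) := by
    refine Nat.Coprime.pow_right _ ?_
    have hN0 : N ≠ 0 := by rintro rfl; simp at hm; omega
    have h1 : Nat.Coprime m (p ^ N) := by rw [hN]; simp
    exact (Nat.coprime_pow_right_iff (Nat.pos_of_ne_zero hN0) _ _).1 h1
  have hx : ¬ m ∣ p ^ i * a := fun h => by
    have := Nat.le_of_dvd ha (hcop.dvd_of_dvd_mul_left h)
    omega
  have h0 : (p ^ i * a) % m ≠ 0 := fun h => hx (Nat.dvd_of_mod_eq_zero h)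
  have hlt := Nat.mod_lt (p ^ i * a) (by omega : 0 < m)
  have hlt' := Nat.mod_lt (p ^ i * (m - a)) (by omega : 0 < m)
  have hdvd : m ∣ (p ^ i * a) % m + (p ^ i * (m - a)) % m := by
    rw [Nat.dvd_iff_mod_eq_zero, ← Nat.add_mod, ← mul_add, Nat.add_sub_cancel' ham.le,
      Nat.mul_mod_left]
  obtain ⟨c, hc⟩ := hdvd
  rcases c with _ | _ | c
  · omega
  · omega
  · exfalso
    have : m * (c + 1 + 1) ≥ m * 2 := Nat.mul_le_mul_left _ (by omega)
    omega

end Digits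

theorem pow_eq_one_add {C : Type*} [CommRing C] (z : C) (m : ℕ) :
    z ^ m = 1 + (z - 1) * m +
      (z - 1) * ((z - 1) * ∑ i ∈ Finset.range m, ∑ j ∈ Finset.range i, z ^ j) := by
  have h1 : (z - 1) * ∑ i ∈ Finset.range m, ∑ j ∈ Finset.range i, z ^ j =
      (∑ i ∈ Finset.range m, z ^ i) - m := by
    rw [Finset.mul_sum, Finset.sum_congr rfl (fun i _ => mul_geom_sum z i),
      Finset.sum_sub_distrib]
    simp
  rw [h1, mul_sub, mul_geom_sum]
  ring

section Char

variable {p : ℕ} [hp : Fact p.Prime]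
variable {E : Type*} [Field E] [Fintype E] [Algebra (ZMod p) E]

theorem card_eq (p : ℕ) [Fact p.Prime] (E : Type*) [Field E] [Fintype E] [Algebra (ZMod p) E] :
    Fintype.card E = p ^ Module.finrank (ZMod p) E := by
  rw [Module.card_eq_pow_finrank (K := ZMod p), ZMod.card]

/-- The trace is ∑ x^(p^i). The terms with i ≥ 1 give power sums of exponent p^i - 1 < |E| - 1,
which vanish; i = 0 counts the nonzero elements, giving |E| - 1 = -1. This is the leading
coefficient of the first Gauss sum. -/
theorem sum_inv_mul_trace :
    ∑ x : E, x⁻¹ * algebraMap (ZMod p) E (Algebra.trace (ZMod p) E x) = -1 := by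
  classical
  have hcp : CharP E p := charP_of_injective_algebraMap (algebraMap (ZMod p) E).injective p
  simp_rw [FiniteField.algebraMap_trace_eq_sum_pow, Nat.card_zmod, Finset.mul_sum]
  rw [Finset.sum_comm]
  obtain ⟨m, hm⟩ : ∃ m, Module.finrank (ZMod p) E = m + 1 :=
    ⟨_, (Nat.succ_pred_eq_of_pos Module.finrank_pos).symm⟩
  rw [hm, Finset.sum_range_succ']
  have hz : ∀ i ∈ Finset.range m, ∑ x : E, x⁻¹ * x ^ p ^ (i + 1) = 0 := by
    intro i hi
    rw [Finset.mem_range] at hi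
    have h2 : 1 < p ^ (i + 1) := Nat.one_lt_pow (by omega) hp.out.one_lt
    have h3 : p ^ (i + 1) - 1 < Fintype.card E - 1 := by
      have : p ^ (i + 1) < p ^ (m + 1) := Nat.pow_lt_pow_right hp.out.one_lt (by omega)
      rw [card_eq p E, hm]; omega
    rw [← FiniteField.sum_pow_lt_card_sub_one E _ h3]
    refine Finset.sum_congr rfl fun x _ => ?_
    rcases eq_or_ne x 0 with rfl | hx
    · rw [zero_pow (by omega), zero_pow (by omega), mul_zero]
    · rw [inv_mul_eq_iff_eq_mul₀ hx, ← pow_succ', Nat.sub_add_cancel h2.le]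
  rw [Finset.sum_eq_zero hz, zero_add]
  simp only [pow_zero, pow_one]
  have : ∑ x : E, x⁻¹ * x = ∑ x : E, (1 - if x = 0 then (1 : E) else 0) := by
    refine Finset.sum_congr rfl fun x _ => ?_
    rcases eq_or_ne x 0 with rfl | hx
    · simp
    · simp [hx]
  rw [this, Finset.sum_sub_distrib]
  simp

variable {C : Type*} [NormedField C]

/-- The additive character `x ↦ ζ ^ Tr x` of a finite field. -/
def traceChar {ζ : C} (hζ : IsPrimitiveRoot ζ p) (E : Type*) [Field E] [Fintype E]
    [Algebra (ZMod p) E] : AddChar E C :=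
  (AddChar.zmodChar p hζ.pow_eq_one).compAddMonoidHom (Algebra.trace (ZMod p) E).toAddMonoidHom

theorem traceChar_apply {ζ : C} (hζ : IsPrimitiveRoot ζ p) (x : E) :
    traceChar hζ E x = ζ ^ (Algebra.trace (ZMod p) E x).val := rfl

theorem traceChar_ne_one {ζ : C} (hζ : IsPrimitiveRoot ζ p) : traceChar hζ E ≠ 1 := by
  obtain ⟨x, hx⟩ := Algebra.trace_surjective (ZMod p) E 1
  refine AddChar.ne_one_iff.2 ⟨x, ?_⟩
  have : Fact (1 < p) := ⟨hp.out.one_lt⟩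
  rw [traceChar_apply, hx, ZMod.val_one, pow_one]
  exact hζ.ne_one hp.out.one_lt

theorem traceChar_pow_card {ζ : C} (hζ : IsPrimitiveRoot ζ p) (x : E) :
    traceChar hζ E (x ^ p) = traceChar hζ E x := by
  have := Algebra.trace_eq_of_algEquiv
    (FiniteField.frobeniusAlgEquivOfAlgebraic (ZMod p) E) x
  rw [traceChar_apply, traceChar_apply, ← this]
  simp [ZMod.card]

theorem norm_mulChar_le_one (χ : MulChar E C) (x : E) : ‖χ x‖ ≤ 1 := by
  by_cases hx : x = 0
  · rw [hx, MulChar.map_zero, norm_zero]; exact zero_le_one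
  · have h1 : χ x ^ (Fintype.card E - 1) = 1 := by
      rw [← map_pow, FiniteField.pow_card_sub_one_eq_one x hx, map_one]
    have h2 : ‖χ x‖ ^ (Fintype.card E - 1) = 1 := by rw [← norm_pow, h1, norm_one]
    have h3 : Fintype.card E - 1 ≠ 0 := by
      have := Fintype.one_lt_card (α := E); omega
    exact ((pow_eq_one_iff_of_nonneg (norm_nonneg _) h3).1 h2).le

variable [IsUltrametricDist C]

/-- The product of 1 - ζ^k for 0 < k < p is p, and all factors have equal norm: 1 - ζ and 1 - ζ^k
divide each other with integral quotients. -/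
theorem norm_primitiveRoot_sub_one [CharZero C] (hpn : ‖(p : C)‖ = (p : ℝ)⁻¹) {ζ : C}
    (hζ : IsPrimitiveRoot ζ p) : ‖ζ - 1‖ ^ (p - 1) = (p : ℝ)⁻¹ := by
  obtain ⟨m, rfl⟩ : ∃ m, p = m + 1 := ⟨p - 1, (Nat.sub_add_cancel hp.out.one_le).symm⟩
  have h := hζ.prod_one_sub_pow_eq_order
  have hnorm : ∀ {z : C}, IsPrimitiveRoot z (m + 1) → ‖z‖ = 1 := fun hz =>
    (isOfFinOrder_iff_pow_eq_one.2 ⟨_, Nat.succ_pos m, hz.pow_eq_one⟩).norm_eq_one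
  have hle : ∀ {z : C} (k : ℕ), ‖z‖ = 1 → ‖1 - z ^ k‖ ≤ ‖1 - z‖ := by
    intro z k hz
    rw [← mul_neg_geom_sum, norm_mul]
    refine mul_le_of_le_one_right (norm_nonneg _) ?_
    refine IsUltrametricDist.norm_sum_le_of_forall_le_of_nonneg zero_le_one fun i _ => ?_
    rw [norm_pow, hz, one_pow]
  have heq : ∀ k ∈ Finset.range m, ‖1 - ζ ^ (k + 1)‖ = ‖ζ - 1‖ := by
    intro k hk
    rw [Finset.mem_range] at hk
    have hcop : Nat.Coprime (k + 1) (m + 1) :=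
      (Nat.coprime_of_lt_prime (Nat.succ_ne_zero k) (by omega) hp.out).symm
    rw [norm_sub_rev ζ 1]
    refine le_antisymm (hle _ (hnorm hζ)) ?_
    have hprim := hζ.pow_of_coprime _ hcop
    obtain ⟨i, -, hi⟩ := hprim.eq_pow_of_pow_eq_one hζ.pow_eq_one
    conv_lhs => rw [← hi]
    exact hle i (hnorm hprim)
  have h2 := congrArg norm h
  rw [norm_prod, Finset.prod_congr rfl heq, Finset.prod_const, Finset.card_range] at h2
  rw [Nat.add_sub_cancel, h2, ← hpn]
  push_cast; rfl

open Teichmuller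

theorem map_pow_finrank (ι : E →+* Residue C) (x : E) :
    (ι x) ^ p ^ Module.finrank (ZMod p) E = ι x := by
  rw [← card_eq, ← map_pow, FiniteField.pow_card]

theorem isTeich_map (ι : E →+* Residue C) (x : E) : IsTeich p (ι x) :=
  ⟨Module.finrank (ZMod p) E, Module.finrank_pos.ne', map_pow_finrank ι x⟩

variable [IsAlgClosed C] [CharZero C]

variable (h : ‖(p : C)‖ < 1) (ι : E →+* Residue C)

/-- The Teichmüller character of a finite field embedded into the residue field. -/
def teichChar (h : ‖(p : C)‖ < 1) (ι : E →+* Residue C) : MulChar E C where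
  toFun x := teich p (ι x)
  map_one' := by rw [map_one, teich_one h]
  map_mul' x y := by rw [map_mul, teich_mul h (isTeich_map ι x) (isTeich_map ι y)]
  map_nonunit' x hx := by
    rw [isUnit_iff_ne_zero, not_not] at hx
    rw [hx, map_zero, teich_zero h]

theorem teichChar_apply (x : E) : teichChar h ι x = teich p (ι x) := rfl

theorem exists_residue_eq (x : E) :
    ∃ y : unitBall C, (y : C) = teichChar h ι x ∧ IsLocalRing.residue (unitBall C) y = ι x := by
  obtain ⟨y, -, h1, h2⟩ := exists_teich_eq h (Module.finrank_pos (R := ZMod p) (M := E)).ne'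
    (map_pow_finrank ι x)
  exact ⟨y, h2.symm, h1⟩

theorem teichChar_injective : Function.Injective (teichChar h ι) := by
  intro x x' hxx
  obtain ⟨y, hy, hy'⟩ := exists_residue_eq h ι x
  obtain ⟨z, hz, hz'⟩ := exists_residue_eq h ι x'
  have : y = z := Subtype.ext (by rw [hy, hz, hxx])
  exact ι.injective (by rw [← hy', ← hz', this])

theorem teichChar_inv_pow_eq_one_iff (a : ℕ) :
    ((teichChar h ι)⁻¹) ^ a = 1 ↔ Fintype.card E - 1 ∣ a := by
  classical
  rw [inv_pow, inv_eq_one]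
  constructor
  · intro ha
    obtain ⟨g, hg⟩ := IsCyclic.exists_generator (α := Eˣ)
    rw [← Fintype.card_units, ← Nat.card_eq_fintype_card, ← orderOf_eq_card_of_forall_mem_zpowers hg, orderOf_dvd_iff_pow_eq_one,
      ← Units.val_inj]
    refine teichChar_injective h ι ?_
    rw [Units.val_pow_eq_pow_val, map_pow, Units.val_one, map_one,
      ← MulChar.pow_apply_coe, ha, MulChar.one_apply_coe]
  · rintro ⟨b, rfl⟩
    ext x
    rw [MulChar.pow_apply_coe, ← map_pow, pow_mul, FiniteField.pow_card_sub_one_eq_one _ x.ne_zero,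
      one_pow, map_one, MulChar.one_apply_coe]

/-- The Gauss sum of the `a`-th power of the inverse of the Teichmüller character. -/
def teichGauss {ζ : C} (hζ : IsPrimitiveRoot ζ p) (a : ℕ) : C :=
  gaussSum ((teichChar h ι)⁻¹ ^ a) (traceChar hζ E)

variable {ζ : C} (hζ : IsPrimitiveRoot ζ p)

theorem teichGauss_zero : teichGauss h ι hζ 0 = -1 := by
  rw [teichGauss, pow_zero, gaussSum_one_left (traceChar_ne_one hζ)]

/-- Substitute x ↦ x^p, which preserves the trace. -/
theorem teichGauss_mul (a : ℕ) : teichGauss h ι hζ (p * a) = teichGauss h ι hζ a := by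
  rw [teichGauss, teichGauss, gaussSum, gaussSum]
  have : CharP E p := charP_of_injective_algebraMap (algebraMap (ZMod p) E).injective p
  refine Fintype.sum_bijective (fun x : E => x ^ p) (bijective_frobenius E p) _ _ fun x => ?_
  rw [traceChar_pow_card, map_pow, ← MulChar.pow_apply' _ hp.out.ne_zero, ← pow_mul, mul_comm a]

/-- The quotient of the two sides is a Jacobi sum, a sum of products of values of norm at most 1. -/
theorem norm_teichGauss_mul_le {a b : ℕ} (hab : ¬ Fintype.card E - 1 ∣ a + b) :
    ‖teichGauss h ι hζ a‖ * ‖teichGauss h ι hζ b‖ ≤ ‖teichGauss h ι hζ (a + b)‖ := by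
  have h1 : (teichChar h ι)⁻¹ ^ a * (teichChar h ι)⁻¹ ^ b ≠ 1 := by
    rwa [← pow_add, ne_eq, teichChar_inv_pow_eq_one_iff]
  have h2 := jacobiSum_mul_nontrivial h1 (traceChar hζ E)
  rw [← pow_add] at h2
  rw [teichGauss, teichGauss, teichGauss, ← norm_mul, ← h2, norm_mul]
  refine mul_le_of_le_one_right (norm_nonneg _) ?_
  refine IsUltrametricDist.norm_sum_le_of_forall_le_of_nonneg zero_le_one fun x _ => ?_
  rw [norm_mul]
  exact mul_le_one₀ (norm_mulChar_le_one _ _) (norm_nonneg _) (norm_mulChar_le_one _ _)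

theorem norm_teichGauss_mul_neg {a b : ℕ} (ha : ¬ Fintype.card E - 1 ∣ a)
    (hab : Fintype.card E - 1 ∣ a + b) :
    ‖teichGauss h ι hζ a‖ * ‖teichGauss h ι hζ b‖ = ‖(Fintype.card E : C)‖ := by
  have h1 : (teichChar h ι)⁻¹ ^ a ≠ 1 := by rwa [ne_eq, teichChar_inv_pow_eq_one_iff]
  have h2 : (teichChar h ι)⁻¹ ^ b = ((teichChar h ι)⁻¹ ^ a)⁻¹ := by
    rw [eq_inv_iff_mul_eq_one, ← pow_add, add_comm, teichChar_inv_pow_eq_one_iff]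
    exact hab
  have h3 := gaussSum_mul_gaussSum_eq_card h1 (AddChar.IsPrimitive.of_ne_one (traceChar_ne_one (E := E) hζ))
  have h4 := mul_gaussSum_inv_eq_gaussSum ((teichChar h ι)⁻¹ ^ b) (traceChar hζ E)
  have h5 : ‖((teichChar h ι)⁻¹ ^ b) (-1 : E)‖ = 1 := by
    have : ((teichChar h ι)⁻¹ ^ b) (-1 : E) ^ 2 = 1 := by rw [← map_pow]; simp
    have h6 : ‖((teichChar h ι)⁻¹ ^ b) (-1 : E)‖ ^ 2 = 1 := by rw [← norm_pow, this, norm_one]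
    exact (pow_eq_one_iff_of_nonneg (norm_nonneg _) two_ne_zero).1 h6
  rw [teichGauss, teichGauss, ← h3, norm_mul, ← h4, norm_mul, h5, one_mul, h2]

/-- Expanding ζ^m to first order at ζ = 1, the constant term vanishes by orthogonality and the sum
is (ζ - 1)(A + (ζ - 1)B) with B integral. A reduces to ∑ x⁻¹ Tr x = -1, so it is a unit. -/
theorem norm_teichGauss_one (hcard : 2 < Fintype.card E) : ‖teichGauss h ι hζ 1‖ = ‖ζ - 1‖ := by
  classical
  set χ := (teichChar h ι)⁻¹ with hχ
  have hχ1 : χ ≠ 1 := by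
    intro h1
    have := (teichChar_inv_pow_eq_one_iff h ι 1).1 (by rw [pow_one]; exact h1)
    have := Nat.le_of_dvd one_pos this
    omega
  have hζ1 : ‖ζ‖ = 1 := (isOfFinOrder_iff_pow_eq_one.2 ⟨_, hp.out.pos, hζ.pow_eq_one⟩).norm_eq_one
  set m : E → ℕ := fun x => (Algebra.trace (ZMod p) E x).val with hm
  set A := ∑ x : E, χ x * (m x : C) with hA
  set B := ∑ x : E, χ x * ∑ i ∈ Finset.range (m x), ∑ j ∈ Finset.range i, ζ ^ j with hB
  have hG : teichGauss h ι hζ 1 = (ζ - 1) * (A + (ζ - 1) * B) := by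
    have : ∀ x : E, χ x * traceChar hζ E x = χ x + ((ζ - 1) * (χ x * (m x : C)) +
        (ζ - 1) * ((ζ - 1) * (χ x * ∑ i ∈ Finset.range (m x), ∑ j ∈ Finset.range i, ζ ^ j))) := by
      intro x
      rw [traceChar_apply, pow_eq_one_add]
      ring
    rw [teichGauss, gaussSum, pow_one, Finset.sum_congr rfl (fun x _ => this x),
      Finset.sum_add_distrib, MulChar.sum_eq_zero_of_ne_one hχ1, Finset.sum_add_distrib,
      ← Finset.mul_sum, ← Finset.mul_sum, ← Finset.mul_sum]
    ring
  have hBn : ‖B‖ ≤ 1 := by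
    refine IsUltrametricDist.norm_sum_le_of_forall_le_of_nonneg zero_le_one fun x _ => ?_
    rw [norm_mul]
    refine mul_le_one₀ (norm_mulChar_le_one _ _) (norm_nonneg _) ?_
    refine IsUltrametricDist.norm_sum_le_of_forall_le_of_nonneg zero_le_one fun i _ => ?_
    refine IsUltrametricDist.norm_sum_le_of_forall_le_of_nonneg zero_le_one fun j _ => ?_
    rw [norm_pow, hζ1, one_pow]
  -- In the residue field, of characteristic p, (ζ - 1)^p = ζ^p - 1 = 0.
  have hπ : ‖ζ - 1‖ < 1 := by
    have h1 : ((1 : Residue C)) ^ p = 1 := one_pow _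
    have hcp := charP_residue hp.out h
    have hmem : ζ ∈ unitBall C := mem_unitBall.2 hζ1.le
    have h2 : IsLocalRing.residue (unitBall C) (⟨ζ, hmem⟩ - 1) = 0 := by
      have h3 : (IsLocalRing.residue (unitBall C) (⟨ζ, hmem⟩ - 1)) ^ p = 0 := by
        rw [map_sub, map_one, sub_pow_char, ← map_pow,
          show (⟨ζ, hmem⟩ : unitBall C) ^ p = 1 from Subtype.ext hζ.pow_eq_one, map_one, one_pow,
          sub_self]
      exact pow_eq_zero_iff hp.out.ne_zero |>.1 h3
    exact residue_eq_zero_iff_norm.1 h2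
  have hAn : ‖A‖ = 1 := by
    choose y hy hy' using fun x : E => exists_residue_eq (p := p) h ι x⁻¹
    have hAy : A = ((∑ x : E, y x * (m x : unitBall C) : unitBall C) : C) := by
      push_cast
      refine Finset.sum_congr rfl fun x _ => ?_
      rw [hy, hχ, MulChar.inv_apply']
    rw [hAy]
    refine norm_eq_one_of_residue_ne_zero ?_
    have : IsLocalRing.residue (unitBall C) (∑ x : E, y x * (m x : unitBall C)) =
        ι (∑ x : E, x⁻¹ * algebraMap (ZMod p) E (Algebra.trace (ZMod p) E x)) := by
      rw [map_sum, map_sum]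
      refine Finset.sum_congr rfl fun x _ => ?_
      rw [map_mul, map_mul, hy', map_natCast]
      congr 1
      conv_rhs => rw [← ZMod.natCast_zmod_val (Algebra.trace (ZMod p) E x)]
      rw [map_natCast, map_natCast]
    rw [this, sum_inv_mul_trace, map_neg, map_one]
    exact neg_ne_zero.2 one_ne_zero
  rw [hG, norm_mul]
  have hlt : ‖(ζ - 1) * B‖ < ‖A‖ := by
    rw [norm_mul, hAn]
    exact lt_of_le_of_lt (mul_le_of_le_one_right (norm_nonneg _) hBn) hπ
  rw [IsUltrametricDist.norm_add_eq_max_of_norm_ne_norm hlt.ne', max_eq_left hlt.le, hAn, mul_one]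

/-- **Stickelberger's theorem** on the absolute values of Gauss sums. -/
theorem norm_teichGauss (hpn : ‖(p : C)‖ = (p : ℝ)⁻¹) {N : ℕ} (hN : Module.finrank (ZMod p) E = N)
    {a : ℕ} (ha : a < p ^ N - 1) :
    ‖teichGauss h ι hζ a‖ = (p : ℝ) ^ (-((residueSum p N a : ℝ) / ((p ^ N - 1 : ℕ) : ℝ))) := by
  have hp1 : (1 : ℝ) < p := by exact_mod_cast hp.out.one_lt
  have hp0 : (0 : ℝ) < p := by linarith
  have hcard : Fintype.card E = p ^ N := by rw [card_eq p E, hN]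
  have hm0 : 0 < p ^ N - 1 := by omega
  have hmR : (0 : ℝ) < ((p ^ N - 1 : ℕ) : ℝ) := by exact_mod_cast hm0
  have hπ : ‖ζ - 1‖ = (p : ℝ) ^ (-(1 / ((p - 1 : ℕ) : ℝ))) := by
    have h1 := norm_primitiveRoot_sub_one hpn hζ
    have hp2 : p - 1 ≠ 0 := by have := hp.out.two_le; omega
    have h2 : (‖ζ - 1‖ ^ (p - 1)) ^ (((p - 1 : ℕ) : ℝ)⁻¹) = ‖ζ - 1‖ :=
      Real.pow_rpow_inv_natCast (norm_nonneg _) hp2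
    rw [← h2, h1, ← Real.rpow_neg_one, ← Real.rpow_mul hp0.le]
    congr 1
    rw [one_div]; ring
  -- Strong induction on a: a factor p is removed by Frobenius invariance; otherwise one copy of the
  -- character is split off by a Jacobi sum, at the cost of a factor |ζ - 1|.
  have hlow : ∀ a < p ^ N - 1,
      (p : ℝ) ^ (-((residueSum p N a : ℝ) / ((p ^ N - 1 : ℕ) : ℝ))) ≤ ‖teichGauss h ι hζ a‖ := by
    intro a
    induction a using Nat.strong_induction_on with
    | _ a ih =>
      intro ha
      rcases Nat.eq_zero_or_pos a with rfl | ha0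
      · rw [teichGauss_zero, residueSum_zero, norm_neg, norm_one]; simp
      by_cases hpa : p ∣ a
      · obtain ⟨b, rfl⟩ := hpa
        have hb : 0 < b := Nat.pos_of_ne_zero (by rintro rfl; simp at ha0)
        have hlt : b < p * b := (Nat.lt_mul_iff_one_lt_left hb).2 hp.out.one_lt
        rw [teichGauss_mul, residueSum_mul hp.out.one_lt]
        exact ih b hlt (hlt.trans ha)
      · obtain ⟨b, rfl⟩ : ∃ b, a = b + 1 := ⟨a - 1, (Nat.sub_add_cancel ha0).symm⟩
        have h1 : ‖teichGauss h ι hζ b‖ * ‖teichGauss h ι hζ 1‖ ≤ ‖teichGauss h ι hζ (b + 1)‖ :=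
          norm_teichGauss_mul_le h ι hζ (by
            rw [hcard]
            intro hd
            have := Nat.le_of_dvd ha0 hd
            omega)
        refine le_trans ?_ h1
        rw [norm_teichGauss_one h ι hζ (by rw [hcard]; omega), hπ]
        have h2 := residueSum_succ hp.out.one_lt ha hpa
        have hp3 : (0 : ℝ) < ((p - 1 : ℕ) : ℝ) := by
          have := hp.out.two_le
          exact_mod_cast (by omega : 0 < p - 1)
        have h3 : ((p - 1 : ℕ) : ℝ) * (residueSum p N (b + 1) : ℝ) =
            ((p - 1 : ℕ) : ℝ) * (residueSum p N b : ℝ) + ((p ^ N - 1 : ℕ) : ℝ) := by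
          exact_mod_cast h2
        have h4 : -((residueSum p N (b + 1) : ℝ) / ((p ^ N - 1 : ℕ) : ℝ)) =
            -((residueSum p N b : ℝ) / ((p ^ N - 1 : ℕ) : ℝ)) + -(1 / ((p - 1 : ℕ) : ℝ)) := by
          field_simp
          linarith
        rw [h4, Real.rpow_add hp0]
        exact mul_le_mul_of_nonneg_right (ih b (Nat.lt_succ_self b) (by omega))
          (Real.rpow_nonneg hp0.le _)
  rcases Nat.eq_zero_or_pos a with rfl | ha0
  · rw [teichGauss_zero, residueSum_zero, norm_neg, norm_one]; simp
  -- The lower bounds for a and its complement p^N - 1 - a multiply to p^(-N), which is exactly the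
  -- product of the two norms; so neither bound can be strict.
  have h1 := hlow a ha
  have h2 := hlow (p ^ N - 1 - a) (by omega)
  have h3 := norm_teichGauss_mul_neg h ι hζ (a := a) (b := p ^ N - 1 - a)
    (by rw [hcard]; intro hd; have := Nat.le_of_dvd ha0 hd; omega)
    (by rw [hcard, Nat.add_sub_cancel' ha.le])
  have h4 : (residueSum p N a : ℝ) + (residueSum p N (p ^ N - 1 - a) : ℝ) =
      N * ((p ^ N - 1 : ℕ) : ℝ) := by
    exact_mod_cast residueSum_add_sub ha0 ha
  have h5 : (p : ℝ) ^ (-((residueSum p N a : ℝ) / ((p ^ N - 1 : ℕ) : ℝ))) *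
      (p : ℝ) ^ (-((residueSum p N (p ^ N - 1 - a) : ℝ) / ((p ^ N - 1 : ℕ) : ℝ))) =
      ‖(Fintype.card E : C)‖ := by
    rw [← Real.rpow_add hp0, ← neg_add, ← add_div, h4, mul_div_cancel_right₀ _ hmR.ne', hcard,
      Nat.cast_pow, norm_pow, hpn, Real.rpow_neg hp0.le, Real.rpow_natCast, inv_pow]
  rw [← h3] at h5
  have hpos2 := Real.rpow_pos_of_pos hp0
    (-((residueSum p N (p ^ N - 1 - a) : ℝ) / ((p ^ N - 1 : ℕ) : ℝ)))
  refine le_antisymm ?_ h1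
  by_contra! hlt
  have := mul_lt_mul hlt h2 hpos2 (norm_nonneg _)
  exact absurd h5 this.ne

end Char

end Stickelberger

end

noncomputable section

/-! ### Lifting Teichmüller Gauss sums, and expanding diagonal exponential sums in them -/

namespace Stickelberger

open Teichmuller

theorem addChar_sum {ι A R : Type*} [AddCommMonoid A] [CommMonoid R] (ψ : AddChar A R)
    (s : Finset ι) (f : ι → A) : ψ (∑ i ∈ s, f i) = ∏ i ∈ s, ψ (f i) := by
  classical
  induction s using Finset.induction_on with
  | empty => simp
  | insert i s hi ih => rw [Finset.sum_insert hi, Finset.prod_insert hi, ψ.map_add_eq_mul, ih]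

theorem zpow_sum {ι G : Type*} [CommGroup G] (g : G) (s : Finset ι) (f : ι → ℤ) :
    g ^ (∑ i ∈ s, f i) = ∏ i ∈ s, g ^ f i := by
  classical
  induction s using Finset.induction_on with
  | empty => simp
  | insert i s hi ih => rw [Finset.sum_insert hi, Finset.prod_insert hi, zpow_add, ih]

variable {p : ℕ} [hp : Fact p.Prime] {C : Type*} [NormedField C] [IsUltrametricDist C]
  [IsAlgClosed C] [CharZero C] (h : ‖(p : C)‖ < 1) {ζ : C} (hζ : IsPrimitiveRoot ζ p)

section Lift

variable {E E' : Type*} [Field E] [Fintype E] [Algebra (ZMod p) E] [Field E'] [Fintype E']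
  [Algebra (ZMod p) E'] (ι : E →+* Residue C) (ι' : E' →+* Residue C)

theorem exists_map_eq_of_pow_card {K : Type*} [Field K] (ι' : E' →+* K) {y : K}
    (hy : y ^ Fintype.card E' = y) : ∃ x, ι' x = y := by
  classical
  have hne : (Polynomial.X ^ Fintype.card E' - Polynomial.X : Polynomial K) ≠ 0 :=
    FiniteField.X_pow_card_sub_X_ne_zero K Fintype.one_lt_card
  have hsub : Finset.univ.image ι' ⊆
      (Polynomial.X ^ Fintype.card E' - Polynomial.X : Polynomial K).roots.toFinset := by
    intro z hz
    obtain ⟨x, -, rfl⟩ := Finset.mem_image.1 hz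
    rw [Multiset.mem_toFinset, Polynomial.mem_roots hne]
    simp [← map_pow, FiniteField.pow_card]
  have heq := Finset.eq_of_subset_of_card_le hsub (by
    rw [Finset.card_image_of_injective _ ι'.injective, Finset.card_univ]
    refine (Multiset.toFinset_card_le _).trans ((Polynomial.card_roots' _).trans ?_)
    rw [FiniteField.X_pow_card_sub_X_natDegree_eq K Fintype.one_lt_card])
  have hmem : y ∈ Finset.univ.image ι' := by
    rw [heq, Multiset.mem_toFinset, Polynomial.mem_roots hne]
    simp [hy]
  obtain ⟨x, -, hx⟩ := Finset.mem_image.1 hmem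
  exact ⟨x, hx⟩

/-- The embedding of E' hits every root of X^|E'| - X, hence the image of E. The resulting extension
E ⊂ E' is compatible with the embeddings, so that the Teichmüller characters of the two fields
correspond under the norm. -/
theorem exists_ringHom_comp_eq {K : Type*} [Field K] (ι : E →+* K) (ι' : E' →+* K) {m : ℕ}
    (hm : Fintype.card E' = Fintype.card E ^ m) : ∃ f : E →+* E', ∀ x, ι' (f x) = ι x := by
  have hex : ∀ x, ∃ z, ι' z = ι x := fun x => exists_map_eq_of_pow_card ι' (by
    rw [← map_pow, hm, FiniteField.pow_card_pow])
  choose f hf using hex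
  exact ⟨{ toFun := f
           map_one' := ι'.injective (by simp [hf])
           map_zero' := ι'.injective (by simp [hf])
           map_add' := fun x y => ι'.injective (by simp [hf])
           map_mul' := fun x y => ι'.injective (by simp [hf]) }, hf⟩

/-- Hasse–Davenport for a Teichmüller power. The norm from E' to E is the power map with exponent
(|E'| - 1)/(|E| - 1), which accounts for the new index. -/
theorem neg_teichGauss_lift {m : ℕ} (hm : Fintype.card E' = Fintype.card E ^ m) (a : ℕ) :
    -teichGauss h ι' hζ (a * ((Fintype.card E' - 1) / (Fintype.card E - 1))) =
      (-teichGauss h ι hζ a) ^ m := by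
  obtain ⟨f, hf⟩ := exists_ringHom_comp_eq ι ι' hm
  let := f.toAlgebra
  have hrank : Module.finrank E E' = m := by
    have h1 := Module.card_eq_pow_finrank (K := E) (V := E')
    rw [hm] at h1
    exact (Nat.pow_right_injective Fintype.one_lt_card h1).symm
  have : IsScalarTower (ZMod p) E E' := .of_algebraMap_eq' (Subsingleton.elim _ _)
  have key := HasseDavenport.neg_sum_lift_eq (E := E') ((teichChar h ι)⁻¹ ^ a)
    (traceChar_ne_one (E := E) hζ)
  rw [hrank] at key
  rw [teichGauss, teichGauss, ← key, gaussSum]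
  congr 1
  refine Finset.sum_congr rfl fun x _ => ?_
  rw [traceChar_apply, traceChar_apply, Algebra.trace_trace]
  congr 1
  rcases eq_or_ne x 0 with rfl | hx
  · rw [MulChar.map_zero, Algebra.norm_zero, MulChar.map_zero]
  have hN : Algebra.norm E x ≠ 0 := by rwa [Algebra.norm_ne_zero_iff]
  have h1 : (teichChar h ι)⁻¹ (Algebra.norm E x) =
      (teichChar h ι')⁻¹ x ^ ((Fintype.card E' - 1) / (Fintype.card E - 1)) := by
    rw [MulChar.inv_apply', MulChar.inv_apply', ← map_pow, teichChar_apply, teichChar_apply, ← hf,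
      map_inv₀ f]
    have := FiniteField.algebraMap_norm_eq_pow (K := E) (x := x)
    rw [Nat.card_eq_fintype_card, Nat.card_eq_fintype_card] at this
    rw [inv_pow, ← this]
    rfl
  have h2 := MulChar.pow_apply_coe ((teichChar h ι)⁻¹) a (Units.mk0 _ hN)
  have h3 := MulChar.pow_apply_coe ((teichChar h ι')⁻¹)
    (a * ((Fintype.card E' - 1) / (Fintype.card E - 1))) (Units.mk0 _ hx)
  simp only [Units.val_mk0] at h2 h3
  rw [h2, h3, h1, ← pow_mul, mul_comm a]

end Lift

section Expansion

variable {E : Type*} [Field E] [Fintype E] [Algebra (ZMod p) E] (ι : E →+* Residue C)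

/-- The Teichmüller character on units. -/
def teichHom (h : ‖(p : C)‖ < 1) (ι : E →+* Residue C) : Eˣ →* Cˣ := (teichChar h ι).toUnitHom

theorem coe_teichHom (x : Eˣ) : (teichHom h ι x : C) = teichChar h ι x :=
  MulChar.coe_toUnitHom _ _

theorem teichHom_injective : Function.Injective (teichHom h ι) := fun x y hxy =>
  Units.ext (teichChar_injective h ι (by rw [← coe_teichHom, ← coe_teichHom, hxy]))

variable [DecidableEq E]

theorem teichHom_pow_card_sub_one (x : Eˣ) : teichHom h ι x ^ (Fintype.card E - 1) = 1 := by
  classical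
  rw [← map_pow, ← Fintype.card_units, pow_card_eq_one, map_one]

theorem sum_teichHom_zpow (b : ℤ) :
    ∑ x : Eˣ, ((teichHom h ι x ^ b : Cˣ) : C) =
      if ((Fintype.card E - 1 : ℕ) : ℤ) ∣ b then ((Fintype.card E - 1 : ℕ) : C) else 0 := by
  classical
  let f : Eˣ →* C := (Units.coeHom C).comp ((zpowGroupHom b).comp (teichHom h ι))
  have h1 := sum_hom_units f
  have h2 : f = 1 ↔ ((Fintype.card E - 1 : ℕ) : ℤ) ∣ b := by
    obtain ⟨g, hg⟩ := IsCyclic.exists_generator (α := Eˣ)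
    have hord : orderOf (teichHom h ι g) = Fintype.card E - 1 := by
      rw [orderOf_injective _ (teichHom_injective h ι), orderOf_eq_card_of_forall_mem_zpowers hg,
        Nat.card_eq_fintype_card, Fintype.card_units]
    rw [← hord, orderOf_dvd_iff_zpow_eq_one]
    constructor
    · intro hf
      exact Units.ext (DFunLike.congr_fun hf g)
    · intro hg1
      ext x
      obtain ⟨k, rfl⟩ := Subgroup.mem_zpowers_iff.1 (hg x)
      change ((teichHom h ι (g ^ k) ^ b : Cˣ) : C) = 1
      rw [map_zpow, ← zpow_mul, mul_comm, zpow_mul, hg1, one_zpow, Units.val_one]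
  rw [Fintype.card_units] at h1
  refine h1.trans ?_
  simp only [h2]
  split_ifs <;> simp

theorem sum_range_teichHom_pow (y : Eˣ) [Decidable (y = 1)] :
    ∑ a ∈ Finset.range (Fintype.card E - 1), (teichHom h ι y : C) ^ a =
      if y = 1 then ((Fintype.card E - 1 : ℕ) : C) else 0 := by
  split_ifs with hy
  · simp [hy]
  · have h1 := geom_sum_mul (teichHom h ι y : C) (Fintype.card E - 1)
    rw [← Units.val_pow_eq_pow_val, teichHom_pow_card_sub_one, Units.val_one, sub_self] at h1
    refine (mul_eq_zero.1 h1).resolve_right (sub_ne_zero.2 fun h2 => hy ?_)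
    exact teichHom_injective h ι (by rw [map_one]; exact Units.ext h2)

theorem teichGauss_eq_sum_units (a : ℕ) :
    teichGauss h ι hζ a = ∑ x : Eˣ, (teichHom h ι x⁻¹ : C) ^ a * traceChar hζ E x := by
  rw [teichGauss, gaussSum]
  classical
  symm
  refine Finset.sum_of_injOn Units.val (fun _ _ _ _ hxy => Units.ext hxy)
    (fun _ _ => Finset.mem_univ _) ?_ ?_
  · intro x _ hx
    have : x = 0 := by
      by_contra h0
      exact hx ⟨Units.mk0 x h0, Finset.mem_coe.2 (Finset.mem_univ _), rfl⟩
    rw [this, MulChar.map_zero, zero_mul]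
  · intro x _
    rw [MulChar.pow_apply_coe, coe_teichHom, MulChar.inv_apply', Units.val_inv_eq_inv_val]

/-- Fourier inversion on the cyclic group Eˣ, cleared of the denominator |E| - 1. -/
theorem card_mul_traceChar (y : Eˣ) :
    ((Fintype.card E - 1 : ℕ) : C) * traceChar hζ E y =
      ∑ a ∈ Finset.range (Fintype.card E - 1),
        teichGauss h ι hζ a * (teichHom h ι y : C) ^ a := by
  simp_rw [teichGauss_eq_sum_units, Finset.sum_mul]
  rw [Finset.sum_comm]
  have : ∀ x : Eˣ, ∑ a ∈ Finset.range (Fintype.card E - 1),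
      (teichHom h ι x⁻¹ : C) ^ a * traceChar hζ E x * (teichHom h ι y : C) ^ a =
      if x = y then ((Fintype.card E - 1 : ℕ) : C) * traceChar hζ E y else 0 := by
    intro x
    have h1 := sum_range_teichHom_pow h ι (x⁻¹ * y)
    have h2 : x⁻¹ * y = 1 ↔ x = y := by rw [inv_mul_eq_one]
    simp only [h2] at h1
    have h3 : ∀ a ∈ Finset.range (Fintype.card E - 1),
        (teichHom h ι x⁻¹ : C) ^ a * traceChar hζ E x * (teichHom h ι y : C) ^ a =
        (teichHom h ι (x⁻¹ * y) : C) ^ a * traceChar hζ E x := by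
      intro a _
      rw [map_mul, Units.val_mul, mul_pow]; ring
    rw [Finset.sum_congr rfl h3, ← Finset.sum_mul, h1]
    split_ifs with hxy
    · rw [hxy]
    · rw [zero_mul]
  rw [Finset.sum_congr rfl fun x _ => this x]
  simp

/-- The exponential sum of a diagonal Laurent polynomial in terms of Gauss sums. -/
theorem sum_traceChar_diagonal {n : ℕ} (M : Matrix (Fin n) (Fin n) ℤ) (c : Fin n → Eˣ) :
    ∑ x : Fin n → Eˣ, traceChar hζ E (∑ j, (c j : E) * ((∏ i, x i ^ M i j : Eˣ) : E)) =
      ∑ a ∈ (Fintype.piFinset fun _ : Fin n => Finset.range (Fintype.card E - 1)).filter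
          (fun a => ∀ i, ((Fintype.card E - 1 : ℕ) : ℤ) ∣ ∑ j, M i j * (a j : ℤ)),
        ∏ j, teichGauss h ι hζ (a j) * (teichHom h ι (c j) : C) ^ a j := by
  set m := Fintype.card E - 1 with hm
  have hm0 : (m : C) ≠ 0 := by
    have := Fintype.one_lt_card (α := E)
    exact_mod_cast (by omega : m ≠ 0)
  have hx : ∀ x : Fin n → Eˣ,
      (m : C) ^ n * traceChar hζ E (∑ j, (c j : E) * ((∏ i, x i ^ M i j : Eˣ) : E)) =
      ∑ a ∈ Fintype.piFinset fun _ : Fin n => Finset.range m,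
        (∏ j, teichGauss h ι hζ (a j) * (teichHom h ι (c j) : C) ^ a j) *
          ∏ i, ((teichHom h ι (x i) ^ (∑ j, M i j * (a j : ℤ)) : Cˣ) : C) := by
    intro x
    have h1 : traceChar hζ E (∑ j, (c j : E) * ((∏ i, x i ^ M i j : Eˣ) : E)) =
        ∏ j, traceChar hζ E ((c j * ∏ i, x i ^ M i j : Eˣ) : E) := by
      rw [addChar_sum]
      rfl
    have h2 : (m : C) ^ n = ∏ _j : Fin n, (m : C) := by simp
    rw [h1, h2, ← Finset.prod_mul_distrib,
      Finset.prod_congr rfl fun j _ => card_mul_traceChar h hζ ι _, Finset.prod_univ_sum]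
    refine Finset.sum_congr rfl fun a _ => ?_
    have h3 : ∏ i, ((teichHom h ι (x i) ^ (∑ j, M i j * (a j : ℤ)) : Cˣ) : C) =
        ∏ j, (teichHom h ι (∏ i, x i ^ M i j) : C) ^ a j := by
      simp_rw [← Units.val_pow_eq_pow_val, ← Units.coe_prod]
      congr 1
      simp_rw [map_prod, map_zpow, ← Finset.prod_pow, ← zpow_natCast, ← zpow_mul]
      rw [Finset.prod_comm]
      refine Finset.prod_congr rfl fun i _ => ?_
      exact zpow_sum _ _ _
    rw [h3, ← Finset.prod_mul_distrib]
    refine Finset.prod_congr rfl fun j _ => ?_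
    rw [map_mul, Units.val_mul, mul_pow, mul_assoc]
  refine mul_left_cancel₀ (pow_ne_zero n hm0) ?_
  rw [Finset.mul_sum, Finset.sum_congr rfl fun x _ => hx x, Finset.sum_comm, Finset.sum_filter,
    Finset.mul_sum]
  refine Finset.sum_congr rfl fun a _ => ?_
  rw [← Finset.mul_sum]
  -- The sum over the torus factors over the coordinates; orthogonality in each coordinate yields
  -- one congruence modulo |E| - 1.
  have h4 := Finset.prod_univ_sum (fun _ : Fin n => (Finset.univ : Finset Eˣ))
    (fun i x => ((teichHom h ι x ^ (∑ j, M i j * (a j : ℤ)) : Cˣ) : C))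
  rw [Fintype.piFinset_univ] at h4
  rw [← h4, Finset.prod_congr rfl fun i _ => sum_teichHom_zpow h ι _]
  split_ifs with hall
  · rw [Finset.prod_congr rfl (g := fun _ => (m : C)) fun i _ => if_pos (hall i)]
    simp [mul_comm]
  · push Not at hall
    obtain ⟨i, hi⟩ := hall
    have h5 : ∏ i, (if (m : ℤ) ∣ ∑ j, M i j * (a j : ℤ) then (m : C) else 0) = 0 :=
      Finset.prod_eq_zero (Finset.mem_univ i) (if_neg hi)
    rw [h5, mul_zero, mul_zero]

end Expansion

end Stickelberger

end

noncomputable section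

/-! ### Gauss sums as functions of the size of the field alone -/

namespace Stickelberger

open Teichmuller

variable {p : ℕ} [hp : Fact p.Prime] {C : Type*} [NormedField C] [IsUltrametricDist C]
  [IsAlgClosed C] (h : ‖(p : C)‖ < 1)

theorem nonempty_ringHom_residue (h : ‖(p : C)‖ < 1) (E : Type*) [Field E] [Finite E]
    [Algebra (ZMod p) E] : Nonempty (E →+* Residue C) := by
  have := charP_residue hp.out h
  let := ZMod.algebra (Residue C) p
  exact ⟨(IsAlgClosed.lift (R := ZMod p) (S := E) (M := Residue C)).toRingHom⟩

theorem exists_field (h : ‖(p : C)‖ < 1) {N : ℕ} (hN : N ≠ 0) :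
    ∃ (E : Type) (_ : Field E) (_ : Fintype E) (_ : Algebra (ZMod p) E) (_ : E →+* Residue C),
      Fintype.card E = p ^ N ∧ Module.finrank (ZMod p) E = N := by
  refine ⟨GaloisField p N, inferInstance, Fintype.ofFinite _, inferInstance,
    (nonempty_ringHom_residue h (GaloisField p N)).some, ?_, GaloisField.finrank p hN⟩
  rw [Fintype.card_eq_nat_card, GaloisField.card p N hN]

variable [CharZero C] {ζ : C} (hζ : IsPrimitiveRoot ζ p)

/-- The Gauss sum of the `a`-th power of the inverse Teichmüller character of the field with
`p ^ N` elements. -/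
def gaussValue (N a : ℕ) : C :=
  letI := Fintype.ofFinite (GaloisField p N)
  teichGauss h (nonempty_ringHom_residue h (GaloisField p N)).some hζ a

/-- The degree one case of the lifting relation: the Gauss sum depends neither on the model of the
field nor on its embedding in the residue field. -/
theorem teichGauss_eq_gaussValue {E : Type*} [Field E] [Fintype E] [Algebra (ZMod p) E]
    (ι : E →+* Residue C) {N : ℕ} (hN : Fintype.card E = p ^ N) (a : ℕ) :
    teichGauss h ι hζ a = gaussValue h hζ N a := by
  let := Fintype.ofFinite (GaloisField p N)
  have hN0 : N ≠ 0 := by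
    rintro rfl
    have := Fintype.one_lt_card (α := E)
    rw [hN, pow_zero] at this
    exact lt_irrefl _ this
  have hcard : Fintype.card (GaloisField p N) = p ^ N := by
    rw [Fintype.card_eq_nat_card, GaloisField.card p N hN0]
  have key := neg_teichGauss_lift h hζ (nonempty_ringHom_residue h (GaloisField p N)).some ι
    (m := 1) (by rw [hN, hcard, pow_one]) a
  rw [hN, hcard, pow_one, neg_inj, Nat.div_self, mul_one] at key
  · exact key
  · have := Nat.one_lt_pow hN0 hp.out.one_lt
    omega

theorem neg_gaussValue_lift {N m : ℕ} (hN : N ≠ 0) (hm : m ≠ 0) (a : ℕ) :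
    -gaussValue h hζ (N * m) (a * ((p ^ (N * m) - 1) / (p ^ N - 1))) =
      (-gaussValue h hζ N a) ^ m := by
  obtain ⟨E, _, _, _, ι, hE, -⟩ := exists_field h hN
  obtain ⟨E', _, _, _, ι', hE', -⟩ := exists_field h (Nat.mul_ne_zero hN hm)
  rw [← teichGauss_eq_gaussValue h hζ ι hE, ← teichGauss_eq_gaussValue h hζ ι' hE', ← hE, ← hE']
  exact neg_teichGauss_lift h hζ ι ι' (by rw [hE, hE', pow_mul]) a

theorem gaussValue_mul {N : ℕ} (hN : N ≠ 0) (a : ℕ) :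
    gaussValue h hζ N (p * a) = gaussValue h hζ N a := by
  obtain ⟨E, _, _, _, ι, hE, -⟩ := exists_field h hN
  rw [← teichGauss_eq_gaussValue h hζ ι hE, ← teichGauss_eq_gaussValue h hζ ι hE, teichGauss_mul]

theorem gaussValue_pow_mul {N : ℕ} (hN : N ≠ 0) (i a : ℕ) :
    gaussValue h hζ N (p ^ i * a) = gaussValue h hζ N a := by
  induction i with
  | zero => simp
  | succ i ih => rw [pow_succ', mul_assoc, gaussValue_mul h hζ hN, ih]

theorem gaussValue_mod {N : ℕ} (hN : N ≠ 0) (a : ℕ) :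
    gaussValue h hζ N (a % (p ^ N - 1)) = gaussValue h hζ N a := by
  obtain ⟨E, _, _, _, ι, hE, -⟩ := exists_field h hN
  rw [← teichGauss_eq_gaussValue h hζ ι hE, ← teichGauss_eq_gaussValue h hζ ι hE, teichGauss,
    teichGauss]
  congr 1
  have h1 : (teichChar h ι)⁻¹ ^ (p ^ N - 1) = 1 := by
    rw [teichChar_inv_pow_eq_one_iff, hE]
  conv_rhs => rw [← Nat.mod_add_div a (p ^ N - 1), pow_add, pow_mul, h1, one_pow, mul_one]

theorem norm_gaussValue (hpn : ‖(p : C)‖ = (p : ℝ)⁻¹) {N : ℕ} (hN : N ≠ 0) {a : ℕ}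
    (ha : a < p ^ N - 1) : ‖gaussValue h hζ N a‖ =
      (p : ℝ) ^ (-((residueSum p N a : ℝ) / ((p ^ N - 1 : ℕ) : ℝ))) := by
  obtain ⟨E, _, _, _, ι, hE, hr⟩ := exists_field h hN
  rw [← teichGauss_eq_gaussValue h hζ ι hE, norm_teichGauss h ι hζ hpn hr ha]

end Stickelberger

/-! ### The finite set S(Δ) and the action of integers prime to det M -/

namespace DiagonalLaurent

section Solutions

variable {n : ℕ} {M : Matrix (Fin n) (Fin n) ℤ}

theorem fracMul_fracMul (m m' : ℕ) (r : Fin n → ℚ) :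
    fracMul m (fracMul m' r) = fracMul (m * m') r := by
  funext i
  simp only [fracMul]
  rw [Int.fract_eq_fract]
  refine ⟨-(m * ⌊(m' : ℚ) * r i⌋), ?_⟩
  rw [Int.fract]; push_cast; ring

theorem fracMul_one {r : Fin n → ℚ} (hr : r ∈ solutionSet M) : fracMul 1 r = r := by
  funext i
  simp only [fracMul, Nat.cast_one, one_mul]
  exact Int.fract_eq_self.2 (hr.1 i)

/-- Apply the adjugate of M to M r = u. This makes S(Δ) finite and the action of m on it depend only
on m modulo det M. -/
theorem exists_det_mul {r : Fin n → ℚ} (hr : r ∈ solutionSet M) (i : Fin n) :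
    ∃ z : ℤ, (M.det : ℚ) * r i = z := by
  obtain ⟨-, u, hu⟩ := hr
  refine ⟨(M.adjugate.mulVec u) i, ?_⟩
  have h1 : (M.map (Int.cast : ℤ → ℚ)).adjugate.mulVec ((M.map (Int.cast : ℤ → ℚ)).mulVec r) =
      (M.map (Int.cast : ℤ → ℚ)).det • r := by
    rw [Matrix.mulVec_mulVec, Matrix.adjugate_mul, Matrix.smul_mulVec, Matrix.one_mulVec]
  have h2 : (M.map (Int.cast : ℤ → ℚ)).det = (M.det : ℚ) :=
    ((Int.castRingHom ℚ).map_det M).symm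
  have h3 : (M.map (Int.cast : ℤ → ℚ)).adjugate = M.adjugate.map (Int.cast : ℤ → ℚ) :=
    ((Int.castRingHom ℚ).map_adjugate M).symm
  rw [h2, hu, h3] at h1
  have h4 := congrFun h1 i
  rw [Pi.smul_apply, smul_eq_mul] at h4
  rw [← h4]
  simp [Matrix.mulVec, dotProduct]

theorem finite_solutionSet (hM : M.det ≠ 0) : (solutionSet M).Finite := by
  have hd : (0 : ℚ) < |(M.det : ℚ)| := abs_pos.2 (Int.cast_ne_zero.2 hM)
  refine Set.Finite.subset (s := Set.pi Set.univ fun _ : Fin n =>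
    (fun z : ℤ => (z : ℚ) / (M.det : ℚ)) '' (Set.Icc (-|M.det|) |M.det|))
    (Set.Finite.pi fun _ => (Set.finite_Icc _ _).image _) ?_
  intro r hr i _
  obtain ⟨z, hz⟩ := exists_det_mul hr i
  refine ⟨z, ?_, ?_⟩
  · have h1 : |(z : ℚ)| ≤ |(M.det : ℚ)| := by
      rw [← hz, abs_mul]
      refine mul_le_of_le_one_right hd.le ?_
      rw [abs_of_nonneg (hr.1 i).1]
      exact (hr.1 i).2.le
    rw [Set.mem_Icc, ← abs_le]
    exact_mod_cast h1
  · simp only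
    rw [← hz, mul_div_cancel_left₀ _ (Int.cast_ne_zero.2 hM)]

theorem fracMul_eq_self_of_modEq {r : Fin n → ℚ} (hr : r ∈ solutionSet M) {m : ℕ}
    (hm : m ≡ 1 [MOD M.det.natAbs]) : fracMul m r = r := by
  rw [← fracMul_one hr, fracMul_fracMul, mul_one]
  funext i
  simp only [fracMul]
  rw [Int.fract_eq_fract]
  obtain ⟨z, hz⟩ := exists_det_mul hr i
  have h1 : M.det ∣ (m : ℤ) - 1 := by
    rw [← Int.natAbs_dvd]
    have := Nat.modEq_iff_dvd.1 hm.symm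
    rwa [Nat.cast_one] at this
  obtain ⟨c, hc⟩ := h1
  refine ⟨c * z, ?_⟩
  have h2 : (m : ℚ) - 1 = M.det * c := by exact_mod_cast hc
  push_cast
  rw [← hz, one_mul]
  linear_combination (r i) * h2

theorem mul_pow_totient_sub_one_modEq {m d : ℕ} (hm : m.Coprime d) :
    m * m ^ (d.totient - 1) ≡ 1 [MOD d] := by
  rcases Nat.eq_zero_or_pos d with rfl | hd
  · rw [Nat.coprime_zero_right] at hm
    simp [hm, Nat.ModEq.refl]
  · rw [← pow_succ', Nat.sub_add_cancel (Nat.totient_pos.2 hd)]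
    exact Nat.ModEq.pow_totient hm

/-- The action of a number prime to `det M` on the solution set. -/
def fracMulPerm (M : Matrix (Fin n) (Fin n) ℤ) (m : ℕ) (hm : m.Coprime M.det.natAbs) :
    Equiv.Perm (solutionSet M) where
  toFun r := ⟨fracMul m r, fracMul_mem M m r.2⟩
  invFun r := ⟨fracMul (m ^ (M.det.natAbs.totient - 1)) r, fracMul_mem M _ r.2⟩
  left_inv r := Subtype.ext <| by
    dsimp only
    rw [fracMul_fracMul, mul_comm]
    exact fracMul_eq_self_of_modEq r.2 (mul_pow_totient_sub_one_modEq hm)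
  right_inv r := Subtype.ext <| by
    dsimp only
    rw [fracMul_fracMul]
    exact fracMul_eq_self_of_modEq r.2 (mul_pow_totient_sub_one_modEq hm)

theorem coe_fracMulPerm_pow {m : ℕ} (hm : m.Coprime M.det.natAbs) (k : ℕ) (r : solutionSet M) :
    (((fracMulPerm M m hm) ^ k) r : Fin n → ℚ) = fracMul (m ^ k) r := by
  induction k with
  | zero => simp [fracMul_one r.2]
  | succ k ih =>
    rw [pow_succ', Equiv.Perm.mul_apply, pow_succ', ← fracMul_fracMul, ← ih]
    rfl

theorem fracMulPerm_pow_totient {m : ℕ} (hm : m.Coprime M.det.natAbs) :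
    (fracMulPerm M m hm) ^ M.det.natAbs.totient = 1 := by
  ext1 r
  refine Subtype.ext ?_
  rw [coe_fracMulPerm_pow]
  exact fracMul_eq_self_of_modEq r.2 (Nat.ModEq.pow_totient hm)

end Solutions

end DiagonalLaurent

end

noncomputable section

/-! ### The contribution of a point of S(Δ) to the exponential sums -/

namespace DiagonalLaurent

open Teichmuller Stickelberger

section Index

/-- The exponent `(p ^ N - 1) x` attached to a rational number `x` fixed by `x ↦ {p ^ N x}`. -/
def expIndex (p N : ℕ) (x : ℚ) : ℕ := ⌊((p ^ N - 1 : ℕ) : ℚ) * x⌋₊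

variable {p N : ℕ} {x : ℚ}

/-- Being fixed by multiplication by p^N modulo 1 means that (p^N - 1)x is an integer, so the floor
loses nothing. -/
theorem coe_expIndex (hp : 0 < p) (hx : 0 ≤ x) (h : Int.fract (((p ^ N : ℕ) : ℚ) * x) = x) :
    (expIndex p N x : ℚ) = ((p ^ N - 1 : ℕ) : ℚ) * x := by
  have h1 : ((p ^ N - 1 : ℕ) : ℚ) * x = (⌊((p ^ N : ℕ) : ℚ) * x⌋ : ℤ) := by
    rw [Nat.cast_sub (Nat.one_le_pow _ _ hp), sub_mul, Nat.cast_one, one_mul]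
    rw [Int.fract] at h
    linarith
  have h2 : 0 ≤ ⌊((p ^ N : ℕ) : ℚ) * x⌋ := Int.floor_nonneg.2 (by positivity)
  rw [expIndex, h1]
  obtain ⟨m, hm⟩ := Int.eq_ofNat_of_zero_le h2
  rw [hm]
  simp

theorem expIndex_lt (hQ : 1 < p ^ N) (hx0 : 0 ≤ x) (hx1 : x < 1) : expIndex p N x < p ^ N - 1 := by
  have hpos : (0 : ℚ) < ((p ^ N - 1 : ℕ) : ℚ) := by exact_mod_cast (by omega : 0 < p ^ N - 1)
  rw [expIndex, Nat.floor_lt (by positivity)]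
  exact mul_lt_of_lt_one_right hpos hx1

theorem expIndex_lift (hp : 1 < p) (hN : N ≠ 0) (hx : 0 ≤ x)
    (h : Int.fract (((p ^ N : ℕ) : ℚ) * x) = x) (m : ℕ) :
    expIndex p (N * m) x = expIndex p N x * ((p ^ (N * m) - 1) / (p ^ N - 1)) := by
  have hd : p ^ N - 1 ∣ p ^ (N * m) - 1 := by
    rw [pow_mul]; simpa using Nat.sub_dvd_pow_sub_pow (p ^ N) 1 m
  obtain ⟨s, hs⟩ := hd
  have hpos : 0 < p ^ N - 1 := by have := Nat.one_lt_pow hN hp; omega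
  rw [hs, Nat.mul_div_cancel_left _ hpos, expIndex, hs]
  have : (((p ^ N - 1) * s : ℕ) : ℚ) * x = ((expIndex p N x * s : ℕ) : ℚ) := by
    push_cast
    rw [coe_expIndex (by omega) hx h]; ring
  rw [this, Nat.floor_natCast]

theorem fract_pow_mul_eq (hp : 1 < p) (hN : N ≠ 0) (hx : 0 ≤ x)
    (h : Int.fract (((p ^ N : ℕ) : ℚ) * x) = x) (i : ℕ) :
    Int.fract (((p ^ i : ℕ) : ℚ) * x) =
      (((p ^ i * expIndex p N x) % (p ^ N - 1) : ℕ) : ℚ) / ((p ^ N - 1 : ℕ) : ℚ) := by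
  have hpos : 0 < p ^ N - 1 := by have := Nat.one_lt_pow hN hp; omega
  have hne : ((p ^ N - 1 : ℕ) : ℚ) ≠ 0 := by exact_mod_cast hpos.ne'
  rw [← Int.fract_div_natCast_eq_div_natCast_mod]
  congr 1
  rw [eq_div_iff hne]
  push_cast [coe_expIndex (by omega : 0 < p) hx h]
  ring

theorem expIndex_fract (hp : 1 < p) (hN : N ≠ 0) (hx : 0 ≤ x)
    (h : Int.fract (((p ^ N : ℕ) : ℚ) * x) = x) (i : ℕ) :
    expIndex p N (Int.fract (((p ^ i : ℕ) : ℚ) * x)) = (p ^ i * expIndex p N x) % (p ^ N - 1) := by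
  have hpos : 0 < p ^ N - 1 := by have := Nat.one_lt_pow hN hp; omega
  have hne : ((p ^ N - 1 : ℕ) : ℚ) ≠ 0 := by exact_mod_cast hpos.ne'
  rw [fract_pow_mul_eq hp hN hx h, expIndex, mul_div_cancel₀ _ hne, Nat.floor_natCast]

theorem residueSum_expIndex (hp : 1 < p) (hN : N ≠ 0) (hx : 0 ≤ x)
    (h : Int.fract (((p ^ N : ℕ) : ℚ) * x) = x) :
    (residueSum p N (expIndex p N x) : ℚ) / ((p ^ N - 1 : ℕ) : ℚ) =
      ∑ i ∈ Finset.range N, Int.fract (((p ^ i : ℕ) : ℚ) * x) := by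
  rw [residueSum, Nat.cast_sum, Finset.sum_div]
  exact Finset.sum_congr rfl fun i _ => (fract_pow_mul_eq hp hN hx h i).symm

end Index

section Eigen

variable {p : ℕ} [hp : Fact p.Prime] {C : Type*} [NormedField C] [IsUltrametricDist C]
  [IsAlgClosed C] [CharZero C] (h : ‖(p : C)‖ < 1) {ζ : C} (hζ : IsPrimitiveRoot ζ p)
  {n : ℕ} {M : Matrix (Fin n) (Fin n) ℤ}

/-- The contribution of `r` to the exponential sum over the field with `p ^ N` elements; here
`t` is the vector of Teichmüller lifts of the coefficients. -/
def eigenvalue (t : Fin n → C) (N : ℕ) (r : Fin n → ℚ) : C :=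
  ∏ j, -gaussValue h hζ N (expIndex p N (r j)) * t j ^ expIndex p N (r j)

variable {t : Fin n → C} {N : ℕ} {r : Fin n → ℚ}

/-- The Gauss sum factors lift by Hasse–Davenport. For the others, (p^(Nm) - 1)/(p^N - 1) is a sum
of m powers of p^N, each of which fixes t j, so raising to it is the m-th power. -/
theorem eigenvalue_lift (hN : N ≠ 0) {m : ℕ} (hm : m ≠ 0) (ht : ∀ j, t j ^ p ^ N = t j)
    (hr : r ∈ solutionSet M) (hNr : fracMul (p ^ N) r = r) :
    eigenvalue h hζ t (N * m) r = eigenvalue h hζ t N r ^ m := by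
  rw [eigenvalue, eigenvalue, ← Finset.prod_pow]
  refine Finset.prod_congr rfl fun j _ => ?_
  rw [expIndex_lift hp.out.one_lt hN (hr.1 j).1 (congrFun hNr j), neg_gaussValue_lift h hζ hN hm,
    mul_pow]
  congr 1
  have h1 : ∀ i, t j ^ (p ^ N) ^ i = t j := fun i => by
    rw [← pow_mul, pow_pow_mul_eq (ht j)]
  have h2 : t j ^ ((p ^ (N * m) - 1) / (p ^ N - 1)) = t j ^ m := by
    rw [pow_mul, ← Nat.geomSum_eq (Nat.one_lt_pow hN hp.out.one_lt), ← Finset.prod_pow_eq_pow_sum,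
      Finset.prod_congr rfl fun i _ => h1 i, Finset.prod_const, Finset.card_range]
  rw [mul_comm, pow_mul, h2, ← pow_mul, ← pow_mul, mul_comm]

/-- Multiplying r by p^e multiplies the Gauss sum indices by p^e modulo p^N - 1, which changes
neither the Gauss sums nor powers of t j, fixed by the p^e-th power map. -/
theorem eigenvalue_fracMul {e : ℕ} (hN : N ≠ 0) (ht : ∀ j, t j ^ p ^ e = t j) (heN : e ∣ N)
    (ht0 : ∀ j, t j ≠ 0) (hr : r ∈ solutionSet M) (hNr : fracMul (p ^ N) r = r) :
    eigenvalue h hζ t N (fracMul (p ^ e) r) = eigenvalue h hζ t N r := by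
  rw [eigenvalue, eigenvalue]
  refine Finset.prod_congr rfl fun j _ => ?_
  have h1 : expIndex p N (fracMul (p ^ e) r j) = (p ^ e * expIndex p N (r j)) % (p ^ N - 1) :=
    expIndex_fract hp.out.one_lt hN (hr.1 j).1 (congrFun hNr j) e
  rw [h1, gaussValue_mod h hζ hN, gaussValue_pow_mul h hζ hN]
  congr 1
  have h2 : t j ^ (p ^ N - 1) = 1 := by
    obtain ⟨c, rfl⟩ := heN
    have h3 := pow_pow_mul_eq (ht j) c
    refine mul_right_cancel₀ (ht0 j) ?_
    rw [← pow_succ, Nat.sub_add_cancel (Nat.one_le_pow _ _ hp.out.pos), h3, one_mul]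
  have h4 : t j ^ (p ^ e * expIndex p N (r j)) = t j ^ expIndex p N (r j) := by
    rw [pow_mul, ht]
  conv_rhs => rw [← h4, ← Nat.mod_add_div (p ^ e * expIndex p N (r j)) (p ^ N - 1), pow_add,
    pow_mul (t j) (p ^ N - 1), h2, one_pow, mul_one]

theorem norm_eigenvalue (hpn : ‖(p : C)‖ = (p : ℝ)⁻¹) (hN : N ≠ 0) (ht : ∀ j, ‖t j‖ = 1)
    (hr : r ∈ solutionSet M) (hNr : fracMul (p ^ N) r = r) :
    ‖eigenvalue h hζ t N r‖ =
      (p : ℝ) ^ (-∑ i ∈ Finset.range N, (rnorm (fracMul (p ^ i) r) : ℝ)) := by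
  have hp0 : (0 : ℝ) < p := by exact_mod_cast hp.out.pos
  have h1 : ∀ j, ‖-gaussValue h hζ N (expIndex p N (r j)) * t j ^ expIndex p N (r j)‖ =
      (p : ℝ) ^ (-∑ i ∈ Finset.range N, (fracMul (p ^ i) r j : ℝ)) := by
    intro j
    rw [norm_mul, norm_neg, norm_pow, ht, one_pow, mul_one,
      norm_gaussValue h hζ hpn hN (expIndex_lt (Nat.one_lt_pow hN hp.out.one_lt) (hr.1 j).1
        (hr.1 j).2)]
    congr 2
    have := residueSum_expIndex hp.out.one_lt hN (hr.1 j).1 (congrFun hNr j)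
    have := congrArg (Rat.cast : ℚ → ℝ) this
    rw [Rat.cast_div, Rat.cast_sum, Rat.cast_natCast, Rat.cast_natCast] at this
    exact this
  rw [eigenvalue, norm_prod, Finset.prod_congr rfl fun j _ => h1 j, ← Real.rpow_sum_of_pos hp0,
    Finset.sum_neg_distrib, Finset.sum_comm]
  congr 2
  refine Finset.sum_congr rfl fun i _ => ?_
  rw [rnorm]; push_cast; rfl

/-- The surviving exponent vectors a correspond to the points r = a/(p^N - 1) fixed by p^N. The sign
compensates for the negated Gauss sums in `eigenvalue`. -/
theorem sum_traceChar_eq_sum_eigenvalue [Fintype (solutionSet M)] {E : Type*} [Field E] [Fintype E]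
    [DecidableEq E] [Algebra (ZMod p) E] (ι : E →+* Residue C) (hE : Fintype.card E = p ^ N)
    (c : Fin n → Eˣ) (hc : ∀ j, teichChar h ι (c j) = t j) :
    ∑ x : Fin n → Eˣ, traceChar hζ E (∑ j, (c j : E) * ((∏ i, x i ^ M i j : Eˣ) : E)) =
      (-1) ^ n * ∑ r ∈ Finset.univ.filter (fun r : solutionSet M =>
        fracMul (p ^ N) (r : Fin n → ℚ) = (r : Fin n → ℚ)),
          eigenvalue h hζ t N r := by
  classical
  have hQ : 1 < p ^ N := by rw [← hE]; exact Fintype.one_lt_card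
  have hpos : 0 < p ^ N - 1 := by omega
  have hne : ((p ^ N - 1 : ℕ) : ℚ) ≠ 0 := by exact_mod_cast hpos.ne'
  have hne' : (0 : ℚ) < ((p ^ N - 1 : ℕ) : ℚ) := by exact_mod_cast hpos
  rw [sum_traceChar_diagonal h hζ ι M c, hE, Finset.mul_sum]
  symm
  refine Finset.sum_bij (fun r _ => fun j => expIndex p N ((r : Fin n → ℚ) j)) ?_ ?_ ?_ ?_
  · intro r hr
    rw [Finset.mem_filter] at hr
    rw [Finset.mem_filter, Fintype.mem_piFinset]
    refine ⟨fun j => Finset.mem_range.2 (expIndex_lt hQ (r.2.1 j).1 (r.2.1 j).2), fun i => ?_⟩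
    obtain ⟨u, hu⟩ := r.2.2
    refine ⟨u i, ?_⟩
    have h1 := congrFun hu i
    simp only [Matrix.mulVec, dotProduct, Matrix.map_apply] at h1
    have : ((∑ j, M i j * (expIndex p N ((r : Fin n → ℚ) j) : ℤ) : ℤ) : ℚ) =
        (((p ^ N - 1 : ℕ) : ℤ) * u i : ℤ) := by
      push_cast
      rw [← h1, Finset.mul_sum]
      refine Finset.sum_congr rfl fun j _ => ?_
      rw [coe_expIndex hp.out.pos (r.2.1 j).1 (congrFun hr.2 j)]
      ring
    exact_mod_cast this
  · intro r hr r' hr' hrr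
    rw [Finset.mem_filter] at hr hr'
    refine Subtype.ext (funext fun j => ?_)
    have h1 := congrArg (Nat.cast : ℕ → ℚ) (congrFun hrr j)
    rw [coe_expIndex hp.out.pos (r.2.1 j).1 (congrFun hr.2 j),
      coe_expIndex hp.out.pos (r'.2.1 j).1 (congrFun hr'.2 j)] at h1
    exact mul_left_cancel₀ hne h1
  · intro a ha
    rw [Finset.mem_filter, Fintype.mem_piFinset] at ha
    obtain ⟨ha, hdvd⟩ := ha
    have hlt : ∀ j, a j < p ^ N - 1 := fun j => Finset.mem_range.1 (ha j)
    set r : Fin n → ℚ := fun j => (a j : ℚ) / ((p ^ N - 1 : ℕ) : ℚ) with hr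
    choose u hu using hdvd
    have hmem : r ∈ solutionSet M := by
      refine ⟨fun j => ⟨by positivity, ?_⟩, u, ?_⟩
      · rw [hr, div_lt_one hne']
        exact_mod_cast hlt j
      · funext i
        simp only [Matrix.mulVec, dotProduct, Matrix.map_apply, hr]
        have h1 : ((∑ j, M i j * (a j : ℤ) : ℤ) : ℚ) = (((p ^ N - 1 : ℕ) : ℤ) * u i : ℤ) := by
          rw [hu i]
        push_cast at h1
        simp_rw [← mul_div_assoc]
        rw [← Finset.sum_div, div_eq_iff hne]
        rw [h1]
        ring
    refine ⟨⟨r, hmem⟩, ?_, ?_⟩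
    · rw [Finset.mem_filter]
      refine ⟨Finset.mem_univ _, funext fun j => ?_⟩
      simp only [fracMul, hr]
      have h2 : ((p ^ N : ℕ) : ℚ) * ((a j : ℚ) / ((p ^ N - 1 : ℕ) : ℚ)) =
          ((p ^ N * a j : ℕ) : ℚ) / ((p ^ N - 1 : ℕ) : ℚ) := by push_cast; ring
      rw [h2, Int.fract_div_natCast_eq_div_natCast_mod, pow_mul_mod hp.out.one_lt,
        Nat.mod_eq_of_lt (hlt j)]
    · funext j
      simp only [expIndex, hr]
      rw [mul_div_cancel₀ _ hne, Nat.floor_natCast]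
  · intro r _
    have h1 : ((-1 : C)) ^ n = ∏ _j : Fin n, (-1 : C) := by simp
    rw [eigenvalue, h1, ← Finset.prod_mul_distrib]
    refine Finset.prod_congr rfl fun j _ => ?_
    rw [teichGauss_eq_gaussValue h hζ ι hE, coe_teichHom, hc]
    ring

end Eigen

end DiagonalLaurent

end

noncomputable section

/-! ### Euler products over the cycles of a permutation, and their Gauss norms -/

namespace OrbitProduct

open Function

section Orbits

theorem pow_apply_eq_self_iff {S : Type*} (σ : Equiv.Perm S) (k : ℕ) (x : S) : (σ ^ k) x = x ↔ minimalPeriod σ x ∣ k := by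
  rw [← Equiv.Perm.iterate_eq_pow, ← isPeriodicPt_iff_minimalPeriod_dvd]
  rfl

variable {S : Type*} [Fintype S] (σ : Equiv.Perm S)

open Classical in
theorem card_filter_sameCycle (x : S) :
    (Finset.univ.filter (fun y => σ.SameCycle x y)).card = minimalPeriod σ x := by
  have hpos : 0 < minimalPeriod σ x := minimalPeriod_pos_of_mem_periodicPts
    (Function.Injective.mem_periodicPts σ.injective x)
  have : Finset.univ.filter (fun y => σ.SameCycle x y) =
      (Finset.range (minimalPeriod σ x)).image (fun i => σ^[i] x) := by
    ext y
    simp only [Finset.mem_filter, Finset.mem_univ, true_and, Finset.mem_image, Finset.mem_range]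
    constructor
    · intro hxy
      obtain ⟨i, -, hi⟩ := hxy.exists_pow_eq'
      refine ⟨i % minimalPeriod σ x, Nat.mod_lt _ hpos, ?_⟩
      rw [iterate_mod_minimalPeriod_eq, Equiv.Perm.iterate_eq_pow, hi]
    · rintro ⟨i, -, rfl⟩
      rw [Equiv.Perm.iterate_eq_pow]
      exact ⟨i, by rw [zpow_natCast]⟩
  rw [this, Finset.card_image_of_injOn, Finset.card_range]
  intro i hi j hj hij
  rw [Finset.coe_range] at hi hj
  exact iterate_injOn_Iio_minimalPeriod hi hj hij

theorem eq_of_sameCycle {A : Type*} {f : S → A} (hf : ∀ x, f (σ x) = f x) {x y : S}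
    (hxy : σ.SameCycle x y) : f x = f y := by
  obtain ⟨i, -, rfl⟩ := hxy.exists_pow_eq'
  induction i with
  | zero => simp
  | succ i ih => rw [pow_succ', Equiv.Perm.mul_apply, hf, ← ih ⟨i, by rw [zpow_natCast]⟩]

/-- The set of cycles of a permutation, including fixed points. -/
abbrev Cycle : Type _ := Quotient (Equiv.Perm.SameCycle.setoid σ)

instance : Fintype (Cycle σ) := Fintype.ofFinite _

theorem prod_eq_prod_cycles {A : Type*} [CommMonoid A] {f : S → A} (hf : ∀ x, f (σ x) = f x) :
    ∏ x, f x = ∏ o : Cycle σ, f o.out ^ minimalPeriod σ o.out := by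
  classical
  rw [← Finset.prod_fiberwise Finset.univ
    (fun x => (Quotient.mk (Equiv.Perm.SameCycle.setoid σ) x : Cycle σ)) f]
  refine Finset.prod_congr rfl fun o _ => ?_
  have hiff : ∀ x, (Quotient.mk (Equiv.Perm.SameCycle.setoid σ) x : Cycle σ) = o ↔
      σ.SameCycle o.out x := by
    intro x
    conv_lhs => rw [← o.out_eq]
    rw [Quotient.eq]
    exact Equiv.Perm.sameCycle_comm
  rw [← card_filter_sameCycle σ o.out]
  simp only [hiff]
  rw [Finset.prod_congr rfl (g := fun _ => f o.out), Finset.prod_const]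
  intro x hx
  exact (eq_of_sameCycle σ hf (Finset.mem_filter.1 hx).2).symm

theorem sum_eq_sum_cycles {A : Type*} [AddCommMonoid A] {f : S → A} (hf : ∀ x, f (σ x) = f x) :
    ∑ x, f x = ∑ o : Cycle σ, minimalPeriod σ o.out • f o.out :=
  prod_eq_prod_cycles (A := Multiplicative A) σ hf

theorem minimalPeriod_pos (x : S) : 0 < minimalPeriod σ x :=
  minimalPeriod_pos_of_mem_periodicPts (Function.Injective.mem_periodicPts σ.injective x)

end Orbits

section Product

variable {K : Type*} [Field K]

open PowerSeries in
-- The series is the geometric expansion of the negated logarithmic derivative of 1 - βX^d.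
theorem one_sub_mul_mk (β : K) {d : ℕ} (hd : 0 < d) :
    ((1 - PowerSeries.C β * X ^ d : PowerSeries K)) *
      mk (fun k => if d ∣ k + 1 then (d : K) * β ^ ((k + 1) / d) else 0) =
      PowerSeries.C (d * β) * X ^ (d - 1) := by
  ext k
  rw [sub_mul, one_mul, map_sub, coeff_mk, mul_assoc, coeff_C_mul, coeff_C_mul, coeff_X_pow_mul',
    coeff_X_pow]
  by_cases hk : d ≤ k
  · rw [if_pos hk, coeff_mk, if_neg (by omega : ¬ k = d - 1)]
    have h1 : k + 1 = (k - d + 1) + d := by omega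
    by_cases hdvd : d ∣ k - d + 1
    · rw [if_pos hdvd, if_pos (by rw [h1]; exact dvd_add hdvd dvd_rfl), h1,
        Nat.add_div_right _ hd, pow_succ]
      ring
    · rw [if_neg hdvd, if_neg (by rw [h1]; exact fun h => hdvd ((Nat.dvd_add_left dvd_rfl).1 h))]
      ring
  · rw [if_neg hk, mul_zero, sub_zero]
    by_cases hk' : k = d - 1
    · have h1 : k + 1 = d := by omega
      rw [if_pos hk', h1, if_pos dvd_rfl, Nat.div_self hd, pow_one, mul_one]
    · rw [if_neg hk', if_neg, mul_zero]
      intro h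
      have := Nat.le_of_dvd (by omega) h
      omega

open PowerSeries in
theorem derivative_prod_eq {ι : Type*} (s : Finset ι) (f g : ι → PowerSeries K)
    (hfg : ∀ i ∈ s, d⁄dX K (f i) = f i * g i) :
    d⁄dX K (∏ i ∈ s, f i) = (∏ i ∈ s, f i) * ∑ i ∈ s, g i := by
  classical
  induction s using Finset.induction_on with
  | empty => simp
  | insert i s hi ih =>
    rw [Finset.prod_insert hi, Finset.sum_insert hi, Derivation.leibniz,
      ih fun j hj => hfg j (Finset.mem_insert_of_mem hj), hfg i (Finset.mem_insert_self i s),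
      smul_eq_mul, smul_eq_mul]
    ring

variable {S : Type*} [Fintype S] (σ : Equiv.Perm S) (b : ℕ → S → K)

/-- The product of `1 - b X ^ d` over the cycles of `σ`, where `d` is the length of the cycle. -/
def cycleProd : Polynomial K :=
  ∏ o : Cycle σ, (1 - Polynomial.C (b (minimalPeriod σ o.out) o.out) *
    Polynomial.X ^ minimalPeriod σ o.out)

theorem coeff_zero_cycleProd : (cycleProd σ b).coeff 0 = 1 := by
  rw [cycleProd, Polynomial.coeff_zero_prod]
  refine Finset.prod_eq_one fun o _ => ?_
  have := (minimalPeriod_pos σ o.out).ne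
  simp [Polynomial.coeff_X_pow, this]

open PowerSeries in
-- The fixed points of σ^(k+1) fill the cycles of length d dividing k + 1. Each such cycle
-- contributes d equal terms b(d)^((k+1)/d), as in the logarithmic derivative of its factor.
theorem derivative_cycleProd [DecidableEq S]
    (hlift : ∀ d m x, d ≠ 0 → m ≠ 0 → (σ ^ d) x = x → b (d * m) x = b d x ^ m)
    (hinv : ∀ k x, k ≠ 0 → (σ ^ k) x = x → b k (σ x) = b k x) :
    d⁄dX K (cycleProd σ b : PowerSeries K) = (cycleProd σ b : PowerSeries K) *
      -mk (fun k => ∑ x ∈ Finset.univ.filter (fun x => (σ ^ (k + 1)) x = x), b (k + 1) x) := by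
  have hcoe : (cycleProd σ b : PowerSeries K) = ∏ o : Cycle σ,
      (1 - PowerSeries.C (b (minimalPeriod σ o.out) o.out) * X ^ minimalPeriod σ o.out) := by
    rw [cycleProd, ← Polynomial.coeToPowerSeries.ringHom_apply, map_prod]
    refine Finset.prod_congr rfl fun o _ => ?_
    simp
  rw [hcoe, derivative_prod_eq Finset.univ _ (fun o => -mk (fun k =>
    if minimalPeriod σ o.out ∣ k + 1 then (minimalPeriod σ o.out : K) *
      b (minimalPeriod σ o.out) o.out ^ ((k + 1) / minimalPeriod σ o.out) else 0))]
  · congr 1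
    rw [Finset.sum_neg_distrib]
    congr 1
    ext k
    rw [map_sum, coeff_mk, Finset.sum_filter, sum_eq_sum_cycles σ]
    · refine Finset.sum_congr rfl fun o _ => ?_
      rw [coeff_mk]
      simp only [pow_apply_eq_self_iff]
      split_ifs with hd
      · obtain ⟨m, hm⟩ := hd
        have hpos := minimalPeriod_pos σ o.out
        rw [nsmul_eq_mul, hm, hlift _ m _ hpos.ne' (by rintro rfl; simp at hm)
          ((pow_apply_eq_self_iff σ _ _).2 dvd_rfl), Nat.mul_div_cancel_left _ hpos]
      · rw [smul_zero]
    · intro x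
      have hiff : (σ ^ (k + 1)) (σ x) = σ x ↔ (σ ^ (k + 1)) x = x := by
        rw [← Equiv.Perm.mul_apply, ← pow_succ, pow_succ', Equiv.Perm.mul_apply,
          σ.injective.eq_iff]
      simp only [hiff]
      split_ifs with hx
      · exact hinv _ x (Nat.succ_ne_zero k) hx
      · rfl
  · intro o _
    have hpos := minimalPeriod_pos σ o.out
    rw [mul_neg, one_sub_mul_mk _ hpos, map_sub, derivative_one, zero_sub, Derivation.leibniz,
      derivative_C, smul_zero, add_zero, smul_eq_mul, derivative_pow, derivative_X, mul_one,
      map_mul, map_natCast]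
    ring

end Product

section GaussNorm

variable {K : Type*} [NormedField K]

/-- The norm of a normed field as an absolute value. -/
abbrev normAbs (K : Type*) [NormedField K] : AbsoluteValue K ℝ := NormedField.toAbsoluteValue K

theorem gaussNorm_one_sub (β : K) {d : ℕ} (hd : 0 < d) {ρ : ℝ} (hρ : 0 < ρ) :
    (1 - Polynomial.C β * Polynomial.X ^ d : Polynomial K).gaussNorm (normAbs K) ρ =
      max 1 (‖β‖ * ρ ^ d) := by
  set P := (1 - Polynomial.C β * Polynomial.X ^ d : Polynomial K) with hP
  have hcoeff : ∀ i, P.coeff i = if i = 0 then 1 else if i = d then -β else 0 := by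
    intro i
    rw [hP, Polynomial.coeff_sub, Polynomial.coeff_one, Polynomial.coeff_C_mul,
      Polynomial.coeff_X_pow]
    split_ifs <;> first | omega | simp
  refine le_antisymm ?_ (max_le ?_ ?_)
  · obtain ⟨i, hi⟩ := Polynomial.exists_eq_gaussNorm (normAbs K) ρ P
    rw [hi, hcoeff]
    change ‖_‖ * _ ≤ _
    split_ifs with h1 h2
    · simp [h1]
    · simp [h2]
    · simp
  · have := Polynomial.le_gaussNorm (normAbs K) P hρ.le 0
    rw [hcoeff, if_pos rfl] at this
    simpa using this
  · have := Polynomial.le_gaussNorm (normAbs K) P hρ.le d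
    rw [hcoeff, if_neg hd.ne', if_pos rfl] at this
    change ‖-β‖ * _ ≤ _ at this
    rwa [norm_neg] at this

variable [IsUltrametricDist K]

theorem gaussNorm_prod {ι : Type*} (s : Finset ι) (f : ι → Polynomial K) {ρ : ℝ} (hρ : 0 < ρ) :
    (∏ i ∈ s, f i).gaussNorm (normAbs K) ρ = ∏ i ∈ s, (f i).gaussNorm (normAbs K) ρ := by
  classical
  induction s using Finset.induction_on with
  | empty =>
    rw [Finset.prod_empty, Finset.prod_empty, ← Polynomial.C_1, Polynomial.gaussNorm_C]
    simp
  | insert i s hi ih =>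
    rw [Finset.prod_insert hi, Finset.prod_insert hi, Polynomial.gaussNorm_mul _ hρ, ih]
    exact IsUltrametricDist.isNonarchimedean_norm

theorem max_one_pow {x : ℝ} (hx : 0 ≤ x) (m : ℕ) : max 1 x ^ m = max 1 (x ^ m) := by
  rcases le_total 1 x with h | h
  · rw [max_eq_right h, max_eq_right (one_le_pow₀ h)]
  · rw [max_eq_left h, max_eq_left (pow_le_one₀ hx h), one_pow]

variable {S : Type*} [Fintype S] (σ : Equiv.Perm S) (b : ℕ → S → K)

/-- Gauss norms are multiplicative. For a cycle of length d and D = dm, the D-th power of max(1,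
|b(d)|ρ^d) is the d-th power of max(1, |b(D)|ρ^D), one factor for each point of the cycle. -/
theorem gaussNorm_cycleProd_pow
    (hlift : ∀ d m x, d ≠ 0 → m ≠ 0 → (σ ^ d) x = x → b (d * m) x = b d x ^ m)
    (hinv : ∀ k x, k ≠ 0 → (σ ^ k) x = x → b k (σ x) = b k x) {D : ℕ} (hD : D ≠ 0)
    (hσ : σ ^ D = 1) {ρ : ℝ} (hρ : 0 < ρ) :
    (cycleProd σ b).gaussNorm (normAbs K) ρ ^ D = ∏ x, max 1 (‖b D x‖ * ρ ^ D) := by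
  have hfix : ∀ x, (σ ^ D) x = x := fun x => by rw [hσ]; rfl
  rw [cycleProd, gaussNorm_prod _ _ hρ, ← Finset.prod_pow,
    prod_eq_prod_cycles σ fun x => by rw [hinv D x hD (hfix x)]]
  refine Finset.prod_congr rfl fun o _ => ?_
  have hpos := minimalPeriod_pos σ o.out
  obtain ⟨m, hm⟩ := (pow_apply_eq_self_iff σ D o.out).1 (hfix _)
  have hm0 : m ≠ 0 := by rintro rfl; exact hD (by simpa using hm)
  have hb : b D o.out = b (minimalPeriod σ o.out) o.out ^ m := by
    conv_lhs => rw [hm]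
    exact hlift _ m _ hpos.ne' hm0 ((pow_apply_eq_self_iff σ _ _).2 dvd_rfl)
  rw [gaussNorm_one_sub _ hpos hρ, max_one_pow (by positivity), max_one_pow (by positivity), hb,
    norm_pow, mul_pow, mul_pow, ← pow_mul, ← pow_mul, ← pow_mul, mul_comm m, ← hm,
    mul_comm D]

end GaussNorm

end OrbitProduct

end

open scoped Pointwise

noncomputable section

/-! ### The L-function of a diagonal Laurent polynomial -/

namespace DiagonalLaurent

open Teichmuller Stickelberger OrbitProduct

section Log

open PowerSeries

variable (p : ℕ) [Fact p.Prime] {F : Type*} [Field F] [Finite F] [CharP F p] {n : ℕ}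

theorem derivative_logLSeries (ζ : ℂ_[p]) (f : LaurentPoly F n) :
    d⁄dX ℂ_[p] (logLSeries p ζ f) = mk fun k => expSum p ζ f (k + 1) := by
  ext k
  rw [coeff_derivative, logLSeries, coeff_mk, coeff_mk]
  have : ((k + 1 : ℕ) : ℂ_[p]) ≠ 0 := Nat.cast_ne_zero.2 (Nat.succ_ne_zero k)
  rw [← Nat.cast_succ]
  exact div_mul_cancel₀ _ this

theorem derivative_LSeries (ζ : ℂ_[p]) (f : LaurentPoly F n) :
    d⁄dX ℂ_[p] (LSeries p ζ f) = LSeries p ζ f * mk fun k => expSum p ζ f (k + 1) := by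
  rw [LSeries, derivative_subst (hasSubst_logLSeries p ζ f), derivative_exp,
    derivative_logLSeries]

theorem constantCoeff_LSeries (ζ : ℂ_[p]) (f : LaurentPoly F n) :
    constantCoeff (LSeries p ζ f) = 1 := by
  have hs := hasSubst_logLSeries p ζ f
  have h0 : constantCoeff (logLSeries p ζ f) = 0 := by
    rw [← coeff_zero_eq_constantCoeff_apply, logLSeries, coeff_mk]
  have h := constantCoeff_subst_eq_zero (R := ℂ_[p]) (a := logLSeries p ζ f) h0
    (exp ℂ_[p] - 1) (by simp)
  rw [← coe_substAlgHom hs, map_sub, map_one, coe_substAlgHom hs] at h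
  have h1 : constantCoeff (subst (logLSeries p ζ f) (exp ℂ_[p]) - 1) = 0 := h
  rw [map_sub, map_one, sub_eq_zero] at h1
  exact h1

/-- The exponent (-1)^(n-1) equals -(-1)^n, so both parities share one formula, and (-1)^n cancels
the sign in the Gauss sum expansion. -/
theorem derivative_signedLSeries (ζ : ℂ_[p]) (f : LaurentPoly F n) :
    d⁄dX ℂ_[p] (signedLSeries p ζ f) = signedLSeries p ζ f *
      -mk fun k => (-1) ^ n * expSum p ζ f (k + 1) := by
  have hmk : (mk fun k => (-1) ^ n * expSum p ζ f (k + 1) : PowerSeries ℂ_[p]) =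
      (-1) ^ n * mk fun k => expSum p ζ f (k + 1) := by
    ext k
    have : ((-1 : PowerSeries ℂ_[p]) ^ n) = C ((-1) ^ n) := by simp
    rw [this, coeff_C_mul, coeff_mk, coeff_mk]
  have hne : constantCoeff (LSeries p ζ f) ≠ 0 := by
    rw [constantCoeff_LSeries]; exact one_ne_zero
  rw [signedLSeries, hmk]
  split_ifs with hn
  · rw [derivative_LSeries, hn.neg_one_pow]; ring
  · rw [Nat.not_odd_iff_even] at hn
    rw [derivative_inv', derivative_LSeries, hn.neg_one_pow]
    have := PowerSeries.mul_inv_cancel _ hne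
    linear_combination (-(LSeries p ζ f)⁻¹ * mk fun k => expSum p ζ f (k + 1)) * this

theorem constantCoeff_signedLSeries (ζ : ℂ_[p]) (f : LaurentPoly F n) :
    constantCoeff (signedLSeries p ζ f) = 1 := by
  rw [signedLSeries]
  split_ifs
  · exact constantCoeff_LSeries p ζ f
  · rw [constantCoeff_inv, constantCoeff_LSeries, inv_one]

/-- The quotient A/B has derivative zero and constant term 1. -/
theorem eq_of_derivative_eq_mul {K : Type*} [Field K] [CharZero K] {A B g : PowerSeries K}
    (hA : d⁄dX K A = A * g) (hB : d⁄dX K B = B * g) (hA1 : constantCoeff A = 1)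
    (hB1 : constantCoeff B = 1) : A = B := by
  have hne : constantCoeff B ≠ 0 := by rw [hB1]; exact one_ne_zero
  have hinv := PowerSeries.mul_inv_cancel B hne
  have h : A * B⁻¹ = 1 := by
    refine derivative.ext ?_ ?_
    · rw [Derivation.leibniz, derivative_inv', hA, hB, derivative_one, smul_eq_mul, smul_eq_mul]
      linear_combination (-A * B⁻¹ * g) * hinv
    · rw [map_mul, constantCoeff_inv, hA1, hB1]; simp
  calc A = A * (B * B⁻¹) := by rw [hinv, mul_one]
    _ = (A * B⁻¹) * B := by ring
    _ = B := by rw [h, one_mul]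

end Log

section Diagonal

theorem norm_natCast_prime (p : ℕ) [Fact p.Prime] : ‖(p : ℂ_[p])‖ = (p : ℝ)⁻¹ := by
  rw [← PadicComplex.coe_natCast, PadicComplex.norm_extends,
    ← map_natCast (algebraMap ℚ_[p] (PadicAlgCl p)), PadicAlgCl.norm_extends, Padic.norm_p]

theorem norm_natCast_prime_lt_one (p : ℕ) [hp : Fact p.Prime] : ‖(p : ℂ_[p])‖ < 1 := by
  rw [norm_natCast_prime]
  exact inv_lt_one_of_one_lt₀ (by exact_mod_cast hp.out.one_lt)

theorem evalTorus_diagonal {F : Type*} [Field F] {n : ℕ} (M : Matrix (Fin n) (Fin n) ℤ)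
    (a : Fin n → Fˣ) {K : Type*} [Field K] [Algebra F K] (x : Fin n → Kˣ) :
    evalTorus (diagonal M a) x =
      ∑ j, algebraMap F K (a j) * ((∏ i, x i ^ M i j : Kˣ) : K) := by
  have h : ∀ f : LaurentPoly F n, evalTorus f x = f.coeff.sum fun v c =>
    algebraMap F K c * ((∏ i, x i ^ v i : Kˣ) : K) := fun f => rfl
  rw [h, diagonal, AddMonoidAlgebra.coeff_sum, ← Finsupp.sum_finsetSum_index]
  · refine Finset.sum_congr rfl fun j _ => ?_
    rw [AddMonoidAlgebra.coeff_single, Finsupp.sum_single_index (by simp)]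
  · simp
  · intro v c d
    rw [map_add, add_mul]

variable (p : ℕ) [hp : Fact p.Prime] {F : Type*} [Field F] [Finite F] [CharP F p] {n : ℕ}

/-- The signed L-function of a diagonal Laurent polynomial is a polynomial, and a power of its
Gauss norms is a product over the solution set. -/
theorem exists_polynomial_signedLSeries {ζ : ℂ_[p]} (hζ : IsPrimitiveRoot ζ p)
    {M : Matrix (Fin n) (Fin n) ℤ} (hM : M.det ≠ 0) (hcop : p.Coprime M.det.natAbs)
    (a : Fin n → Fˣ) [Fintype (solutionSet M)] {e : ℕ} (he : Nat.card F = p ^ e) :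
    ∃ P : Polynomial ℂ_[p], signedLSeries p ζ (diagonal M a) = (P : PowerSeries ℂ_[p]) ∧
      P.coeff 0 = 1 ∧ ∀ ρ : ℝ, 0 < ρ →
        P.gaussNorm (normAbs ℂ_[p]) ρ ^ M.det.natAbs.totient =
          ∏ r : solutionSet M, max 1 ((p : ℝ) ^ (-∑ i ∈ Finset.range (e * M.det.natAbs.totient),
            (rnorm (fracMul (p ^ i) (r : Fin n → ℚ)) : ℝ)) * ρ ^ M.det.natAbs.totient) := by
  classical
  have h := norm_natCast_prime_lt_one p
  let := ZMod.algebra F p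
  let := Fintype.ofFinite F
  obtain ⟨i0⟩ := nonempty_ringHom_residue h F
  have he0 : e ≠ 0 := by
    rintro rfl
    have := Finite.one_lt_card (α := F)
    rw [he, pow_zero] at this
    exact lt_irrefl _ this
  have hcardF : Fintype.card F = p ^ e := by rw [← he, Nat.card_eq_fintype_card]
  have hD : M.det.natAbs.totient ≠ 0 :=
    (Nat.totient_pos.2 (Int.natAbs_pos.2 hM)).ne'
  set t : Fin n → ℂ_[p] := fun j => teichChar h i0 (a j) with ht
  have ht1 : ∀ j, t j ^ (p ^ e - 1) = 1 := fun j => by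
    rw [ht, ← hcardF]
    simp only
    rw [← map_pow, FiniteField.pow_card_sub_one_eq_one _ (a j).ne_zero, map_one]
  have htpow : ∀ j, t j ^ p ^ e = t j := fun j => by
    rw [ht, ← hcardF]
    simp only
    rw [← map_pow, FiniteField.pow_card]
  have hpe : 1 < p ^ e := Nat.one_lt_pow he0 hp.out.one_lt
  have htnorm : ∀ j, ‖t j‖ = 1 := fun j =>
    (isOfFinOrder_iff_pow_eq_one.2 ⟨_, by omega, ht1 j⟩).norm_eq_one
  have ht0 : ∀ j, t j ≠ 0 := fun j h0 => by
    have := htnorm j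
    rw [h0, norm_zero] at this
    exact zero_ne_one this
  have hqcop : (p ^ e).Coprime M.det.natAbs := Nat.Coprime.pow_left _ hcop
  set σ := fracMulPerm M (p ^ e) hqcop with hσ
  set b : ℕ → solutionSet M → ℂ_[p] := fun k r => eigenvalue h hζ t (e * k) r with hb
  have hfix : ∀ k (r : solutionSet M), (σ ^ k) r = r ↔
      fracMul (p ^ (e * k)) (r : Fin n → ℚ) = r := fun k r => by
    rw [← Subtype.coe_inj, coe_fracMulPerm_pow, ← pow_mul]
  have hlift : ∀ d m x, d ≠ 0 → m ≠ 0 → (σ ^ d) x = x → b (d * m) x = b d x ^ m := by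
    intro d m x hd hm hx
    simp only [hb]
    rw [← mul_assoc]
    exact eigenvalue_lift h hζ (Nat.mul_ne_zero he0 hd) hm
      (fun j => pow_pow_mul_eq (htpow j) d) x.2 ((hfix d x).1 hx)
  have hinv : ∀ k x, k ≠ 0 → (σ ^ k) x = x → b k (σ x) = b k x := by
    intro k x hk hx
    exact eigenvalue_fracMul h hζ (Nat.mul_ne_zero he0 hk) htpow (dvd_mul_right e k) ht0 x.2
      ((hfix k x).1 hx)
  have hexp : ∀ k, expSum p ζ (diagonal M a) (k + 1) = (-1) ^ n *
      ∑ x ∈ Finset.univ.filter (fun x => (σ ^ (k + 1)) x = x), b (k + 1) x := by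
    intro k
    let E := FiniteField.Extension F p (k + 1)
    let := Fintype.ofFinite E
    have hE : Fintype.card E = p ^ (e * (k + 1)) := by
      rw [Fintype.card_eq_nat_card, FiniteField.natCard_extension, he, pow_mul]
    -- The extension is embedded over the fixed embedding of F, so the coefficients have the same
    -- Teichmüller lifts t for every k.
    let := i0.toAlgebra
    let ι : E →ₐ[F] Residue ℂ_[p] := IsAlgClosed.lift
    have key := sum_traceChar_eq_sum_eigenvalue (M := M) h hζ (t := t) ι.toRingHom hE
      (fun j => Units.map (algebraMap F E).toMonoidHom (a j)) (fun j => by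
        exact congrArg (teich p) (ι.commutes (a j : F)))
    have hset : (Finset.univ.filter fun r : solutionSet M =>
        fracMul (p ^ (e * (k + 1))) (r : Fin n → ℚ) = (r : Fin n → ℚ)) =
        Finset.univ.filter fun x => (σ ^ (k + 1)) x = x :=
      Finset.filter_congr fun r _ => (hfix (k + 1) r).symm
    rw [hset] at key
    rw [← key, expSum, finsum_eq_sum_of_fintype]
    refine Finset.sum_congr rfl fun x _ => ?_
    rw [evalTorus_diagonal]
    rfl
  refine ⟨cycleProd σ b, ?_, coeff_zero_cycleProd σ b, fun ρ hρ => ?_⟩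
  · have h1 := derivative_signedLSeries p ζ (diagonal M a)
    have h2 := derivative_cycleProd σ b hlift hinv
    refine eq_of_derivative_eq_mul (h1.trans ?_) h2 (constantCoeff_signedLSeries p ζ _) ?_
    · congr 3
      ext k
      rw [hexp, ← mul_assoc, ← mul_pow]
      simp
    · rw [Polynomial.constantCoeff_coe, coeff_zero_cycleProd]
  -- By Euler's theorem the exponent φ(|det M|) makes every point fixed, so the norm of each
  -- contribution is available at that level.
  · have hσD : σ ^ M.det.natAbs.totient = 1 := fracMulPerm_pow_totient hqcop
    rw [gaussNorm_cycleProd_pow σ b hlift hinv hD hσD hρ]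
    refine Finset.prod_congr rfl fun r _ => ?_
    rw [hb]
    simp only
    rw [norm_eigenvalue h hζ (norm_natCast_prime p) (Nat.mul_ne_zero he0 hD) htnorm r.2
      ((hfix _ r).1 (by rw [hσD]; rfl))]

end Diagonal

end DiagonalLaurent

end

open scoped Pointwise

noncomputable section

/-! ### Polygons through their support functions; the equality case of Jensen's inequality -/

namespace DiagonalLaurent

section LowerConvexClosure

theorem lowerConvexClosure_eq_add (S : Set (ℝ × ℝ)) :
    lowerConvexClosure S = convexHull ℝ S + ({0} : Set ℝ) ×ˢ Set.Ici (0 : ℝ) := by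
  have h1 : {P : ℝ × ℝ | ∃ Q ∈ S, P.1 = Q.1 ∧ Q.2 ≤ P.2} = S + ({0} : Set ℝ) ×ˢ Set.Ici (0 : ℝ) := by
    ext P
    rw [Set.mem_add]
    constructor
    · rintro ⟨Q, hQ, h1, h2⟩
      refine ⟨Q, hQ, (0, P.2 - Q.2), ⟨rfl, sub_nonneg.2 h2⟩, ?_⟩
      ext <;> simp [h1]
    · rintro ⟨Q, hQ, ⟨x, y⟩, ⟨hx, hy⟩, rfl⟩
      rw [Set.mem_singleton_iff] at hx
      simp only at hx
      subst hx
      exact ⟨Q, hQ, by simp, by simpa using hy⟩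
  have h2 : Convex ℝ (({0} : Set ℝ) ×ˢ Set.Ici (0 : ℝ)) :=
    (convex_singleton 0).prod (convex_Ici 0)
  rw [lowerConvexClosure, h1, convexHull_add, h2.convexHull_eq]

/-- The region is a compact hull plus a closed vertical ray, hence closed and convex, and
Hahn–Banach applies. Non-vertical lines suffice: as S is finite, a vertical separating line can be
tilted slightly. -/
theorem mem_lowerConvexClosure_iff {S : Set (ℝ × ℝ)} (hS : S.Finite) (hne : S.Nonempty)
    (P : ℝ × ℝ) : P ∈ lowerConvexClosure S ↔
      ∀ l c : ℝ, (∀ Q ∈ S, c ≤ Q.2 - l * Q.1) → c ≤ P.2 - l * P.1 := by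
  constructor
  · intro hP l c hc
    have hconv : Convex ℝ {P : ℝ × ℝ | c ≤ P.2 - l * P.1} := by
      intro x hx y hy a b ha hb hab
      simp only [Set.mem_ofPred_eq, Prod.snd_add, Prod.smul_snd, Prod.fst_add, Prod.smul_fst,
        smul_eq_mul] at *
      have hb' : b = 1 - a := by linarith
      subst hb'
      nlinarith [mul_le_mul_of_nonneg_left hx ha, mul_le_mul_of_nonneg_left hy hb]
    refine convexHull_min ?_ hconv hP
    rintro Q ⟨R, hR, h1, h2⟩
    have := hc R hR
    simp only [Set.mem_ofPred_eq]
    rw [h1]; linarith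
  · intro h
    by_contra hP
    rw [lowerConvexClosure_eq_add] at hP
    have hconv : Convex ℝ (convexHull ℝ S + ({0} : Set ℝ) ×ˢ Set.Ici (0 : ℝ)) :=
      (convex_convexHull ℝ S).add ((convex_singleton 0).prod (convex_Ici 0))
    have hclosed : IsClosed (convexHull ℝ S + ({0} : Set ℝ) ×ˢ Set.Ici (0 : ℝ)) :=
      (isClosed_singleton.prod isClosed_Ici).add_left_of_isCompact (hS.isCompact_convexHull ℝ)
    obtain ⟨f, u, hfP, hfu⟩ := geometric_hahn_banach_point_closed hconv hclosed hP
    have hf : ∀ x : ℝ × ℝ, f x = f (1, 0) * x.1 + f (0, 1) * x.2 := by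
      intro x
      have : x = x.1 • ((1, 0) : ℝ × ℝ) + x.2 • ((0, 1) : ℝ × ℝ) := by ext <;> simp
      conv_lhs => rw [this, map_add, map_smul, map_smul, smul_eq_mul, smul_eq_mul]
      ring
    set α := f (1, 0) with hα
    set β := f (0, 1) with hβ
    have hray : ∀ Q ∈ S, ∀ y : ℝ, 0 ≤ y → u < α * Q.1 + β * (Q.2 + y) := by
      intro Q hQ y hy
      have := hfu (Q + (0, y)) (Set.add_mem_add (subset_convexHull ℝ S hQ) ⟨rfl, hy⟩)
      rw [hf] at this
      simpa using this
    obtain ⟨Q0, hQ0⟩ := hne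
    -- The region is stable under going up, so a functional bounded below on it cannot have a
    -- negative vertical coefficient.
    have hβ0 : 0 ≤ β := by
      by_contra! hneg
      have h1 := hray Q0 hQ0 (max 0 ((α * Q0.1 + β * Q0.2 - u) / -β)) (le_max_left _ _)
      have h2 := le_max_right 0 ((α * Q0.1 + β * Q0.2 - u) / -β)
      rw [div_le_iff₀ (by linarith)] at h2
      nlinarith
    rw [hf] at hfP
    -- When β = 0 the separation has the gap u - αP.1, and ε is chosen so small that the vertical
    -- term uses at most half of it.
    obtain ⟨ε, hε, hlt⟩ : ∃ ε > 0, ∀ Q ∈ S, α * P.1 + ε * P.2 ≤ α * Q.1 + ε * Q.2 ∧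
        ¬ α * Q.1 + ε * Q.2 ≤ α * P.1 + ε * P.2 := by
      rcases hβ0.lt_or_eq with hpos | hzero
      · refine ⟨β, hpos, fun Q hQ => ?_⟩
        have := hray Q hQ 0 le_rfl
        rw [add_zero] at this
        exact ⟨by linarith, by linarith⟩
      · obtain ⟨B, hB⟩ := (hS.image fun Q => P.2 - Q.2).bddAbove
        rw [← hzero] at hfP hray
        have hd : 0 < u - α * P.1 := by linarith
        refine ⟨(u - α * P.1) / (2 * (|B| + 1)), by positivity, fun Q hQ => ?_⟩
        have h1 : P.2 - Q.2 ≤ B := hB ⟨Q, hQ, rfl⟩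
        have h2 := hray Q hQ 0 le_rfl
        rw [zero_mul, add_zero] at h2
        have h3 : (u - α * P.1) / (2 * (|B| + 1)) * (P.2 - Q.2) ≤ (u - α * P.1) / 2 := by
          have h4 : P.2 - Q.2 ≤ |B| + 1 := by linarith [le_abs_self B]
          calc (u - α * P.1) / (2 * (|B| + 1)) * (P.2 - Q.2)
              ≤ (u - α * P.1) / (2 * (|B| + 1)) * (|B| + 1) :=
                mul_le_mul_of_nonneg_left h4 (by positivity)
            _ = (u - α * P.1) / 2 := by field_simp
        constructor <;> nlinarith
    obtain ⟨Q1, hQ1, hmin⟩ := hS.exists_minimalFor (fun Q => α * Q.1 + ε * Q.2) S ⟨Q0, hQ0⟩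
    have hmin' : ∀ Q ∈ S, α * Q1.1 + ε * Q1.2 ≤ α * Q.1 + ε * Q.2 := fun Q hQ => by
      rcases le_total (α * Q1.1 + ε * Q1.2) (α * Q.1 + ε * Q.2) with h' | h'
      · exact h'
      · exact hmin hQ h'
    have := h (-(α / ε)) ((α * Q1.1 + ε * Q1.2) / ε) (fun Q hQ => by
      rw [div_le_iff₀ hε]
      have := hmin' Q hQ
      have e1 : (Q.2 - -(α / ε) * Q.1) * ε = α * Q.1 + ε * Q.2 := by field_simp; ring
      rw [e1]; exact this)
    rw [div_le_iff₀ hε] at this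
    have e1 : (P.2 - -(α / ε) * P.1) * ε = α * P.1 + ε * P.2 := by field_simp; ring
    rw [e1] at this
    exact (hlt Q1 hQ1).2 this

/-- Here f l and g l are the minima of y - l x over the two sets; such a Legendre transform
determines the region and conversely. -/
theorem lowerConvexClosure_eq_iff {S T : Set (ℝ × ℝ)} (hS : S.Finite) (hSn : S.Nonempty)
    (hT : T.Finite) (hTn : T.Nonempty) {f g : ℝ → ℝ}
    (hf : ∀ l c, (∀ Q ∈ S, c ≤ Q.2 - l * Q.1) ↔ c ≤ f l)
    (hg : ∀ l c, (∀ Q ∈ T, c ≤ Q.2 - l * Q.1) ↔ c ≤ g l) :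
    lowerConvexClosure S = lowerConvexClosure T ↔ ∀ l, f l = g l := by
  have hsub : ∀ U : Set (ℝ × ℝ), U ⊆ lowerConvexClosure U := fun U Q hQ =>
    subset_convexHull ℝ _ ⟨Q, hQ, rfl, le_rfl⟩
  constructor
  · intro h l
    refine le_antisymm ((hg l _).1 fun Q hQ => ?_) ((hf l _).1 fun Q hQ => ?_)
    · exact (mem_lowerConvexClosure_iff hS hSn Q).1 (h ▸ hsub T hQ) l _ ((hf l _).2 le_rfl)
    · exact (mem_lowerConvexClosure_iff hT hTn Q).1 (h ▸ hsub S hQ) l _ ((hg l _).2 le_rfl)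
  · intro h
    ext P
    rw [mem_lowerConvexClosure_iff hS hSn, mem_lowerConvexClosure_iff hT hTn]
    simp only [hf, hg, h]

end LowerConvexClosure

section Newton

open OrbitProduct

variable {p : ℕ} [hp : Fact p.Prime]

theorem finite_newton_points (q : ℕ) (P : Polynomial ℂ_[p]) :
    {R : ℝ × ℝ | ∃ k : ℕ, PowerSeries.coeff k (P : PowerSeries ℂ_[p]) ≠ 0 ∧
      R = ((k : ℝ), ordQ q (PowerSeries.coeff k (P : PowerSeries ℂ_[p])))}.Finite := by
  refine (P.support.finite_toSet.image fun k : ℕ => ((k : ℝ), ordQ q (P.coeff k))).subset ?_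
  rintro R ⟨k, hk, rfl⟩
  rw [Polynomial.coeff_coe] at hk ⊢
  exact ⟨k, by simpa using hk, rfl⟩

/-- Since |a_k| q^(lk) = q^(-(ord_q a_k - lk)), the Gauss norm at radius q^l is q to minus the
support function at slope l. -/
theorem newton_points_support_iff {q : ℕ} (hq : 1 < q) (P : Polynomial ℂ_[p]) (l c : ℝ) :
    (∀ R ∈ {R : ℝ × ℝ | ∃ k : ℕ, PowerSeries.coeff k (P : PowerSeries ℂ_[p]) ≠ 0 ∧
      R = ((k : ℝ), ordQ q (PowerSeries.coeff k (P : PowerSeries ℂ_[p])))}, c ≤ R.2 - l * R.1) ↔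
      P.gaussNorm (normAbs ℂ_[p]) ((q : ℝ) ^ l) ≤ (q : ℝ) ^ (-c) := by
  have hq1 : (1 : ℝ) < q := by exact_mod_cast hq
  have hq0 : (0 : ℝ) < q := by linarith
  have key : ∀ k, P.coeff k ≠ 0 → (c ≤ ordQ q (P.coeff k) - l * k ↔
      ‖P.coeff k‖ * ((q : ℝ) ^ l) ^ k ≤ (q : ℝ) ^ (-c)) := by
    intro k hk
    have hpos : 0 < ‖P.coeff k‖ := norm_pos_iff.2 hk
    have hiff := Real.logb_le_logb hq1 (x := ‖P.coeff k‖ * (q : ℝ) ^ (l * k))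
      (y := (q : ℝ) ^ (-c)) (by positivity) (by positivity)
    rw [← Real.rpow_natCast, ← Real.rpow_mul hq0.le, ordQ, ← hiff,
      Real.logb_mul hpos.ne' (by positivity), Real.logb_rpow hq0 hq1.ne',
      Real.logb_rpow hq0 hq1.ne']
    constructor <;> intro h <;> linarith
  constructor
  · intro h
    obtain ⟨k, hk⟩ := Polynomial.exists_eq_gaussNorm (normAbs ℂ_[p]) ((q : ℝ) ^ l) P
    rw [hk]
    by_cases hz : P.coeff k = 0
    · rw [hz, map_zero, zero_mul]; positivity
    · exact (key k hz).1 (h (_, _) ⟨k, by rwa [Polynomial.coeff_coe], by rw [Polynomial.coeff_coe]; rfl⟩)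
  · rintro h R ⟨k, hk, rfl⟩
    rw [Polynomial.coeff_coe] at hk ⊢
    exact (key k hk).2 ((Polynomial.le_gaussNorm (normAbs ℂ_[p]) P (by positivity) k).trans h)

end Newton

section Jensen

variable {S : Type*} (σ : Equiv.Perm S) (w : S → ℝ)

theorem sum_orbit_apply {N : ℕ} (hσ : σ ^ N = 1) (x : S) :
    ∑ i ∈ Finset.range N, w ((σ ^ i) (σ x)) = ∑ i ∈ Finset.range N, w ((σ ^ i) x) := by
  have h1 := Finset.sum_range_succ (fun i => w ((σ ^ i) x)) N
  have h2 := Finset.sum_range_succ' (fun i => w ((σ ^ i) x)) N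
  have h3 : ∀ i, (σ ^ i) (σ x) = (σ ^ (i + 1)) x := fun i => by
    rw [pow_succ, Equiv.Perm.mul_apply]
  simp only [h3]
  rw [hσ] at h1
  rw [h1, pow_zero] at h2
  linarith

/-- Convexity gives Jensen's inequality at each point, and summing over the σ-invariant set S turns
the hypothesis into equality at each point. Taking l equal to the average s x makes one side zero,
so no value on the orbit lies below its average and all values are equal. -/
theorem sum_max_average_eq_iff [Fintype S] {N : ℕ} (hN : N ≠ 0) (hσ : σ ^ N = 1) {s : S → ℝ}
    (hs : ∀ x, N * s x = ∑ i ∈ Finset.range N, w ((σ ^ i) x)) :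
    (∀ l : ℝ, ∑ x, max 0 (l - s x) = ∑ x, max 0 (l - w x)) ↔ ∀ x, w (σ x) = w x := by
  have hNpos : (0 : ℝ) < N := by exact_mod_cast Nat.pos_of_ne_zero hN
  constructor
  · intro h
    have hterm : ∀ l x, N * max 0 (l - s x) ≤
        ∑ i ∈ Finset.range N, max 0 (l - w ((σ ^ i) x)) := by
      intro l x
      rw [mul_max_of_nonneg _ _ hNpos.le, mul_zero]
      refine max_le (Finset.sum_nonneg fun i _ => le_max_left _ _) ?_
      rw [mul_sub, hs]
      have : (N : ℝ) * l = ∑ i ∈ Finset.range N, l := by simp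
      rw [this, ← Finset.sum_sub_distrib]
      exact Finset.sum_le_sum fun i _ => le_max_right _ _
    have hsum : ∀ l, ∑ x, N * max 0 (l - s x) =
        ∑ x, ∑ i ∈ Finset.range N, max 0 (l - w ((σ ^ i) x)) := by
      intro l
      rw [Finset.sum_comm, ← Finset.mul_sum, h l]
      have : ∀ i ∈ Finset.range N, ∑ x, max 0 (l - w ((σ ^ i) x)) = ∑ x, max 0 (l - w x) :=
        fun i _ => Equiv.sum_comp (σ ^ i) fun x => max 0 (l - w x)
      rw [Finset.sum_congr rfl this]
      simp
    have heq : ∀ l x, N * max 0 (l - s x) =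
        ∑ i ∈ Finset.range N, max 0 (l - w ((σ ^ i) x)) := fun l x =>
      (Finset.sum_eq_sum_iff_of_le fun x _ => hterm l x).1 (hsum l) x (Finset.mem_univ x)
    have hle : ∀ x, ∀ i ∈ Finset.range N, s x ≤ w ((σ ^ i) x) := by
      intro x i hi
      have h1 := heq (s x) x
      rw [sub_self, max_self, mul_zero] at h1
      have h2 := (Finset.sum_eq_zero_iff_of_nonneg fun i _ => le_max_left _ _).1 h1.symm i hi
      have h3 := le_max_right 0 (s x - w ((σ ^ i) x))
      rw [h2] at h3
      linarith
    have hsw : ∀ x, s x = w x := by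
      intro x
      have h1 : ∑ i ∈ Finset.range N, s x = ∑ i ∈ Finset.range N, w ((σ ^ i) x) := by
        rw [← hs]; simp
      have h2 := (Finset.sum_eq_sum_iff_of_le (hle x)).1 h1 0
        (Finset.mem_range.2 (Nat.pos_of_ne_zero hN))
      simpa using h2
    intro x
    rw [← hsw, ← hsw]
    refine mul_left_cancel₀ hNpos.ne' ?_
    rw [hs, hs, sum_orbit_apply σ w hσ]
  · intro h l
    have hw : ∀ i x, w ((σ ^ i) x) = w x := by
      intro i x
      induction i with
      | zero => simp
      | succ i ih => rw [pow_succ', Equiv.Perm.mul_apply, h, ih]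
    have hsw : ∀ x, s x = w x := by
      intro x
      refine mul_left_cancel₀ hNpos.ne' ?_
      rw [hs, Finset.sum_congr rfl fun i _ => hw i x]
      simp
    simp only [hsw]

end Jensen

end DiagonalLaurent

end

open scoped Pointwise

noncomputable section

/-! ### The simplex Δ, its weight function and its denominator -/

namespace DiagonalLaurent

section Polyhedron

variable {n : ℕ} {M : Matrix (Fin n) (Fin n) ℤ}

/-- The `j`-th column of an integer matrix, as a real vector. -/
def realCol (M : Matrix (Fin n) (Fin n) ℤ) (j : Fin n) : Fin n → ℝ := fun i => (M i j : ℝ)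

theorem isUnit_map_intCast {K : Type*} [Field K] [CharZero K] (hM : M.det ≠ 0) :
    IsUnit (M.map (Int.cast : ℤ → K)) := by
  rw [Matrix.isUnit_iff_isUnit_det, ← Int.cast_det, isUnit_iff_ne_zero]
  exact_mod_cast hM

theorem mulVec_coords (hM : M.det ≠ 0) (x : Fin n → ℝ) :
    (M.map (Int.cast : ℤ → ℝ)).mulVec (coords M x) = x := by
  rw [coords, Matrix.mulVec_mulVec,
    Matrix.mul_nonsing_inv _ ((Matrix.isUnit_iff_isUnit_det _).1 (isUnit_map_intCast hM)),
    Matrix.one_mulVec]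

theorem coords_mulVec (hM : M.det ≠ 0) (c : Fin n → ℝ) :
    coords M ((M.map (Int.cast : ℤ → ℝ)).mulVec c) = c := by
  rw [coords, Matrix.mulVec_mulVec,
    Matrix.nonsing_inv_mul _ ((Matrix.isUnit_iff_isUnit_det _).1 (isUnit_map_intCast hM)),
    Matrix.one_mulVec]

theorem sum_smul_realCol (c : Fin n → ℝ) :
    ∑ j, c j • realCol M j = (M.map (Int.cast : ℤ → ℝ)).mulVec c := by
  ext i
  simp [realCol, Matrix.mulVec, dotProduct, mul_comm]

theorem coords_realCol (hM : M.det ≠ 0) (j : Fin n) :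
    coords M (realCol M j) = Pi.single j 1 := by
  have h : realCol M j = (M.map (Int.cast : ℤ → ℝ)).mulVec (Pi.single j 1) := by
    ext i
    simp [realCol]
  rw [h, coords_mulVec hM]

theorem coords_smul (r : ℝ) (x : Fin n → ℝ) : coords M (r • x) = r • coords M x :=
  Matrix.mulVec_smul _ _ _

theorem coords_add (x y : Fin n → ℝ) : coords M (x + y) = coords M x + coords M y :=
  Matrix.mulVec_add _ _ _

theorem coords_zero : coords M 0 = 0 := Matrix.mulVec_zero _

theorem linearIndependent_realCol (hM : M.det ≠ 0) : LinearIndependent ℝ (realCol M) :=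
  Matrix.linearIndependent_cols_iff_isUnit.2 (isUnit_map_intCast (K := ℝ) hM)

theorem support_diagonal {F : Type*} [Field F] (hM : M.det ≠ 0) (a : Fin n → Fˣ) :
    ((diagonal M a).coeff.support : Set (Fin n → ℤ)) = Set.range fun j i => M i j := by
  have hinj : Function.Injective fun (j : Fin n) (i : Fin n) => M i j := fun j k hjk => by
    refine (linearIndependent_realCol hM).injective ?_
    ext i
    exact congrArg (Int.cast : ℤ → ℝ) (congrFun hjk i)
  have hcoeff : ∀ v, (diagonal M a).coeff v =
      ∑ j, if (fun i => M i j) = v then (a j : F) else 0 := by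
    intro v
    rw [diagonal, AddMonoidAlgebra.coeff_sum, Finsupp.finsetSum_apply]
    exact Finset.sum_congr rfl fun j _ => by
      rw [AddMonoidAlgebra.coeff_single, Finsupp.single_apply]
  ext v
  rw [Finset.mem_coe, Finsupp.mem_support_iff, hcoeff]
  constructor
  · intro h
    obtain ⟨j, -, hj⟩ := Finset.exists_ne_zero_of_sum_ne_zero h
    exact ⟨j, by_contra fun h' => hj (if_neg h')⟩
  · rintro ⟨j, rfl⟩
    rw [Finset.sum_eq_single j (fun k _ hk => if_neg fun h => hk (hinj h)) (by simp), if_pos rfl]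
    exact (a j).ne_zero

theorem mem_newtonPolyhedron_diagonal {F : Type*} [Field F] (hM : M.det ≠ 0) (a : Fin n → Fˣ)
    (x : Fin n → ℝ) : x ∈ newtonPolyhedron (diagonal M a) ↔
      (∀ j, 0 ≤ coords M x j) ∧ ∑ j, coords M x j ≤ 1 := by
  have hcol : (fun (v : Fin n → ℤ) (i : Fin n) => (v i : ℝ)) ''
      ((diagonal M a).coeff.support : Set (Fin n → ℤ)) = Set.range (realCol M) := by
    rw [support_diagonal hM, ← Set.range_comp]
    rfl
  rw [newtonPolyhedron, hcol]
  constructor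
  · have hconv : Convex ℝ {x : Fin n → ℝ | (∀ j, 0 ≤ coords M x j) ∧ ∑ j, coords M x j ≤ 1} := by
      rintro y ⟨hy, hy'⟩ z ⟨hz, hz'⟩ s t hs ht hst
      simp only [Set.mem_ofPred_eq, coords_add, coords_smul, Pi.add_apply, Pi.smul_apply,
        smul_eq_mul, Finset.sum_add_distrib, ← Finset.mul_sum]
      refine ⟨fun j => add_nonneg (mul_nonneg hs (hy j)) (mul_nonneg ht (hz j)), ?_⟩
      nlinarith
    refine fun hx => convexHull_min ?_ hconv hx
    rintro y (rfl | ⟨j, rfl⟩)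
    · simp [coords_zero]
    · simp only [Set.mem_ofPred_eq, coords_realCol hM]
      refine ⟨fun k => ?_, by simp⟩
      rw [Pi.single_apply]
      split_ifs <;> norm_num
  · rintro ⟨h1, h2⟩
    -- The vertex 0 is indexed by `none` and receives the remaining weight 1 - ∑ coords.
    have h := (convex_convexHull ℝ (insert 0 (Set.range (realCol M)))).sum_mem
      (t := (Finset.univ : Finset (Option (Fin n))))
      (w := fun o => o.elim (1 - ∑ j, coords M x j) (coords M x))
      (z := fun o => o.elim 0 (realCol M)) ?_ ?_ ?_
    · rw [Fintype.sum_option] at h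
      simpa [sum_smul_realCol, mulVec_coords hM] using h
    · rintro (_ | j) -
      · simpa using h2
      · exact h1 j
    · rw [Fintype.sum_option]
      simp
    · rintro (_ | j) -
      · exact subset_convexHull ℝ _ (Set.mem_insert _ _)
      · exact subset_convexHull ℝ _ (Set.mem_insert_of_mem _ ⟨j, rfl⟩)

theorem mem_smul_newtonPolyhedron_diagonal {F : Type*} [Field F] (hM : M.det ≠ 0)
    (a : Fin n → Fˣ) {r : ℝ} (hr : 0 ≤ r) (x : Fin n → ℝ) :
    x ∈ r • newtonPolyhedron (diagonal M a) ↔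
      (∀ j, 0 ≤ coords M x j) ∧ ∑ j, coords M x j ≤ r := by
  rcases hr.eq_or_lt with rfl | hr
  · have hne : (newtonPolyhedron (diagonal M a)).Nonempty :=
      ⟨0, (mem_newtonPolyhedron_diagonal hM a 0).2 (by simp [coords_zero])⟩
    rw [Set.zero_smul_set hne, Set.mem_zero]
    constructor
    · rintro rfl
      simp [coords_zero]
    · rintro ⟨h1, h2⟩
      have h3 : coords M x = 0 := by
        funext j
        exact (Finset.sum_eq_zero_iff_of_nonneg fun j _ => h1 j).1
          (le_antisymm h2 (Finset.sum_nonneg fun j _ => h1 j)) j (Finset.mem_univ j)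
      rw [← mulVec_coords hM x, h3, Matrix.mulVec_zero]
  · rw [Set.mem_smul_set_iff_inv_smul_mem₀ hr.ne', mem_newtonPolyhedron_diagonal hM]
    simp only [coords_smul, Pi.smul_apply, smul_eq_mul, ← Finset.mul_sum]
    rw [inv_mul_le_iff₀ hr, mul_one]
    simp only [mul_nonneg_iff_of_pos_left (inv_pos.2 hr)]

theorem weight_diagonal {F : Type*} [Field F] (hM : M.det ≠ 0) (a : Fin n → Fˣ)
    {x : Fin n → ℝ} (hx : ∀ j, 0 ≤ coords M x j) :
    weight (newtonPolyhedron (diagonal M a)) x = ((∑ j, coords M x j : ℝ) : EReal) := by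
  refine IsLeast.csInf_eq ⟨⟨_, Finset.sum_nonneg fun j _ => hx j, ?_, rfl⟩, ?_⟩
  · exact (mem_smul_newtonPolyhedron_diagonal hM a (Finset.sum_nonneg fun j _ => hx j) x).2
      ⟨hx, le_rfl⟩
  · rintro _ ⟨r, hr, hxr, rfl⟩
    exact EReal.coe_le_coe_iff.2 ((mem_smul_newtonPolyhedron_diagonal hM a hr x).1 hxr).2

theorem weight_diagonal_eq_coe_iff {F : Type*} [Field F] (hM : M.det ≠ 0) (a : Fin n → Fˣ)
    (x : Fin n → ℝ) (s : ℝ) : weight (newtonPolyhedron (diagonal M a)) x = (s : EReal) ↔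
      (∀ j, 0 ≤ coords M x j) ∧ ∑ j, coords M x j = s := by
  constructor
  · intro h
    have hx : ∀ j, 0 ≤ coords M x j := by
      by_contra hx
      have : {c : EReal | ∃ r : ℝ, 0 ≤ r ∧ x ∈ r • newtonPolyhedron (diagonal M a) ∧
          c = (r : EReal)} = ∅ := Set.eq_empty_iff_forall_notMem.2 fun c ⟨r, hr, hxr, _⟩ =>
        hx ((mem_smul_newtonPolyhedron_diagonal hM a hr x).1 hxr).1
      rw [weight, this, sInf_empty] at h
      exact EReal.coe_ne_top s h.symm
    rw [weight_diagonal hM a hx, EReal.coe_eq_coe_iff] at h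
    exact ⟨hx, h⟩
  · rintro ⟨hx, rfl⟩
    exact weight_diagonal hM a hx

/-- The linear functional with coefficient vector `e`. -/
def dotFunctional (e : Fin n → ℚ) : (Fin n → ℝ) →ₗ[ℝ] ℝ :=
  ∑ i, (e i : ℝ) • LinearMap.proj i

theorem dotFunctional_apply (e : Fin n → ℚ) (x : Fin n → ℝ) :
    dotFunctional e x = ∑ i, (e i : ℝ) * x i := by
  simp [dotFunctional]

theorem dotFunctional_eq_sum_coords (hM : M.det ≠ 0) (e : Fin n → ℚ) (x : Fin n → ℝ) :
    dotFunctional e x = ∑ j, coords M x j * dotFunctional e (realCol M j) := by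
  conv_lhs => rw [← mulVec_coords hM x, ← sum_smul_realCol, map_sum]
  simp

theorem vectorSpan_le_ker {E : Type*} [AddCommGroup E] [Module ℝ E] (φ : E →ₗ[ℝ] ℝ) {c : ℝ}
    {s : Set E} (h : ∀ x ∈ s, φ x = c) : vectorSpan ℝ s ≤ LinearMap.ker φ := by
  rw [vectorSpan_def, Submodule.span_le]
  rintro _ ⟨x, hx, y, hy, rfl⟩
  simp [h x hx, h y hy]

/-- The only facet missing the origin is the one spanned by all the V_j. For n = 0 the right side is
vacuous while the left side fails on dimension. -/
theorem isFacetEquation_diagonal_iff {F : Type*} [Field F] (hM : M.det ≠ 0) (a : Fin n → Fˣ)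
    (hn : n ≠ 0) (e : Fin n → ℚ) :
    IsFacetEquation (newtonPolyhedron (diagonal M a)) e ↔ ∀ j, ∑ i, e i * (M i j : ℚ) = 1 := by
  have hcast : ∀ j, dotFunctional e (realCol M j) = ((∑ i, e i * (M i j : ℚ) : ℚ) : ℝ) := by
    intro j
    rw [dotFunctional_apply]
    push_cast
    rfl
  have hiff : (∀ j, ∑ i, e i * (M i j : ℚ) = 1) ↔ ∀ j, dotFunctional e (realCol M j) = 1 := by
    refine forall_congr' fun j => ?_
    rw [hcast]
    norm_cast
  have hmem : ∀ j, realCol M j ∈ newtonPolyhedron (diagonal M a) := fun j => by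
    rw [mem_newtonPolyhedron_diagonal hM, coords_realCol hM]
    refine ⟨fun k => ?_, by simp⟩
    rw [Pi.single_apply]
    split_ifs <;> norm_num
  have hker : ∀ φ : (Fin n → ℝ) →ₗ[ℝ] ℝ, φ ≠ 0 →
      Module.finrank ℝ (LinearMap.ker φ) + 1 = n := fun φ hφ => by
    rw [Module.Dual.finrank_ker_add_one_of_ne_zero (f := φ) hφ, Module.finrank_fin_fun]
  have hface : {x ∈ newtonPolyhedron (diagonal M a) | ∑ i, (e i : ℝ) * x i = 1} =
      {x ∈ newtonPolyhedron (diagonal M a) | dotFunctional e x = 1} := by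
    simp only [dotFunctional_apply]
  rw [hiff, IsFacetEquation, hface]
  simp only [← dotFunctional_apply]
  set φ := dotFunctional e with hφ
  constructor
  · rintro ⟨h1, ⟨x, hx, hx1⟩, h3⟩ j
    have hφ0 : φ ≠ 0 := by
      intro h
      rw [h] at hx1
      simp at hx1
    by_contra hj
    have hlt : φ (realCol M j) < 1 := lt_of_le_of_ne (h1 _ (hmem j)) hj
    have hzero : ∀ y ∈ {y ∈ newtonPolyhedron (diagonal M a) | φ y = 1}, coords M y j = 0 := by
      rintro y ⟨hy, hy1⟩
      rw [mem_newtonPolyhedron_diagonal hM] at hy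
      by_contra hne
      have hpos : 0 < coords M y j := lt_of_le_of_ne (hy.1 j) (Ne.symm hne)
      have : ∑ k, coords M y k * φ (realCol M k) < ∑ k, coords M y k :=
        Finset.sum_lt_sum (fun k _ => mul_le_of_le_one_right (hy.1 k) (h1 _ (hmem k)))
          ⟨j, Finset.mem_univ j, mul_lt_of_lt_one_right hpos hlt⟩
      rw [← dotFunctional_eq_sum_coords hM, ← hφ, hy1] at this
      linarith [hy.2]
    -- If the functional is below 1 at V_j, the face lies in the zero set of the j-th coordinate ψ.
    -- By dimension its direction space is both ker φ and ker ψ, but a point x of the face has ψ x =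
    -- 0 and φ x = 1.
    let ψ : (Fin n → ℝ) →ₗ[ℝ] ℝ :=
      LinearMap.proj j ∘ₗ Matrix.mulVecLin (M.map (Int.cast : ℤ → ℝ))⁻¹
    have hψ : ∀ y, ψ y = coords M y j := fun y => rfl
    have hψ0 : ψ ≠ 0 := by
      intro h
      have := hψ (realCol M j)
      rw [h, coords_realCol hM] at this
      simp at this
    have e1 := Submodule.eq_of_le_of_finrank_eq (vectorSpan_le_ker φ (c := 1)
      (s := {y ∈ newtonPolyhedron (diagonal M a) | φ y = 1}) fun y hy => hy.2)
      (by have := hker φ hφ0; omega)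
    have e2 := Submodule.eq_of_le_of_finrank_eq (vectorSpan_le_ker ψ (c := 0)
      (s := {y ∈ newtonPolyhedron (diagonal M a) | φ y = 1}) hzero)
      (by have := hker ψ hψ0; omega)
    have hφψ : LinearMap.ker ψ = LinearMap.ker φ := e2.symm.trans e1
    have hxker : x ∈ LinearMap.ker ψ := hzero x ⟨hx, hx1⟩
    rw [hφψ, LinearMap.mem_ker, hx1] at hxker
    exact one_ne_zero hxker
  · intro h
    have hval : ∀ x, φ x = ∑ j, coords M x j := fun x => by
      rw [dotFunctional_eq_sum_coords hM]
      simp [h, ← hφ]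
    have j0 : Fin n := ⟨0, Nat.pos_of_ne_zero hn⟩
    have hφ0 : φ ≠ 0 := by
      intro h0
      have := h j0
      rw [h0] at this
      simp at this
    refine ⟨fun x hx => ?_, ⟨realCol M j0, hmem j0, h j0⟩, ?_⟩
    · rw [hval]
      exact ((mem_newtonPolyhedron_diagonal hM a x).1 hx).2
    · have h1 : Set.range (realCol M) ⊆ {y ∈ newtonPolyhedron (diagonal M a) | φ y = 1} := by
        rintro _ ⟨j, rfl⟩
        exact ⟨hmem j, h j⟩
      have h2 := Submodule.finrank_mono (vectorSpan_mono ℝ h1)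
      rw [((linearIndependent_realCol hM).affineIndependent ℝ).finrank_vectorSpan (n := n - 1)
        (by rw [Fintype.card_fin]; omega)] at h2
      have h3 := Submodule.finrank_mono (vectorSpan_le_ker φ (c := 1)
        (s := {y ∈ newtonPolyhedron (diagonal M a) | φ y = 1}) fun y hy => hy.2)
      have := hker φ hφ0
      omega

theorem exists_dot_eq_one (hM : M.det ≠ 0) :
    ∃ e : Fin n → ℚ, ∀ j, ∑ i, e i * (M i j : ℚ) = 1 := by
  have h : Matrix.vecMul (Matrix.vecMul 1 (M.map (Int.cast : ℤ → ℚ))⁻¹)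
      (M.map (Int.cast : ℤ → ℚ)) = 1 := by
    rw [Matrix.vecMul_vecMul,
      Matrix.nonsing_inv_mul _ ((Matrix.isUnit_iff_isUnit_det _).1 (isUnit_map_intCast hM)),
      Matrix.vecMul_one]
  exact ⟨_, fun j => congrFun h j⟩

theorem exists_det_mul_eq_intCast {e : Fin n → ℚ}
    (he : ∀ j, ∑ i, e i * (M i j : ℚ) = 1) (i : Fin n) : ∃ z : ℤ, (M.det : ℚ) * e i = z := by
  have h1 : Matrix.vecMul e (M.map (Int.cast : ℤ → ℚ)) = 1 := funext fun j => he j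
  have h2 : Matrix.vecMul 1 ((M.map (Int.cast : ℤ → ℚ)).adjugate) = (M.det : ℚ) • e := by
    rw [← h1, Matrix.vecMul_vecMul, Matrix.mul_adjugate, ← Int.cast_det, Matrix.vecMul_smul,
      Matrix.vecMul_one]
  have h3 : (M.map (Int.cast : ℤ → ℚ)).adjugate = M.adjugate.map (Int.cast : ℤ → ℚ) :=
    ((Int.castRingHom ℚ).map_adjugate M).symm
  refine ⟨∑ k, M.adjugate k i, ?_⟩
  rw [← smul_eq_mul, ← Pi.smul_apply, ← h2, h3]
  simp [Matrix.vecMul, dotProduct]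

/-- Cramer's rule shows that |det M| is a common denominator, so the infimum is attained. Minimality
of D plays no role in the sequel. -/
theorem denominator_diagonal_spec {F : Type*} [Field F] (hM : M.det ≠ 0) (a : Fin n → Fˣ) :
    0 < denominator (newtonPolyhedron (diagonal M a)) ∧
      ∀ e : Fin n → ℚ, (∀ j, ∑ i, e i * (M i j : ℚ) = 1) →
        ∀ i, ∃ z : ℤ, (denominator (newtonPolyhedron (diagonal M a)) : ℚ) * e i = z := by
  have hmem := Nat.sInf_mem (s := {D : ℕ | 0 < D ∧ ∀ e : Fin n → ℚ,
    IsFacetEquation (newtonPolyhedron (diagonal M a)) e → ∀ i, ∃ z : ℤ, (D : ℚ) * e i = z})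
    ⟨M.det.natAbs, Int.natAbs_pos.2 hM, fun e he i => by
      have hn : n ≠ 0 := fun h => Fin.elim0 (h ▸ i)
      obtain ⟨z, hz⟩ := exists_det_mul_eq_intCast
        ((isFacetEquation_diagonal_iff hM a hn e).1 he) i
      rcases Int.natAbs_eq M.det with h | h
      · exact ⟨z, by rw [← hz, h]; simp⟩
      · exact ⟨-z, by
          rw [Int.cast_neg, ← hz, h]
          simp⟩⟩
  refine ⟨hmem.1, fun e he i => ?_⟩
  have hn : n ≠ 0 := fun h => Fin.elim0 (h ▸ i)
  exact hmem.2 e ((isFacetEquation_diagonal_iff hM a hn e).2 he) i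

/-- With e the facet functional and u = M r, |r| = e · u; here D e and u are integral. -/
theorem exists_denominator_mul_rnorm {F : Type*} [Field F] (hM : M.det ≠ 0) (a : Fin n → Fˣ)
    {r : Fin n → ℚ} (hr : r ∈ solutionSet M) :
    ∃ t : ℕ, (denominator (newtonPolyhedron (diagonal M a)) : ℚ) * rnorm r = t := by
  obtain ⟨h0, u, hu⟩ := hr
  obtain ⟨e, he⟩ := exists_dot_eq_one hM
  choose z hz using (denominator_diagonal_spec hM a).2 e he
  set D := denominator (newtonPolyhedron (diagonal M a))
  have h1 : rnorm r = ∑ i, e i * u i := by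
    have hu' : ∀ i, (u i : ℚ) = ∑ j, (M i j : ℚ) * r j := fun i => (congrFun hu i).symm
    simp only [hu', Finset.mul_sum, rnorm]
    rw [Finset.sum_comm]
    refine Finset.sum_congr rfl fun j _ => ?_
    simp only [← mul_assoc]
    rw [← Finset.sum_mul, he, one_mul]
  have h2 : (D : ℚ) * rnorm r = ((∑ i, z i * u i : ℤ) : ℚ) := by
    rw [h1, Finset.mul_sum]
    push_cast
    exact Finset.sum_congr rfl fun i _ => by rw [← mul_assoc, hz]
  have h3 : 0 ≤ (D : ℚ) * rnorm r :=
    mul_nonneg (Nat.cast_nonneg D) (Finset.sum_nonneg fun i _ => (h0 i).1)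
  rw [h2] at h3
  obtain ⟨t, ht⟩ := Int.eq_ofNat_of_zero_le (Int.cast_nonneg_iff.1 h3)
  exact ⟨t, by rw [h2, ht]; simp⟩

end Polyhedron

end DiagonalLaurent

end

open scoped Pointwise

noncomputable section

/-! ### Counting lattice points: Hodge numbers and the Hodge polygon -/

namespace DiagonalLaurent

section WeightedCompositions

/-- The number of `m : ℕⁿ` with `D * |m| = j`. -/
def compositionCount (n D : ℕ) (j : ℤ) : ℤ :=
  Set.ncard {m : Fin n → ℕ | (D : ℤ) * ∑ i, (m i : ℤ) = j}

theorem finite_compositions {D : ℕ} (hD : 0 < D) (n : ℕ) (j : ℤ) :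
    {m : Fin n → ℕ | (D : ℤ) * ∑ i, (m i : ℤ) = j}.Finite := by
  refine (Set.finite_Iic fun _ => j.toNat).subset fun m hm i => ?_
  have h1 : (m i : ℤ) ≤ ∑ i, (m i : ℤ) :=
    Finset.single_le_sum (f := fun i => (m i : ℤ)) (fun _ _ => Int.natCast_nonneg _)
      (Finset.mem_univ i)
  have h2 : ∑ i, (m i : ℤ) ≤ (D : ℤ) * ∑ i, (m i : ℤ) :=
    le_mul_of_one_le_left (Finset.sum_nonneg fun _ _ => Int.natCast_nonneg _)
      (by exact_mod_cast hD)
  have h3 : (D : ℤ) * ∑ i, (m i : ℤ) = j := hm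
  change m i ≤ j.toNat
  omega

/-- Either m 0 vanishes and can be dropped, or it can be lowered by one. -/
theorem compositionCount_succ {D : ℕ} (hD : 0 < D) (n : ℕ) (j : ℤ) :
    compositionCount (n + 1) D j = compositionCount n D j + compositionCount (n + 1) D (j - D) := by
  have hunion : {m : Fin (n + 1) → ℕ | (D : ℤ) * ∑ i, (m i : ℤ) = j} =
      (fun m => (Fin.cons 0 m : Fin (n + 1) → ℕ)) ''
          {m : Fin n → ℕ | (D : ℤ) * ∑ i, (m i : ℤ) = j} ∪
        (fun m => m + Pi.single 0 1) ''
          {m : Fin (n + 1) → ℕ | (D : ℤ) * ∑ i, (m i : ℤ) = j - D} := by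
    ext m
    constructor
    · intro hm
      rw [Set.mem_ofPred_eq] at hm
      rcases Nat.eq_zero_or_pos (m 0) with h | h
      · refine Or.inl ⟨Fin.tail m, ?_, ?_⟩
        · rw [Fin.sum_univ_succ, h, Nat.cast_zero, zero_add] at hm
          exact hm
        · conv_rhs => rw [← Fin.cons_self_tail m, h]
      · have hm' : m - Pi.single 0 1 + Pi.single 0 1 = m := by
          funext i
          simp only [Pi.add_apply, Pi.sub_apply, Pi.single_apply]
          split_ifs with hi
          · subst hi; omega
          · omega
        refine Or.inr ⟨m - Pi.single 0 1, ?_, hm'⟩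
        rw [← hm'] at hm
        simp only [Pi.add_apply, Nat.cast_add, Finset.sum_add_distrib, mul_add] at hm
        rw [Set.mem_ofPred_eq]
        simp only [Pi.single_apply] at hm ⊢
        simp at hm ⊢
        linarith
    · rintro (⟨m, hm, rfl⟩ | ⟨m, hm, rfl⟩)
      · rw [Set.mem_ofPred_eq] at hm ⊢
        simpa [Fin.sum_univ_succ] using hm
      · rw [Set.mem_ofPred_eq] at hm ⊢
        simp only [Pi.add_apply, Nat.cast_add, Finset.sum_add_distrib, mul_add, hm,
          Pi.single_apply]
        simp
  have hdisj : Disjoint ((fun m => (Fin.cons 0 m : Fin (n + 1) → ℕ)) ''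
      {m : Fin n → ℕ | (D : ℤ) * ∑ i, (m i : ℤ) = j}) ((fun m => m + Pi.single 0 1) ''
          {m : Fin (n + 1) → ℕ | (D : ℤ) * ∑ i, (m i : ℤ) = j - D}) := by
    rw [Set.disjoint_left]
    rintro _ ⟨m, -, rfl⟩ ⟨m', -, h⟩
    have := congrFun h 0
    simp at this
  rw [compositionCount, hunion, Set.ncard_union_eq hdisj ((finite_compositions hD _ _).image _)
    ((finite_compositions hD _ _).image _),
    Set.ncard_image_of_injective _ (Fin.cons_right_injective (α := fun _ => ℕ) 0),
    Set.ncard_image_of_injective _ (add_left_injective _)]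
  push_cast
  rfl

theorem compositionCount_zero {D : ℕ} (j : ℤ) :
    compositionCount 0 D j = if j = 0 then 1 else 0 := by
  rw [compositionCount]
  split_ifs with h
  · subst h
    simp
  · have : {m : Fin 0 → ℕ | (D : ℤ) * ∑ i, (m i : ℤ) = j} = ∅ :=
      Set.eq_empty_iff_forall_notMem.2 fun m hm => h (by simpa using hm.symm)
    rw [this]
    simp

/-- The generating function is (1 - T^D)^(-n), and each difference of step -D cancels one factor.
The sign appears because this difference is f(j - D) - f(j). -/
theorem fwdDiff_iter_compositionCount {D : ℕ} (hD : 0 < D) (n : ℕ) :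
    (fwdDiff (-(D : ℤ)))^[n] (compositionCount n D) =
      (-1 : ℤ) ^ n • fun j : ℤ => if j = 0 then 1 else 0 := by
  induction n with
  | zero =>
    funext j
    simp [compositionCount_zero]
  | succ n ih =>
    have h : fwdDiff (-(D : ℤ)) (compositionCount (n + 1) D) = (-1 : ℤ) • compositionCount n D := by
      funext j
      rw [fwdDiff, Pi.smul_apply, compositionCount_succ hD n j, ← sub_eq_add_neg]
      simp
    rw [Function.iterate_succ_apply, h, fwdDiff_iter_const_smul, ih, smul_smul, pow_succ']

theorem sum_choose_mul_compositionCount {D : ℕ} (hD : 0 < D) (n : ℕ) (j : ℤ) :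
    ∑ i ∈ Finset.range (n + 1),
      (-1) ^ i * (n.choose i : ℤ) * compositionCount n D (j - i * D) = if j = 0 then 1 else 0 := by
  have h1 := fwdDiff_iter_eq_sum_shift (-(D : ℤ)) (compositionCount n D) n j
  rw [fwdDiff_iter_compositionCount hD, Pi.smul_apply, smul_eq_mul] at h1
  have h2 : ((-1 : ℤ) ^ n) * (-1) ^ n = 1 := by rw [← mul_pow]; simp
  calc _ = (-1 : ℤ) ^ n * ∑ k ∈ Finset.range (n + 1), ((-1 : ℤ) ^ (n - k) * (n.choose k : ℤ)) •
          compositionCount n D (j + k • -(D : ℤ)) := by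
        rw [Finset.mul_sum]
        refine Finset.sum_congr rfl fun i hi => ?_
        have hi' : i ≤ n := Nat.lt_succ_iff.1 (Finset.mem_range.1 hi)
        have h3 : (-1 : ℤ) ^ n * (-1) ^ (n - i) = (-1) ^ i := by
          obtain ⟨k, rfl⟩ := Nat.exists_eq_add_of_le hi'
          rw [Nat.add_sub_cancel_left, pow_add, mul_assoc, ← mul_pow]
          simp
        rw [smul_eq_mul, ← mul_assoc, ← mul_assoc, h3]
        congr 2
        simp [sub_eq_add_neg]
    _ = _ := by rw [← h1, ← mul_assoc, h2, one_mul]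

end WeightedCompositions

section HodgePolygon

variable {n : ℕ} {M : Matrix (Fin n) (Fin n) ℤ} {F : Type*} [Field F]

theorem coords_eq_of_mulVec {c : Fin n → ℚ} {u : Fin n → ℤ} (hM : M.det ≠ 0)
    (h : (M.map (Int.cast : ℤ → ℚ)).mulVec c = fun i => (u i : ℚ)) :
    coords M (fun i => (u i : ℝ)) = fun j => (c j : ℝ) := by
  have : (fun i => (u i : ℝ)) = (M.map (Int.cast : ℤ → ℝ)).mulVec fun j => (c j : ℝ) := by
    funext i
    have := congrArg (Rat.cast : ℚ → ℝ) (congrFun h i)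
    simp only [Matrix.mulVec, dotProduct, Matrix.map_apply] at this ⊢
    push_cast at this
    exact this.symm
  rw [this, coords_mulVec hM]

theorem exists_mulVec_eq_intCast (hM : M.det ≠ 0) (u : Fin n → ℤ) :
    ∃ c : Fin n → ℚ, (M.map (Int.cast : ℤ → ℚ)).mulVec c = fun i => (u i : ℚ) := by
  refine ⟨(M.map (Int.cast : ℤ → ℚ))⁻¹.mulVec fun i => (u i : ℚ), ?_⟩
  rw [Matrix.mulVec_mulVec,
    Matrix.mul_nonsing_inv _ ((Matrix.isUnit_iff_isUnit_det _).1 (isUnit_map_intCast hM)),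
    Matrix.one_mulVec]

theorem mulVec_add_intCast {r : Fin n → ℚ} {u : Fin n → ℤ}
    (h : (M.map (Int.cast : ℤ → ℚ)).mulVec r = fun i => (u i : ℚ)) (m : Fin n → ℤ) :
    (M.map (Int.cast : ℤ → ℚ)).mulVec (fun j => r j + m j) =
      fun i => (((u + M.mulVec m) i : ℤ) : ℚ) := by
  have h1 : (fun j => r j + (m j : ℚ)) = r + fun j => (m j : ℚ) := rfl
  rw [h1, Matrix.mulVec_add, h]
  funext i
  simp [Matrix.mulVec, dotProduct]

/-- The common multiple `D * |r|` of the norm of an element of the solution set. -/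
def scaledNorm (D : ℕ) (r : Fin n → ℚ) : ℕ := ⌊(D : ℚ) * rnorm r⌋₊

theorem scaledNorm_eq (hM : M.det ≠ 0) (a : Fin n → Fˣ) {r : Fin n → ℚ} (hr : r ∈ solutionSet M) :
    (scaledNorm (denominator (newtonPolyhedron (diagonal M a))) r : ℚ) =
      denominator (newtonPolyhedron (diagonal M a)) * rnorm r := by
  obtain ⟨t, ht⟩ := exists_denominator_mul_rnorm hM a hr
  rw [scaledNorm, ht, Nat.floor_natCast]

/-- Coordinates of a lattice point in the cone split uniquely into fractional parts, forming a point
r of S(Δ), and integral parts m in ℕⁿ; the weight is |r| + |m|. -/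
theorem latticeCount_diagonal (hM : M.det ≠ 0) (a : Fin n → Fˣ) [Fintype (solutionSet M)] (k : ℤ) :
    (latticeCount (newtonPolyhedron (diagonal M a)) k : ℤ) = ∑ r : solutionSet M,
      compositionCount n (denominator (newtonPolyhedron (diagonal M a)))
        (k - scaledNorm (denominator (newtonPolyhedron (diagonal M a))) (r : Fin n → ℚ)) := by
  have hD := (denominator_diagonal_spec hM a).1
  have ht : ∀ r : solutionSet M, _ := fun r => scaledNorm_eq hM a r.2
  rw [latticeCount]
  simp only [weight_diagonal_eq_coe_iff hM a]
  set D := denominator (newtonPolyhedron (diagonal M a)) with hDdef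
  choose u hu using fun r : solutionSet M => r.2.2
  have hD' : (D : ℚ) ≠ 0 := by exact_mod_cast hD.ne'
  have hcoords : ∀ (r : solutionSet M) (m : Fin n → ℕ),
      coords M (fun i => ((u r + M.mulVec fun j => (m j : ℤ)) i : ℝ)) =
        fun j => (((r : Fin n → ℚ) j + m j : ℚ) : ℝ) := fun r m => by
    have := coords_eq_of_mulVec hM (mulVec_add_intCast (hu r) fun j => (m j : ℤ))
    rw [this]
    simp
  have hsum : ∀ (r : solutionSet M) (m : Fin n → ℕ),
      ∑ j, (((r : Fin n → ℚ) j + m j : ℚ) : ℝ) = (k : ℝ) / (D : ℝ) ↔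
        (D : ℤ) * ∑ i, (m i : ℤ) = k - scaledNorm D (r : Fin n → ℚ) := by
    intro r m
    have h1 : (∑ j, (((r : Fin n → ℚ) j + m j : ℚ) : ℝ) = (k : ℝ) / (D : ℝ)) ↔
        rnorm (r : Fin n → ℚ) + ∑ j, (m j : ℚ) = (k : ℚ) / D := by
      rw [rnorm, ← Finset.sum_add_distrib]
      norm_cast
    rw [h1, eq_div_iff hD', add_mul, mul_comm (rnorm _), ← ht r, ← @Int.cast_inj ℚ]
    push_cast
    constructor <;> intro h <;> linarith
  let T : solutionSet M → Type := fun r =>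
    {m : Fin n → ℕ // (D : ℤ) * ∑ i, (m i : ℤ) = k - scaledNorm D (r : Fin n → ℚ)}
  have : ∀ r, Finite (T r) := fun r => (finite_compositions hD _ _).to_subtype
  let f : (Σ r, T r) → {v : Fin n → ℤ // (∀ j, 0 ≤ coords M (fun i => (v i : ℝ)) j) ∧
      ∑ j, coords M (fun i => (v i : ℝ)) j = (k : ℝ) / (D : ℝ)} := fun x =>
    ⟨u x.1 + M.mulVec fun j => ((x.2.1 j : ℕ) : ℤ), by
      rw [hcoords]
      exact ⟨fun j => by
        have := (x.1.2.1 j).1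
        simp only
        positivity, (hsum _ _).2 x.2.2⟩⟩
  have hf : Function.Bijective f := by
    constructor
    · rintro ⟨⟨r, hr⟩, ⟨m, hm⟩⟩ ⟨⟨r', hr'⟩, ⟨m', hm'⟩⟩ h
      have h1 := congrArg (fun v : Fin n → ℤ => coords M fun i => (v i : ℝ)) (congrArg Subtype.val h)
      simp only [f] at h1
      rw [hcoords, hcoords] at h1
      have h2 : ∀ j, r j + m j = r' j + m' j := fun j => by exact_mod_cast congrFun h1 j
      have h3 : r = r' := by
        funext j
        rw [← Int.fract_eq_self.2 (hr.1 j), ← Int.fract_eq_self.2 (hr'.1 j),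
          ← Int.fract_add_natCast (r j) (m j), h2, Int.fract_add_natCast]
      subst h3
      have h4 : m = m' := by
        funext j
        exact_mod_cast add_left_cancel (h2 j)
      subst h4
      rfl
    · rintro ⟨v, hv, hvk⟩
      obtain ⟨c, hc⟩ := exists_mulVec_eq_intCast hM v
      have hcc := coords_eq_of_mulVec hM hc
      have hc0 : ∀ j, 0 ≤ c j := fun j => by
        have := hv j
        rw [hcc] at this
        exact Rat.cast_nonneg.1 this
      have hfr : (fun j => Int.fract (c j)) ∈ solutionSet M := by
        refine ⟨fun j => ⟨Int.fract_nonneg _, Int.fract_lt_one _⟩,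
          v + M.mulVec fun j => -⌊c j⌋, ?_⟩
        rw [← mulVec_add_intCast hc]
        congr 1
        funext j
        simp [Int.fract, sub_eq_add_neg]
      have hfl : ∀ j, ((⌊c j⌋.toNat : ℕ) : ℚ) = ⌊c j⌋ := fun j => by
        have : ((⌊c j⌋.toNat : ℕ) : ℤ) = ⌊c j⌋ := Int.toNat_of_nonneg (Int.floor_nonneg.2 (hc0 j))
        exact_mod_cast congrArg (Int.cast : ℤ → ℚ) this
      have hrec : ∀ j, Int.fract (c j) + (⌊c j⌋.toNat : ℕ) = c j := fun j => by
        rw [hfl, Int.fract_add_floor]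
      refine ⟨⟨⟨_, hfr⟩, ⟨fun j => ⌊c j⌋.toNat, ?_⟩⟩, ?_⟩
      · rw [← hsum]
        simp only [hrec]
        rw [hcc] at hvk
        exact hvk
      · apply Subtype.ext
        have h1 := mulVec_add_intCast (hu ⟨_, hfr⟩) fun j => ((⌊c j⌋.toNat : ℕ) : ℤ)
        simp only [Int.cast_natCast, hrec] at h1
        rw [hc] at h1
        funext i
        exact (Int.cast_injective (α := ℚ) (congrFun h1 i)).symm
  have hcard := Nat.card_eq_of_bijective f hf
  rw [Nat.card_sigma] at hcard
  refine (congrArg (Nat.cast : ℕ → ℤ) hcard.symm).trans ?_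
  push_cast
  rfl

theorem hodgeNumber_diagonal (hM : M.det ≠ 0) (a : Fin n → Fˣ) [Fintype (solutionSet M)] (k : ℕ) :
    hodgeNumber (newtonPolyhedron (diagonal M a)) k = ∑ r : solutionSet M,
      if k = scaledNorm (denominator (newtonPolyhedron (diagonal M a))) (r : Fin n → ℚ)
        then 1 else 0 := by
  have hD := (denominator_diagonal_spec hM a).1
  rw [hodgeNumber]
  simp only [latticeCount_diagonal hM a, Finset.mul_sum]
  rw [Finset.sum_comm]
  refine Finset.sum_congr rfl fun r _ => ?_
  have h := sum_choose_mul_compositionCount hD n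
    ((k : ℤ) - scaledNorm (denominator (newtonPolyhedron (diagonal M a))) (r : Fin n → ℚ))
  simp only [sub_eq_zero, Nat.cast_inj] at h
  rw [← h]
  exact Finset.sum_congr rfl fun i _ => by rw [sub_right_comm]

theorem sum_mul_hodgeNumber (hM : M.det ≠ 0) (a : Fin n → Fˣ) [Fintype (solutionSet M)] (m : ℕ)
    (f : ℕ → ℝ) : ∑ k ∈ Finset.range (m + 1),
      f k * (hodgeNumber (newtonPolyhedron (diagonal M a)) k : ℝ) = ∑ r : solutionSet M,
        if scaledNorm (denominator (newtonPolyhedron (diagonal M a))) (r : Fin n → ℚ) ≤ m then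
          f (scaledNorm (denominator (newtonPolyhedron (diagonal M a))) (r : Fin n → ℚ)) else 0 := by
  simp only [hodgeNumber_diagonal hM a]
  push_cast
  simp only [Finset.mul_sum]
  rw [Finset.sum_comm]
  refine Finset.sum_congr rfl fun r _ => ?_
  simp only [mul_ite, mul_one, mul_zero]
  rw [Finset.sum_ite_eq' ]
  simp only [Finset.mem_range, Nat.lt_succ_iff]

/-- At the m-th vertex, y - l x is minus the sum of l - |r| over the r with D|r| ≤ m. It is smallest
when exactly the r with |r| ≤ l, those with nonnegative terms, are included. -/
theorem hodge_points_support_iff (hM : M.det ≠ 0) (a : Fin n → Fˣ) [Fintype (solutionSet M)]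
    (l c : ℝ) :
    (∀ Q ∈ insert ((0, 0) : ℝ × ℝ) {P | ∃ m : ℕ,
      m ≤ n * denominator (newtonPolyhedron (diagonal M a)) ∧
      P = (∑ k ∈ Finset.range (m + 1),
          (hodgeNumber (newtonPolyhedron (diagonal M a)) k : ℝ),
        1 / (denominator (newtonPolyhedron (diagonal M a)) : ℝ) * ∑ k ∈ Finset.range (m + 1),
          (k : ℝ) * (hodgeNumber (newtonPolyhedron (diagonal M a)) k : ℝ))},
      c ≤ Q.2 - l * Q.1) ↔
      c ≤ -∑ r : solutionSet M, max 0 (l - (rnorm (r : Fin n → ℚ) : ℝ)) := by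
  have hD := (denominator_diagonal_spec hM a).1
  have ht : ∀ r : solutionSet M, _ := fun r => scaledNorm_eq hM a r.2
  have hs1 : ∀ m, _ := fun m => sum_mul_hodgeNumber hM a m fun _ => 1
  have hs2 : ∀ m, _ := fun m => sum_mul_hodgeNumber hM a m fun k => k
  simp only [one_mul] at hs1
  simp only [hs1, hs2]
  set D := denominator (newtonPolyhedron (diagonal M a)) with hDdef
  have hDpos : (0 : ℝ) < D := by exact_mod_cast hD
  have ht' : ∀ r : solutionSet M, (scaledNorm D (r : Fin n → ℚ) : ℝ) =
      D * (rnorm (r : Fin n → ℚ) : ℝ) := fun r => by exact_mod_cast congrArg (Rat.cast : ℚ → ℝ) (ht r)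
  have hr0 : ∀ r : solutionSet M, (0 : ℝ) ≤ (rnorm (r : Fin n → ℚ) : ℝ) := fun r => by
    exact_mod_cast Finset.sum_nonneg fun i _ => (r.2.1 i).1
  have hrn : ∀ r : solutionSet M, (rnorm (r : Fin n → ℚ) : ℝ) ≤ n := fun r => by
    have : rnorm (r : Fin n → ℚ) ≤ ∑ _i : Fin n, 1 := Finset.sum_le_sum fun i _ => (r.2.1 i).2.le
    rw [Finset.sum_const, Finset.card_univ, Fintype.card_fin, nsmul_one] at this
    exact_mod_cast this
  have hval : ∀ m : ℕ, 1 / (D : ℝ) * (∑ r : solutionSet M,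
        if scaledNorm D (r : Fin n → ℚ) ≤ m then (scaledNorm D (r : Fin n → ℚ) : ℝ) else 0) -
      l * (∑ r : solutionSet M, if scaledNorm D (r : Fin n → ℚ) ≤ m then (1 : ℝ) else 0) =
      -∑ r : solutionSet M, if scaledNorm D (r : Fin n → ℚ) ≤ m then
        l - (rnorm (r : Fin n → ℚ) : ℝ) else 0 := by
    intro m
    rw [Finset.mul_sum, Finset.mul_sum, ← Finset.sum_sub_distrib, ← Finset.sum_neg_distrib]
    refine Finset.sum_congr rfl fun r _ => ?_
    split_ifs
    · rw [ht']
      field_simp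
      ring
    · simp
  have hmax : ∀ m : ℕ, ∑ r : solutionSet M, (if scaledNorm D (r : Fin n → ℚ) ≤ m then
        l - (rnorm (r : Fin n → ℚ) : ℝ) else 0) ≤
      ∑ r : solutionSet M, max 0 (l - (rnorm (r : Fin n → ℚ) : ℝ)) := fun m =>
    Finset.sum_le_sum fun r _ => by
      split_ifs
      · exact le_max_right _ _
      · exact le_max_left _ _
  constructor
  · intro h
    -- For l < 0 no r qualifies and the minimum is at the origin, which is why (0, 0) is needed
    -- among the points.
    rcases lt_or_ge l 0 with hl | hl
    · have h0 := h _ (Set.mem_insert _ _)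
      have h1 : ∑ r : solutionSet M, max 0 (l - (rnorm (r : Fin n → ℚ) : ℝ)) = 0 :=
        Finset.sum_eq_zero fun r _ => max_eq_left (by linarith [hr0 r])
      rw [h1]
      simpa using h0
    -- The optimal vertex is m = ⌊lD⌋; capping at nD loses no r, since |r| ≤ n.
    · have h0 := h _ (Set.mem_insert_of_mem _
        ⟨min ⌊l * D⌋₊ (n * D), min_le_right _ _, rfl⟩)
      rw [hval] at h0
      convert h0 using 3 with r
      have hcut : scaledNorm D (r : Fin n → ℚ) ≤ min ⌊l * D⌋₊ (n * D) ↔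
          (rnorm (r : Fin n → ℚ) : ℝ) ≤ l := by
        have h1 : scaledNorm D (r : Fin n → ℚ) ≤ n * D := by
          have : (scaledNorm D (r : Fin n → ℚ) : ℝ) ≤ n * D := by
            rw [ht', mul_comm]
            exact mul_le_mul_of_nonneg_right (hrn r) hDpos.le
          exact_mod_cast this
        rw [le_min_iff, and_iff_left h1, Nat.le_floor_iff (by positivity), ht', mul_comm l,
          mul_le_mul_iff_right₀ hDpos]
      simp only [hcut]
      split_ifs with h2
      · exact max_eq_right (by linarith)
      · exact max_eq_left (by linarith)
  · rintro h Q (rfl | ⟨m, -, rfl⟩)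
    · have h1 : (0 : ℝ) ≤ ∑ r : solutionSet M, max 0 (l - (rnorm (r : Fin n → ℚ) : ℝ)) :=
        Finset.sum_nonneg fun r _ => le_max_left _ _
      simp only [mul_zero, sub_zero]
      linarith
    · simp only [hval]
      linarith [hmax m]

end HodgePolygon

end DiagonalLaurent

end

open scoped Pointwise

noncomputable section

/-! ### The ordinarity criterion -/

namespace DiagonalLaurent

section Ordinary

open OrbitProduct

variable {n : ℕ} {M : Matrix (Fin n) (Fin n) ℤ}

/-- Take φ(|det M|)-th roots, using max(1, q^y) = q^max(0, y); the exponent of p becomes an average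
over e φ(|det M|) steps of the p-action. -/
theorem gaussNorm_eq_rpow (p : ℕ) [Fact p.Prime] (hM : M.det ≠ 0) [Fintype (solutionSet M)]
    {e : ℕ} (he : e ≠ 0) {P : Polynomial ℂ_[p]}
    (hP : ∀ ρ : ℝ, 0 < ρ → P.gaussNorm (normAbs ℂ_[p]) ρ ^ M.det.natAbs.totient =
      ∏ r : solutionSet M, max 1 ((p : ℝ) ^ (-∑ i ∈ Finset.range (e * M.det.natAbs.totient),
        (rnorm (fracMul (p ^ i) (r : Fin n → ℚ)) : ℝ)) * ρ ^ M.det.natAbs.totient)) (l : ℝ) :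
    P.gaussNorm (normAbs ℂ_[p]) (((p ^ e : ℕ) : ℝ) ^ l) = ((p ^ e : ℕ) : ℝ) ^
      ∑ r : solutionSet M, max 0 (l - (∑ i ∈ Finset.range (e * M.det.natAbs.totient),
        (rnorm (fracMul (p ^ i) (r : Fin n → ℚ)) : ℝ)) / (e * M.det.natAbs.totient : ℕ)) := by
  have hp1 : (1 : ℝ) < p := by exact_mod_cast (Fact.out : p.Prime).one_lt
  have hp0 : (0 : ℝ) < p := by linarith
  have hd : 0 < M.det.natAbs.totient := Nat.totient_pos.2 (Int.natAbs_pos.2 hM)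
  set d := M.det.natAbs.totient
  have hd' : (d : ℝ) ≠ 0 := by exact_mod_cast hd.ne'
  have he' : (e : ℝ) ≠ 0 := by exact_mod_cast he
  have hq : ((p ^ e : ℕ) : ℝ) = (p : ℝ) ^ (e : ℝ) := by push_cast; rw [Real.rpow_natCast]
  have hq0 : (0 : ℝ) < ((p ^ e : ℕ) : ℝ) := by rw [hq]; positivity
  refine (pow_left_inj₀ (Polynomial.gaussNorm_nonneg _ _ (by positivity)) (by positivity)
    hd.ne').1 ?_
  rw [hP _ (by positivity), ← Real.rpow_natCast (_ ^ (∑ r : solutionSet M, _)) d,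
    ← Real.rpow_mul hq0.le, Finset.sum_mul, Real.rpow_sum_of_pos hq0]
  refine Finset.prod_congr rfl fun r _ => ?_
  set A := ∑ i ∈ Finset.range (e * d), (rnorm (fracMul (p ^ i) (r : Fin n → ℚ)) : ℝ)
  have h1 : (p : ℝ) ^ (-A) * (((p ^ e : ℕ) : ℝ) ^ l) ^ d =
      ((p ^ e : ℕ) : ℝ) ^ ((l - A / (e * d : ℕ)) * d) := by
    rw [hq, ← Real.rpow_mul hp0.le, ← Real.rpow_natCast, ← Real.rpow_mul hp0.le,
      ← Real.rpow_add hp0, ← Real.rpow_mul hp0.le]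
    congr 1
    push_cast
    field_simp
    ring
  have hmono : Monotone fun x : ℝ => ((p ^ e : ℕ) : ℝ) ^ (x * d) := fun x y hxy =>
    Real.rpow_le_rpow_of_exponent_le
      (by exact_mod_cast Nat.one_le_pow e p (Fact.out : p.Prime).pos)
      (mul_le_mul_of_nonneg_right hxy (Nat.cast_nonneg d))
  rw [h1]
  have := hmono.map_max (a := 0) (b := l - A / (e * d : ℕ))
  simp only [zero_mul, Real.rpow_zero] at this
  exact this.symm

theorem finite_exists_le_eq {α : Type*} (N : ℕ) (g : ℕ → α) :
    {x | ∃ m : ℕ, m ≤ N ∧ x = g m}.Finite :=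
  ((Set.finite_Iic N).image g).subset fun _ ⟨m, hm, hx⟩ => ⟨m, hm, hx.symm⟩

theorem isOrdinary_diagonal_iff (p : ℕ) [Fact p.Prime] {F : Type*} [Field F] [Finite F]
    [CharP F p] {ζ : ℂ_[p]} (hζ : IsPrimitiveRoot ζ p) (hM : M.det ≠ 0)
    (hp : Nat.Coprime p M.det.natAbs) (a : Fin n → Fˣ) :
    IsOrdinary p ζ (diagonal M a) ↔ ∀ r ∈ solutionSet M, rnorm r = rnorm (fracMul p r) := by
  have : Fintype (solutionSet M) := (finite_solutionSet hM).fintype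
  obtain ⟨e, he, hcard⟩ : ∃ e : ℕ, e ≠ 0 ∧ Nat.card F = p ^ e := by
    have := Fintype.ofFinite F
    obtain ⟨e, -, h⟩ := FiniteField.card F p
    exact ⟨e, e.ne_zero, by rw [Nat.card_eq_fintype_card, h]⟩
  obtain ⟨P, hLP, hP0, hP⟩ := exists_polynomial_signedLSeries p hζ hM hp a hcard
  have hq : 1 < Nat.card F := by
    rw [hcard]
    exact Nat.one_lt_pow he (Fact.out : p.Prime).one_lt
  have hq' : (1 : ℝ) < Nat.card F := by exact_mod_cast hq
  have hN : e * M.det.natAbs.totient ≠ 0 :=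
    Nat.mul_ne_zero he (Nat.totient_pos.2 (Int.natAbs_pos.2 hM)).ne'
  set s : solutionSet M → ℝ := fun r => (∑ i ∈ Finset.range (e * M.det.natAbs.totient),
    (rnorm (fracMul (p ^ i) (r : Fin n → ℚ)) : ℝ)) / (e * M.det.natAbs.totient : ℕ) with hs
  have hnewton : ∀ l c : ℝ, (∀ R ∈ {R : ℝ × ℝ | ∃ k : ℕ,
      PowerSeries.coeff k (P : PowerSeries ℂ_[p]) ≠ 0 ∧
      R = ((k : ℝ), ordQ (Nat.card F) (PowerSeries.coeff k (P : PowerSeries ℂ_[p])))},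
      c ≤ R.2 - l * R.1) ↔ c ≤ -∑ r, max 0 (l - s r) := by
    intro l c
    have h := gaussNorm_eq_rpow p hM he hP l
    rw [← hcard] at h
    rw [newton_points_support_iff hq, h, Real.rpow_le_rpow_left_iff hq', le_neg]
  rw [IsOrdinary, newtonPolygon, hLP, hodgePolygon,
    lowerConvexClosure_eq_iff (finite_newton_points _ P)
      ⟨_, 0, by rw [Polynomial.coeff_coe, hP0]; exact one_ne_zero, rfl⟩
      ((finite_exists_le_eq _ _).insert _)
      (Set.insert_nonempty _ _) hnewton (hodge_points_support_iff hM a)]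
  simp only [neg_inj]
  -- From here on it is the action of p, not of q, that matters: e φ(|det M|) is a period of it, so
  -- s is the p-orbit average of |r|.
  set σ := fracMulPerm M p hp with hσ
  have hσN : σ ^ (e * M.det.natAbs.totient) = 1 := by
    rw [mul_comm, pow_mul, hσ, fracMulPerm_pow_totient, one_pow]
  have hsum : ∀ r, ((e * M.det.natAbs.totient : ℕ) : ℝ) * s r =
      ∑ i ∈ Finset.range (e * M.det.natAbs.totient),
        (rnorm ((σ ^ i) r : Fin n → ℚ) : ℝ) := fun r => by
    rw [hs, mul_div_cancel₀ _ (by exact_mod_cast hN)]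
    exact Finset.sum_congr rfl fun i _ => by rw [hσ, coe_fracMulPerm_pow]
  rw [sum_max_average_eq_iff σ (fun r => (rnorm (r : Fin n → ℚ) : ℝ)) hN hσN hsum,
    Subtype.forall]
  refine forall₂_congr fun r hr => ?_
  have h1 : (σ ⟨r, hr⟩ : Fin n → ℚ) = fracMul p r := by
    have := coe_fracMulPerm_pow hp 1 (⟨r, hr⟩ : solutionSet M)
    rwa [pow_one, pow_one] at this
  rw [h1, Rat.cast_inj, eq_comm]

/-- Passing to coordinates along the V_j identifies lattice points of the fundamental domain with
S(Δ), the representative of pu with {pr}, and the weight with the coordinate sum. -/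
theorem forall_solutionSet_iff_forall_weight (p : ℕ) {F : Type*} [Field F] (hM : M.det ≠ 0)
    (a : Fin n → Fˣ) : (∀ r ∈ solutionSet M, rnorm r = rnorm (fracMul p r)) ↔
      ∀ u : Fin n → ℤ, (fun i => (u i : ℝ)) ∈ fundamentalDomain M →
        weight (newtonPolyhedron (diagonal M a)) (fun i => (u i : ℝ)) =
          weight (newtonPolyhedron (diagonal M a))
            (latticeFract M (fun i => (p : ℝ) * (u i : ℝ))) := by
  have key : ∀ (r : Fin n → ℚ) (u : Fin n → ℤ), r ∈ solutionSet M →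
      (M.map (Int.cast : ℤ → ℚ)).mulVec r = (fun i => (u i : ℚ)) →
      (weight (newtonPolyhedron (diagonal M a)) (fun i => (u i : ℝ)) =
          weight (newtonPolyhedron (diagonal M a))
            (latticeFract M (fun i => (p : ℝ) * (u i : ℝ))) ↔
        rnorm r = rnorm (fracMul p r)) := by
    intro r u hr hu
    have h1 := coords_eq_of_mulVec hM hu
    have h2 : coords M (latticeFract M (fun i => (p : ℝ) * (u i : ℝ))) =
        fun j => ((fracMul p r j : ℚ) : ℝ) := by
      have h3 : (fun i => (p : ℝ) * (u i : ℝ)) = (p : ℝ) • fun i => (u i : ℝ) := rfl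
      rw [latticeFract, coords_mulVec hM, h3, coords_smul, h1]
      funext j
      simp only [fracMul, Pi.smul_apply, smul_eq_mul, Rat.cast_fract]
      push_cast
      rfl
    rw [weight_diagonal hM a (by rw [h1]; exact fun j => Rat.cast_nonneg.2 (hr.1 j).1),
      weight_diagonal hM a (by
        rw [h2]; exact fun j => Rat.cast_nonneg.2 (Int.fract_nonneg _)),
      h1, h2, EReal.coe_eq_coe_iff, rnorm, rnorm]
    simp only
    norm_cast
  constructor
  · intro h u hu
    obtain ⟨c, hc⟩ := exists_mulVec_eq_intCast hM u
    have hmem : c ∈ solutionSet M := ⟨fun j => by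
      have := hu j
      rw [coords_eq_of_mulVec hM hc] at this
      exact ⟨Rat.cast_nonneg.1 this.1, Rat.cast_lt.1 (this.2.trans_eq Rat.cast_one.symm)⟩, u, hc⟩
    exact (key c u hmem hc).2 (h c hmem)
  · intro h r hr
    obtain ⟨u, hu⟩ := hr.2
    refine (key r u hr hu).1 (h u fun j => ?_)
    rw [coords_eq_of_mulVec hM hu]
    exact ⟨Rat.cast_nonneg.2 (hr.1 j).1, (Rat.cast_lt.2 (hr.1 j).2).trans_eq Rat.cast_one⟩

end Ordinary

end DiagonalLaurent

end

theorem theorem3p4 (p : ℕ) [Fact p.Prime] {F : Type*} [Field F] [Finite F] [CharP F p]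
    (ζ : ℂ_[p]) (hζ : IsPrimitiveRoot ζ p)
    (n : ℕ) (M : Matrix (Fin n) (Fin n) ℤ) (hM : M.det ≠ 0) (hp : Nat.Coprime p M.det.natAbs)
    (a : Fin n → Fˣ) :
    (DiagonalLaurent.IsOrdinary p ζ (DiagonalLaurent.diagonal M a) ↔
      ∀ r ∈ DiagonalLaurent.solutionSet M,
        DiagonalLaurent.rnorm r = DiagonalLaurent.rnorm (DiagonalLaurent.fracMul p r)) ∧
    (DiagonalLaurent.IsOrdinary p ζ (DiagonalLaurent.diagonal M a) ↔
      ∀ u : Fin n → ℤ, (fun i => (u i : ℝ)) ∈ DiagonalLaurent.fundamentalDomain M →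
        DiagonalLaurent.weight
            (DiagonalLaurent.newtonPolyhedron (DiagonalLaurent.diagonal M a))
            (fun i => (u i : ℝ)) =
          DiagonalLaurent.weight
            (DiagonalLaurent.newtonPolyhedron (DiagonalLaurent.diagonal M a))
            (DiagonalLaurent.latticeFract M (fun i => (p : ℝ) * (u i : ℝ)))) := by
  have h := DiagonalLaurent.isOrdinary_diagonal_iff p hζ hM hp a
  exact ⟨h, h.trans (DiagonalLaurent.forall_solutionSet_iff_forall_weight p hM a)⟩
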